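/- Conventions. Manifolds are smooth, finite dimensional, Hausdorff and second countable, without boundary. An \emph{admissible pair} $(\mathfrak g,P)$ consists of a finite dimensional real Lie algebra $\mathfrak g$ with a decreasing filtration $\mathfrak g=\mathfrak g^{-\mu}\supset\dots\supset\mathfrak g^{0}\supset\dots\supset\mathfrak g^{\nu}$ (with $\mathfrak g^i=\mathfrak g$ for $i<-\mu$ and $\mathfrak g^i=0$ for $i>\nu$) such that $[\mathfrak g^i,\mathfrak g^j]\subset\mathfrak g^{i+j}$ for all $i,j$, a Lie group $P$ with Lie algebra $\mathfrak p=\mathfrak g^0$, and a smooth homomorphism $\mathrm{Ad}$ from $P$ to the filtration-preserving automorphisms of the Lie algebra $\mathfrak g$ whose derivative is $\mathrm{ad}|_{\mathfrak g^0}$, such that (A) no non-zero ideal of $\mathfrak g$ is contained in $\mathfrak g^0$, and (B) if $A\in\mathfrak g^0$ satisfies $[A,\mathfrak g^i]\subset\mathfrak g^{i+1}$ for $i=-\mu,\dots,-1$, then $A\in\mathfrak g^1$. Let $\mathrm{gr}(\mathfrak g)=\bigoplus_i \mathfrak g^i/\mathfrak g^{i+1}$ be the associated graded Lie algebra and $\mathfrak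 m=\bigoplus_{i<0}\mathfrak m_i$, $\mathfrak m_i=\mathfrak g^i/\mathfrak g^{i+1}$, its negative part. Let $P_+\subset P$ be the kernel of the induced action $\mathrm{Ad}_{\mathrm{gr}}$ of $P$ on $\mathrm{gr}(\mathfrak g)$, let $G_0=P/P_+$, and let $\beta:G_0\to\mathrm{Aut}_{\mathrm{gr}}(\mathfrak m)$ be the homomorphism into the automorphisms of the graded Lie algebra $\mathfrak m$ induced by $\mathrm{Ad}_{\mathrm{gr}}$. A \emph{Cartan geometry} $(p:\mathcal G\to M,\omega)$ of type $(\mathfrak g,P)$ is a principal $P$-bundle with a smooth one-form $\omega\in\Omega^1(\mathcal G,\mathfrak g)$ such that $(r^g)^*\omega=\mathrm{Ad}(g^{-1})\circ\omega$ for $g\in P$, $\omega(\zeta_X)=X$ for the fundamental vector fields $\zeta_X$, $X\in\mathfrak p$, and $\omega_u:T_u\mathcal G\to\mathfrak g$ is a linear isomorphism for every $u$. It is \emph{regular} if its curvature $K(\xi,\eta)=d\omega(\xi,\eta)+[\omega(\xi),\omega(\eta)]$ satisfies $K_u(\xi,\eta)\in\mathfrak g^{i+j+1}$ whenever $\omega_u(\xi)\in\mathfrak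 g^i$ and $\omega_u(\eta)\in\mathfrak g^j$. A \emph{filtered manifold} is a manifold $M$ with a filtration $TM=T^{-\mu}M\supset\dots\supset T^{-1}M$ by smooth subbundles (with $T^iM=TM$ for $i<-\mu$ and $T^iM=0$ for $i\ge 0$) such that brackets of sections of $T^iM$ and $T^jM$ are sections of $T^{i+j}M$. Then $\mathrm{gr}(T_xM)=\bigoplus_{i<0} T^i_xM/T^{i+1}_xM$ is a graded Lie algebra under the Levi bracket, which is induced by the bracket of vector fields. The filtered manifold is \emph{regular of type $\mathfrak m$} if, locally on $M$, there are smooth trivializations $T^iM/T^{i+1}M\to U\times\mathfrak m_i$, $i<0$, which at each point form an isomorphism of graded Lie algebras. In this case, let $\mathcal PM\to M$ be the frame bundle of $\mathrm{gr}(TM)$, with fibre at $x$ the set of isomorphisms $\mathfrak m\to\mathrm{gr}(T_xM)$ of graded Lie algebras; $\mathrm{Aut}_{\mathrm{gr}}(\mathfrak m)$ acts on it by composition from the right. A \emph{filtered $G_0$-structure} on $M$ (with respect to $\beta$, which has to be smooth with injective derivative at the identity) is a principal $G_0$-bundle $\mathcal G_0\to M$ with a smooth bundle map $\Phi:\mathcal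 G_0\to\mathcal PM$ over $\mathrm{id}_M$ such that $\Phi(w\cdot g)=\Phi(w)\cdot\beta(g)$ for all $w\in\mathcal G_0$ and $g\in G_0$. \textbf{Theorem.} Let $(\mathfrak g,P)$ be an admissible pair and let $(p:\mathcal G\to M,\omega)$ be a regular Cartan geometry of type $(\mathfrak g,P)$. (1) There is a filtration $\{T^iM\}$ of $TM$ such that $T^i_{p(u)}M=T_up\big(\omega_u^{-1}(\mathfrak g^i)\big)$ for every $u\in\mathcal G$ and every $i$. It makes $M$ into a filtered manifold which is regular of type $\mathfrak m$. (2) The group $G_0=P/P_+$ carries a Lie group structure and the orbit space $\mathcal G_0=\mathcal G/P_+$ carries a manifold structure (on the quotient topologies) for which the projections $P\to G_0$ and $\mathcal G\to\mathcal G_0$ are smooth submersions. The homomorphism $\beta$ is smooth with injective derivative at the identity, the induced projection $\mathcal G_0\to M$ is a principal $G_0$-bundle, and there is a map $\Phi:\mathcal G_0\to\mathcal PM$ such that, for $u\in\mathcal G$ and $i<0$, the isomorphism $\Phi(u\cdot P_+)$ sends the class in $\mathfrak m_i$ of $\omega_u(\xi)\in\mathfrak g^i$ to the class of $T_up(\xi)$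 in $T^i_{p(u)}M/T^{i+1}_{p(u)}M$ for all $\xi\in\omega_u^{-1}(\mathfrak g^i)$. The bundle $\mathcal G_0\to M$ and the map $\Phi$ form a filtered $G_0$-structure on $M$. -/

import Mathlib

open scoped Manifold ContDiff

namespace FilteredGeometry

open VectorField MulOpposite

/-! ### Smooth maps into finite dimensional vector spaces -/

section Smoothness

variable (E : Type*) [NormedAddCommGroup E] [NormedSpace ℝ E]
  {N : Type*} [TopologicalSpace N] [ChartedSpace E N]
  {W : Type*} [AddCommGroup W] [Module ℝ W]

/-- A map `f` from a manifold `N` modelled on `E` into a finite dimensional real vector space is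
smooth on `s` if its composite with every linear functional is. (No norm on `W` is chosen.) -/
def SmoothOn (f : N → W) (s : Set N) : Prop :=
  ∀ l : Module.Dual ℝ W, ContMDiffOn 𝓘(ℝ, E) 𝓘(ℝ, ℝ) ∞ (fun y => l (f y)) s

/-- The derivative at `x`, in the direction of the tangent vector `v`, of a map `f` into a finite
dimensional real vector space, computed in the coordinates of a basis (the result does not depend
on the basis). -/
noncomputable def derivAlong [FiniteDimensional ℝ W] (f : N → W) (x : N)
    (v : TangentSpace 𝓘(ℝ, E) x) : W :=
  ∑ k, (show ℝ from mfderiv 𝓘(ℝ, E) 𝓘(ℝ, ℝ) (fun y => (Module.finBasis ℝ W).coord k (f y)) x v) •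
    Module.finBasis ℝ W k

/-- `ξ` is a smooth vector field on `U`. -/
def SmoothFieldOn [IsManifold 𝓘(ℝ, E) ∞ N] (ξ : ∀ x : N, TangentSpace 𝓘(ℝ, E) x) (U : Set N) : Prop :=
  ContMDiffOn 𝓘(ℝ, E) 𝓘(ℝ, E).tangent ∞ (fun x => (⟨x, ξ x⟩ : TangentBundle 𝓘(ℝ, E) N)) U

/-- `f` is a smooth submersion. -/
def SmoothSubmersion (E' : Type*) [NormedAddCommGroup E'] [NormedSpace ℝ E']
    {N' : Type*} [TopologicalSpace N'] [ChartedSpace E' N'] (f : N → N') : Prop :=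
  ContMDiff 𝓘(ℝ, E) 𝓘(ℝ, E') ∞ f ∧
    ∀ x, Function.Surjective (mfderiv 𝓘(ℝ, E) 𝓘(ℝ, E') f x)

/-- `ξ` is a smooth local section, over the open set `U`, of the distribution `D`. -/
structure IsLocalSection [IsManifold 𝓘(ℝ, E) ∞ N] (D : ∀ x : N, Submodule ℝ (TangentSpace 𝓘(ℝ, E) x))
    (ξ : ∀ x : N, TangentSpace 𝓘(ℝ, E) x) (U : Set N) : Prop where
  isOpen : IsOpen U
  smooth : SmoothFieldOn E ξ U
  mem : ∀ x ∈ U, ξ x ∈ D x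

/-- The distribution `D` is a smooth subbundle of the tangent bundle: it has smooth local
frames. -/
def IsSmoothSubbundle [IsManifold 𝓘(ℝ, E) ∞ N] (D : ∀ x : N, Submodule ℝ (TangentSpace 𝓘(ℝ, E) x)) : Prop :=
  ∀ x : N, ∃ (U : Set N) (r : ℕ) (e : Fin r → ∀ y : N, TangentSpace 𝓘(ℝ, E) y),
    x ∈ U ∧ (∀ a, IsLocalSection E D (e a) U) ∧
      ∀ y ∈ U, LinearIndependent ℝ (fun a => e a y) ∧
        Submodule.span ℝ (Set.range fun a => e a y) = D y

end Smoothness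

/-! ### Filtered Lie algebras and their associated graded -/

/-- The component `F i / F (i + 1)` of the associated graded of a decreasing filtration. -/
abbrev Gr {V : Type*} [AddCommGroup V] [Module ℝ V] (F : ℤ → Submodule ℝ V) (i : ℤ) : Type _ :=
  (F i) ⧸ (F (i + 1)).submoduleOf (F i)

/-- The class in `F i / F (i + 1)` of an element of `F i`. -/
def Gr.mk {V : Type*} [AddCommGroup V] [Module ℝ V] {F : ℤ → Submodule ℝ V} {i : ℤ} {v : V}
    (h : v ∈ F i) : Gr F i :=
  Submodule.Quotient.mk ⟨v, h⟩

/-- A filtration `𝔤 = 𝔤^{-μ} ⊇ … ⊇ 𝔤^ν` making `𝔤` into a filtered Lie algebra, continued by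
`𝔤` below `-μ` and by `0` above `ν`. -/
structure LieFiltration (𝔤 : Type*) [LieRing 𝔤] [LieAlgebra ℝ 𝔤] (μ ν : ℕ) where
  F : ℤ → Submodule ℝ 𝔤
  antitone : Antitone F
  top : ∀ i : ℤ, i ≤ -(μ : ℤ) → F i = ⊤
  bot : ∀ i : ℤ, (ν : ℤ) < i → F i = ⊥
  lie_mem : ∀ (i j : ℤ) (x y : 𝔤), x ∈ F i → y ∈ F j → ⁅x, y⁆ ∈ F (i + j)

section Graded

variable {𝔤 : Type*} [LieRing 𝔤] [LieAlgebra ℝ 𝔤] {μ ν : ℕ}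

/-- The bracket on representatives, as a map `𝔤^i × 𝔤^j → gr_{i+j}(𝔤)`. -/
def LieFiltration.preBracket (S : LieFiltration 𝔤 μ ν) (i j : ℤ) :
    S.F i →ₗ[ℝ] S.F j →ₗ[ℝ] Gr S.F (i + j) :=
  LinearMap.mk₂ ℝ (fun x y => Gr.mk (S.lie_mem i j x y x.2 y.2))
    (fun x x' y => by
      simp only [Gr.mk, ← Submodule.Quotient.mk_add]; congr 1; ext; simp)
    (fun c x y => by
      simp only [Gr.mk, ← Submodule.Quotient.mk_smul]; congr 1; ext; simp)
    (fun x y y' => by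
      simp only [Gr.mk, ← Submodule.Quotient.mk_add]; congr 1; ext; simp)
    (fun c x y => by
      simp only [Gr.mk, ← Submodule.Quotient.mk_smul]; congr 1; ext; simp)

/-- The bracket `gr_i(𝔤) × gr_j(𝔤) → gr_{i+j}(𝔤)` of the associated graded Lie algebra, induced
by the bracket of `𝔤`. -/
def LieFiltration.grBracket (S : LieFiltration 𝔤 μ ν) (i j : ℤ) :
    Gr S.F i →ₗ[ℝ] Gr S.F j →ₗ[ℝ] Gr S.F (i + j) :=
  Submodule.liftQ _
    { toFun := fun x => Submodule.liftQ _ (S.preBracket i j x) (by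
        intro y hy
        rw [LinearMap.mem_ker]
        refine (Submodule.Quotient.mk_eq_zero _).2 ?_
        have h := S.lie_mem i (j + 1) x y x.2 hy
        rw [← add_assoc] at h
        exact h)
      map_add' := fun x x' => by
        apply Submodule.linearMap_qext; ext y; simp
      map_smul' := fun c x => by
        apply Submodule.linearMap_qext; ext y; simp }
    (by
      intro x hx
      rw [LinearMap.mem_ker]
      apply Submodule.linearMap_qext
      ext y
      refine (Submodule.Quotient.mk_eq_zero _).2 ?_
      have h := S.lie_mem (i + 1) j x y hx y.2
      rw [add_right_comm] at h
      exact h)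

theorem LieFiltration.grBracket_mk (S : LieFiltration 𝔤 μ ν) (i j : ℤ) {x y : 𝔤}
    (hx : x ∈ S.F i) (hy : y ∈ S.F j) :
    S.grBracket i j (Gr.mk hx) (Gr.mk hy) = Gr.mk (S.lie_mem i j x y hx hy) := rfl

/-- The degrees of the negative part of a graded Lie algebra. -/
abbrev NegInt : Type := {i : ℤ // i < 0}

instance : Add NegInt := ⟨fun i j => ⟨i.1 + j.1, add_neg i.2 j.2⟩⟩

/-- The group `Aut_gr(𝔪)` of automorphisms of the Lie algebra `𝔪 = ⊕_{i<0} gr_i(𝔤)` (the negative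
part of the associated graded) which preserve the grading. Such an automorphism is a family of
linear automorphisms of the components `gr_i(𝔤)`, `i < 0`, compatible with the brackets. -/
def LieFiltration.AutGr (S : LieFiltration 𝔤 μ ν) :
    Subgroup (∀ i : NegInt, Gr S.F i ≃ₗ[ℝ] Gr S.F i) where
  carrier := {a | ∀ (i j : NegInt) (x : Gr S.F i) (y : Gr S.F j),
    a (i + j) (S.grBracket i j x y) = S.grBracket i j (a i x) (a j y)}
  mul_mem' := fun {a b} ha hb i j x y => by
    change a (i + j) (b (i + j) _) = S.grBracket i j (a i (b i x)) (a j (b j y))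
    rw [hb, ha]
  one_mem' := fun i j x y => rfl
  inv_mem' := fun {a} ha i j x y => by
    change (a (i + j)).symm _ = S.grBracket i j ((a i).symm x) ((a j).symm y)
    rw [LinearEquiv.symm_apply_eq, ha, LinearEquiv.apply_symm_apply, LinearEquiv.apply_symm_apply]

end Graded

/-! ### Filtered manifolds -/

section FilteredManifold

variable (E : Type*) [NormedAddCommGroup E] [NormedSpace ℝ E]
  {M : Type*} [TopologicalSpace M] [ChartedSpace E M] [IsManifold 𝓘(ℝ, E) ∞ M]

/-- A filtration of `TM` by smooth subbundles `TM = T^{-μ}M ⊇ … ⊇ T^{-1}M`, with `T^i M = TM`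
below `-μ` and `T^i M = 0` for `i ≥ 0`, making `M` into a filtered manifold. -/
structure IsFilteredManifold (μ : ℕ) (T : ℤ → ∀ x : M, Submodule ℝ (TangentSpace 𝓘(ℝ, E) x)) :
    Prop where
  antitone : ∀ x, Antitone fun i => T i x
  top : ∀ i : ℤ, i ≤ -(μ : ℤ) → ∀ x, T i x = ⊤
  bot : ∀ i : ℤ, 0 ≤ i → ∀ x, T i x = ⊥
  smooth : ∀ i, IsSmoothSubbundle E (T i)
  bracket : ∀ (i j : ℤ) (U : Set M) (ξ η : ∀ x : M, TangentSpace 𝓘(ℝ, E) x),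
    IsLocalSection E (T i) ξ U → IsLocalSection E (T j) η U →
      ∀ x ∈ U, mlieBracket 𝓘(ℝ, E) ξ η x ∈ T (i + j) x

variable {𝔤 : Type*} [LieRing 𝔤] [LieAlgebra ℝ 𝔤] {μ ν : ℕ}
  (S : LieFiltration 𝔤 μ ν) (T : ℤ → ∀ x : M, Submodule ℝ (TangentSpace 𝓘(ℝ, E) x))

/-- The component `gr_i(T_x M) = T^i_x M / T^{i+1}_x M`. -/
abbrev GrT (x : M) (i : ℤ) : Type _ := Gr (fun k => T k x) i

/-- The graded linear map `ψ : gr(T_x M) → 𝔪` intertwines the Levi bracket at `x` with the bracket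
of `𝔪`. The Levi bracket of the classes of `ξ x` and `η x`, for local sections `ξ` of `T^i M` and
`η` of `T^j M`, is the class of `[ξ, η] x` in `gr_{i+j}(T_x M)`. -/
def IntertwinesLevi (x : M) (ψ : ∀ i : NegInt, GrT E T x i →ₗ[ℝ] Gr S.F i) : Prop :=
  ∀ (i j : NegInt) (U : Set M) (ξ η : ∀ x : M, TangentSpace 𝓘(ℝ, E) x) (hx : x ∈ U)
    (hξ : IsLocalSection E (T i) ξ U) (hη : IsLocalSection E (T j) η U),
    ∃ h : mlieBracket 𝓘(ℝ, E) ξ η x ∈ T (i + j) x,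
      ψ (i + j) (Gr.mk (F := fun k => T k x) h) =
        S.grBracket i j (ψ i (Gr.mk (F := fun k => T k x) (hξ.mem x hx)))
          (ψ j (Gr.mk (F := fun k => T k x) (hη.mem x hx)))

/-- A smooth local trivialization `gr_i(TM)|_U → U × 𝔪_i`, `i < 0`, by isomorphisms of graded Lie
algebras. Smoothness of the bundle map `gr_i(TM)|_U → U × 𝔪_i` means that smooth local sections of
`T^i M` go to smooth `𝔪_i`-valued functions. (The values of `φ` off `U` are irrelevant.) -/
structure IsLocalTriv (U : Set M)
    (φ : ∀ (y : M) (i : NegInt), GrT E T y i →ₗ[ℝ] Gr S.F i) : Prop where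
  isOpen : IsOpen U
  bijective : ∀ y ∈ U, ∀ i, Function.Bijective (φ y i)
  smooth : ∀ (i : NegInt) (V : Set M) (ξ : ∀ x : M, TangentSpace 𝓘(ℝ, E) x)
    (hξ : IsLocalSection E (T i) ξ V) (f : M → Gr S.F i),
    (∀ (y : M) (hy : y ∈ V), f y = φ y i (Gr.mk (F := fun k => T k y) (hξ.mem y hy))) →
      SmoothOn E f (U ∩ V)
  levi : ∀ y ∈ U, IntertwinesLevi E S T y (φ y)

/-- The filtration `T` is regular of type `𝔪`, where `𝔪` is the negative part of `gr(𝔤)`. -/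
def IsRegularOfType : Prop :=
  ∀ x : M, ∃ (U : Set M) (φ : ∀ (y : M) (i : NegInt), GrT E T y i →ₗ[ℝ] Gr S.F i),
    x ∈ U ∧ IsLocalTriv E S T U φ

/-- The fibre at `x` of the natural frame bundle `𝒫M` of `gr(TM)`: isomorphisms
`𝔪 → gr(T_x M)` of graded Lie algebras. -/
structure GradedFrame (x : M) where
  toEquiv : ∀ i : NegInt, Gr S.F i ≃ₗ[ℝ] GrT E T x i
  levi : IntertwinesLevi E S T x (fun i => (toEquiv i).symm.toLinearMap)

/-- The natural frame bundle `𝒫M` of `gr(TM)`. -/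
abbrev FrameBundle : Type _ := Σ x : M, GradedFrame E S T x

variable {E S T}

/-- The right action of `Aut_gr(𝔪)` on `𝒫M`, by composition from the right. -/
noncomputable def FrameBundle.act (w : FrameBundle E S T) (a : S.AutGr) : FrameBundle E S T :=
  ⟨w.1,
    { toEquiv := fun i => (a.1 i).trans (w.2.toEquiv i)
      levi := by
        intro i j U ξ η hx hξ hη
        obtain ⟨h, e⟩ := w.2.levi i j U ξ η hx hξ hη
        refine ⟨h, ?_⟩
        have ha := (a⁻¹).2 i j
        change ∀ x y, (a.1 (i + j)).symm (S.grBracket i j x y) =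
          S.grBracket i j ((a.1 i).symm x) ((a.1 j).symm y) at ha
        simp only [LinearEquiv.coe_coe, LinearEquiv.trans_symm, LinearEquiv.trans_apply] at e ⊢
        rw [e, ha] }⟩

end FilteredManifold

/-! ### Principal bundles -/

section Principal

variable (E_B E_K E_M : Type*) [NormedAddCommGroup E_B] [NormedSpace ℝ E_B]
  [NormedAddCommGroup E_K] [NormedSpace ℝ E_K] [NormedAddCommGroup E_M] [NormedSpace ℝ E_M]
  (K : Type*) [Group K] [TopologicalSpace K] [ChartedSpace E_K K]
  {B : Type*} [TopologicalSpace B] [ChartedSpace E_B B] [MulAction Kᵐᵒᵖ B]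
  {M : Type*} [TopologicalSpace M] [ChartedSpace E_M M]

/-- `π : B → M` is a smooth principal bundle with structure group `K`. The right action
`u · g` is written `op g • u`. -/
structure IsPrincipalBundle (π : B → M) : Prop where
  smooth_proj : ContMDiff 𝓘(ℝ, E_B) 𝓘(ℝ, E_M) ∞ π
  smooth_act : ContMDiff (𝓘(ℝ, E_B).prod 𝓘(ℝ, E_K)) 𝓘(ℝ, E_B) ∞ fun q : B × K => op q.2 • q.1
  proj_act : ∀ (u : B) (g : K), π (op g • u) = π u
  locallyTrivial : ∀ x : M, ∃ (U : Set M) (χ : OpenPartialHomeomorph B (M × K)),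
    IsOpen U ∧ x ∈ U ∧ χ.source = π ⁻¹' U ∧ χ.target = U ×ˢ Set.univ ∧
    ContMDiffOn 𝓘(ℝ, E_B) (𝓘(ℝ, E_M).prod 𝓘(ℝ, E_K)) ∞ χ χ.source ∧
    ContMDiffOn (𝓘(ℝ, E_M).prod 𝓘(ℝ, E_K)) 𝓘(ℝ, E_B) ∞ χ.symm χ.target ∧
    ∀ u ∈ χ.source, (χ u).1 = π u ∧ ∀ g : K, χ (op g • u) = ((χ u).1, (χ u).2 * g)

end Principal

/-! ### The orbit space of a normal subgroup of the structure group -/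

section OrbitSpace

variable {P : Type*} [Group P]

/-- The orbit space `B / N` of the right action of a subgroup `N ⊆ P` on `B`. -/
def OrbitSpace (N : Subgroup P) (B : Type*) [MulAction Pᵐᵒᵖ B] : Type _ :=
  Quotient (MulAction.orbitRel N.op B)

namespace OrbitSpace

variable (N : Subgroup P) {B : Type*} [MulAction Pᵐᵒᵖ B]

/-- The orbit of `u`. -/
def mk (u : B) : OrbitSpace N B := Quotient.mk (MulAction.orbitRel N.op B) u

instance [TopologicalSpace B] : TopologicalSpace (OrbitSpace N B) :=
  inferInstanceAs (TopologicalSpace (Quotient (MulAction.orbitRel N.op B)))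

theorem mk_act (u : B) {n : P} (hn : n ∈ N) : mk N (op n • u) = mk N u :=
  Quotient.sound ⟨⟨op n, hn⟩, rfl⟩

/-- The right action of `P / N` on `B / N`: `[u] · [g] = [u · g]`. -/
instance [N.Normal] : MulAction (P ⧸ N)ᵐᵒᵖ (OrbitSpace N B) where
  smul q w := Quotient.liftOn₂ (s₁ := QuotientGroup.leftRel N) (s₂ := MulAction.orbitRel N.op B)
    q.unop w (fun g u => mk N (op g • u)) (by
      rintro g u g' u' hg ⟨⟨n, hn⟩, hu⟩
      change QuotientGroup.leftRel N g g' at hg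
      have hg' : g⁻¹ * g' ∈ N := QuotientGroup.leftRel_apply.1 hg
      have hu' : n • u' = u := hu
      have hn' : n.unop ∈ N := hn
      have h1 : (g⁻¹ * g')⁻¹ * (g⁻¹ * n.unop * g) ∈ N := by
        refine N.mul_mem (N.inv_mem hg') ?_
        have := ‹N.Normal›.conj_mem n.unop hn' g⁻¹
        rwa [inv_inv] at this
      have h2 := mk_act N (op g' • u') h1
      rw [← h2, ← hu', smul_smul, smul_smul]
      congr 2
      apply unop_injective
      simp [mul_assoc])
  one_smul w := by
    induction w using Quotient.inductionOn with
    | h u =>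
      change mk N (op (1 : P) • u) = mk N u
      rw [op_one, one_smul]
  mul_smul a b w := by
    induction a using MulOpposite.rec' with
    | h a =>
    induction b using MulOpposite.rec' with
    | h b =>
    induction a using QuotientGroup.induction_on with
    | H a =>
    induction b using QuotientGroup.induction_on with
    | H b =>
    induction w using Quotient.inductionOn with
    | h u =>
      change mk N (op (b * a) • u) = mk N (op a • op b • u)
      rw [op_mul, mul_smul]

theorem op_mk_smul_mk [N.Normal] (g : P) (u : B) :
    op (g : P ⧸ N) • mk N u = mk N (op g • u) := rfl

end OrbitSpace

end OrbitSpace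

/-! ### Filtered `G₀`-structures -/

section FilteredStructure

variable (E E_B E_K : Type*) [NormedAddCommGroup E] [NormedSpace ℝ E]
  [NormedAddCommGroup E_B] [NormedSpace ℝ E_B] [NormedAddCommGroup E_K] [NormedSpace ℝ E_K]
  {M : Type*} [TopologicalSpace M] [ChartedSpace E M] [IsManifold 𝓘(ℝ, E) ∞ M]
  {K : Type*} [Group K] [TopologicalSpace K] [ChartedSpace E_K K]
  {B : Type*} [TopologicalSpace B] [ChartedSpace E_B B] [MulAction Kᵐᵒᵖ B]
  {𝔤 : Type*} [LieRing 𝔤] [LieAlgebra ℝ 𝔤] [FiniteDimensional ℝ 𝔤] {μ ν : ℕ}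

/-- `β : K → Aut_gr(𝔪)` is a homomorphism of Lie groups whose derivative at the identity is
injective. As `Aut_gr(𝔪)` is a closed subgroup of the product of the groups `GL(𝔪_i)`, smoothness
and derivatives are those of the functions `g ↦ β g X`, `X ∈ 𝔪_i`. -/
structure IsInfInjective (S : LieFiltration 𝔤 μ ν) (β : K →* S.AutGr) : Prop where
  smooth : ∀ (i : NegInt) (X : Gr S.F i), SmoothOn E_K (fun g => (β g).1 i X) Set.univ
  injective : ∀ v : TangentSpace 𝓘(ℝ, E_K) (1 : K),
    (∀ (i : NegInt) (X : Gr S.F i), derivAlong E_K (fun g => (β g).1 i X) 1 v = 0) → v = 0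

/-- `π : B → M` with `Φ : B → 𝒫M` is a filtered `K`-structure on the filtered manifold `(M, T)`,
regular of type `𝔪`: a reduction of structure group of `𝒫M` along `β : K → Aut_gr(𝔪)`.
The smooth structure of `𝒫M` is given by its local trivializations
`𝒫M|_U ≅ U × Aut_gr(𝔪)`, which come from those of `gr(TM)`; so smoothness of `Φ` means that in
each of them its second component is a smooth map into `Aut_gr(𝔪) ⊆ ∏ GL(𝔪_i)`. -/
structure IsFilteredStructure (S : LieFiltration 𝔤 μ ν)
    (T : ℤ → ∀ x : M, Submodule ℝ (TangentSpace 𝓘(ℝ, E) x))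
    (β : K →* S.AutGr) (π : B → M) (Φ : B → FrameBundle E S T) : Prop where
  infInjective : IsInfInjective E_K S β
  principal : IsPrincipalBundle E_B E_K E K π
  covers : ∀ w, (Φ w).1 = π w
  equivariant : ∀ (w : B) (g : K), Φ (op g • w) = (Φ w).act (β g)
  smooth : ∀ (U : Set M) (φ : ∀ (y : M) (i : NegInt), GrT E T y i →ₗ[ℝ] Gr S.F i),
    IsLocalTriv E S T U φ → ∀ (i : NegInt) (X : Gr S.F i),
      SmoothOn E_B (fun w => φ (Φ w).1 i ((Φ w).2.toEquiv i X)) (π ⁻¹' U)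

end FilteredStructure

/-! ### Admissible pairs -/

section Admissible

/-- An admissible pair `(𝔤, P)`. -/
structure AdmissiblePair (𝔤 : Type*) [LieRing 𝔤] [LieAlgebra ℝ 𝔤] [FiniteDimensional ℝ 𝔤]
    (E_P : Type*) [NormedAddCommGroup E_P] [NormedSpace ℝ E_P]
    (P : Type*) [Group P] [TopologicalSpace P] [ChartedSpace E_P P] (μ ν : ℕ) where
  /-- The filtration of `𝔤`. -/
  S : LieFiltration 𝔤 μ ν
  /-- The identification of the Lie algebra of `P` with the subalgebra `𝔭 = 𝔤^0` of `𝔤`. -/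
  ι : GroupLieAlgebra 𝓘(ℝ, E_P) P →ₗ[ℝ] 𝔤
  ι_injective : Function.Injective ι
  ι_range : LinearMap.range ι = S.F 0
  ι_lie : ∀ X Y : GroupLieAlgebra 𝓘(ℝ, E_P) P, ι ⁅X, Y⁆ = ⁅ι X, ι Y⁆
  /-- The homomorphism `Ad : P → Aut_f(𝔤)`. -/
  Ad : P →* (𝔤 ≃ₗ[ℝ] 𝔤)
  Ad_lie : ∀ (g : P) (X Y : 𝔤), Ad g ⁅X, Y⁆ = ⁅Ad g X, Ad g Y⁆
  Ad_mem : ∀ (g : P) (i : ℤ) (X : 𝔤), X ∈ S.F i → Ad g X ∈ S.F i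
  Ad_smooth : ∀ X : 𝔤, SmoothOn E_P (fun g => Ad g X) Set.univ
  Ad_deriv : ∀ (A : GroupLieAlgebra 𝓘(ℝ, E_P) P) (X : 𝔤),
    derivAlong E_P (fun g => Ad g X) 1 A = ⁅ι A, X⁆
  /-- Infinitesimal effectivity. -/
  effective : ∀ J : LieIdeal ℝ 𝔤, J.toSubmodule ≤ S.F 0 → J = ⊥
  mem_one : ∀ A ∈ S.F 0,
    (∀ i : ℤ, -(μ : ℤ) ≤ i → i ≤ -1 → ∀ X ∈ S.F i, ⁅A, X⁆ ∈ S.F (i + 1)) → A ∈ S.F 1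

variable {𝔤 : Type*} [LieRing 𝔤] [LieAlgebra ℝ 𝔤] [FiniteDimensional ℝ 𝔤]
  {E_P : Type*} [NormedAddCommGroup E_P] [NormedSpace ℝ E_P]
  {P : Type*} [Group P] [TopologicalSpace P] [ChartedSpace E_P P] {μ ν : ℕ}
  (A : AdmissiblePair 𝔤 E_P P μ ν)

namespace AdmissiblePair

/-- The map `gr_i(𝔤) → gr_i(𝔤)` induced by `Ad g`. -/
def adGrMap (i : ℤ) (g : P) : Gr A.S.F i →ₗ[ℝ] Gr A.S.F i :=
  Submodule.mapQ _ _ ((A.Ad g).toLinearMap.restrict (A.Ad_mem g i))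
    (fun X hX => A.Ad_mem g (i + 1) X hX)

theorem adGrMap_mk (i : ℤ) (g : P) {X : 𝔤} (hX : X ∈ A.S.F i) :
    A.adGrMap i g (Gr.mk hX) = Gr.mk (A.Ad_mem g i X hX) := rfl

theorem adGrMap_one (i : ℤ) (x : Gr A.S.F i) : A.adGrMap i 1 x = x := by
  obtain ⟨⟨X, hX⟩, rfl⟩ := Submodule.Quotient.mk_surjective _ x
  change Submodule.Quotient.mk _ = Submodule.Quotient.mk _
  congr 1
  ext
  simp

theorem adGrMap_mul (i : ℤ) (g h : P) (x : Gr A.S.F i) :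
    A.adGrMap i (g * h) x = A.adGrMap i g (A.adGrMap i h x) := by
  obtain ⟨⟨X, hX⟩, rfl⟩ := Submodule.Quotient.mk_surjective _ x
  change Submodule.Quotient.mk _ = Submodule.Quotient.mk _
  congr 1
  ext
  simp

/-- The degree `i` component of `Ad_gr : P → Aut_gr(gr(𝔤))`. -/
def adGr (i : ℤ) : P →* (Gr A.S.F i ≃ₗ[ℝ] Gr A.S.F i) where
  toFun g := LinearEquiv.ofLinearMap (A.adGrMap i g) (A.adGrMap i g⁻¹)
    (by
      refine LinearMap.ext fun x => ?_
      change A.adGrMap i g (A.adGrMap i g⁻¹ x) = x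
      rw [← adGrMap_mul, mul_inv_cancel, adGrMap_one])
    (by
      refine LinearMap.ext fun x => ?_
      change A.adGrMap i g⁻¹ (A.adGrMap i g x) = x
      rw [← adGrMap_mul, inv_mul_cancel, adGrMap_one])
  map_one' := LinearEquiv.ext fun x => A.adGrMap_one i x
  map_mul' g h := LinearEquiv.ext fun x => A.adGrMap_mul i g h x

theorem adGr_mk (i : ℤ) (g : P) {X : 𝔤} (hX : X ∈ A.S.F i) :
    A.adGr i g (Gr.mk hX) = Gr.mk (A.Ad_mem g i X hX) := rfl

/-- The subgroup `P_+ ⊆ P`, the kernel of `Ad_gr : P → Aut_gr(gr(𝔤))`. -/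
def Pplus : Subgroup P := ⨅ i : ℤ, (A.adGr i).ker

instance : A.Pplus.Normal := Subgroup.normal_iInf_normal fun _ => inferInstance

/-- The restriction of `Ad_gr` to the negative part, `P → Aut_gr(𝔪)`. -/
def adNeg : P →* A.S.AutGr where
  toFun g := ⟨fun i => A.adGr i g, by
    intro i j x y
    obtain ⟨⟨X, hX⟩, rfl⟩ := Submodule.Quotient.mk_surjective _ x
    obtain ⟨⟨Y, hY⟩, rfl⟩ := Submodule.Quotient.mk_surjective _ y
    change Submodule.Quotient.mk _ = Submodule.Quotient.mk _
    congr 1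
    ext
    exact A.Ad_lie g X Y⟩
  map_one' := Subtype.ext (funext fun i => (A.adGr i).map_one)
  map_mul' g h := Subtype.ext (funext fun i => (A.adGr i).map_mul g h)

/-- The homomorphism `β : G₀ = P / P_+ → Aut_gr(𝔪)` induced by `Ad_gr`. -/
def beta : P ⧸ A.Pplus →* A.S.AutGr :=
  QuotientGroup.lift A.Pplus A.adNeg fun _ hg =>
    Subtype.ext (funext fun i => (Subgroup.mem_iInf.1 hg (i : ℤ)))

end AdmissiblePair

/-! ### Cartan geometries -/

variable {E_M : Type*} [NormedAddCommGroup E_M] [NormedSpace ℝ E_M]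
  {M : Type*} [TopologicalSpace M] [ChartedSpace E_M M]
  {E_B : Type*} [NormedAddCommGroup E_B] [NormedSpace ℝ E_B]
  {B : Type*} [TopologicalSpace B] [ChartedSpace E_B B] [IsManifold 𝓘(ℝ, E_B) ∞ B]
  [MulAction Pᵐᵒᵖ B]

/-- `(π : B → M, θ)` is a Cartan geometry of type `(𝔤, P)`. -/
structure IsCartanGeometry (π : B → M) (θ : ∀ u : B, TangentSpace 𝓘(ℝ, E_B) u →ₗ[ℝ] 𝔤) :
    Prop where
  principal : IsPrincipalBundle E_B E_P E_M P π
  smooth : ∀ (U : Set B) (ξ : ∀ u : B, TangentSpace 𝓘(ℝ, E_B) u), IsOpen U →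
    SmoothFieldOn E_B ξ U → SmoothOn E_B (fun u => θ u (ξ u)) U
  equivariant : ∀ (g : P) (u : B) (ξ : TangentSpace 𝓘(ℝ, E_B) u),
    θ (op g • u) (mfderiv 𝓘(ℝ, E_B) 𝓘(ℝ, E_B) (fun w : B => op g • w) u ξ) = A.Ad g⁻¹ (θ u ξ)
  /-- The fundamental field of `X` at `u` is the derivative of `g ↦ u · g` at `1` applied
  to `X`. -/
  fundamental : ∀ (X : GroupLieAlgebra 𝓘(ℝ, E_P) P) (u : B),
    θ (op (1 : P) • u) (mfderiv 𝓘(ℝ, E_P) 𝓘(ℝ, E_B) (fun g : P => op g • u) 1 X) = A.ι X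
  bijective : ∀ u, Function.Bijective (θ u)

/-- The curvature `K(ξ, η) = dθ(ξ, η) + [θ(ξ), θ(η)]` on vector fields, where
`dθ(ξ, η) = ξ · θ(η) - η · θ(ξ) - θ([ξ, η])`. -/
noncomputable def curvature (θ : ∀ u : B, TangentSpace 𝓘(ℝ, E_B) u →ₗ[ℝ] 𝔤)
    (ξ η : ∀ u : B, TangentSpace 𝓘(ℝ, E_B) u) (u : B) : 𝔤 :=
  derivAlong E_B (fun w => θ w (η w)) u (ξ u) - derivAlong E_B (fun w => θ w (ξ w)) u (η u)
    - θ u (mlieBracket 𝓘(ℝ, E_B) ξ η u) + ⁅θ u (ξ u), θ u (η u)⁆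

/-- Regularity: `K_u(ξ, η) ∈ 𝔤^{i+j+1}` whenever `θ_u(ξ) ∈ 𝔤^i` and `θ_u(η) ∈ 𝔤^j`. The tangent
vectors are the values at `u` of vector fields defined near `u`, on which alone `K_u` depends. -/
def IsRegular (S : LieFiltration 𝔤 μ ν) (θ : ∀ u : B, TangentSpace 𝓘(ℝ, E_B) u →ₗ[ℝ] 𝔤) : Prop :=
  ∀ (i j : ℤ) (U : Set B) (ξ η : ∀ u : B, TangentSpace 𝓘(ℝ, E_B) u), IsOpen U →
    SmoothFieldOn E_B ξ U → SmoothFieldOn E_B η U →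
      ∀ u ∈ U, θ u (ξ u) ∈ S.F i → θ u (η u) ∈ S.F j → curvature θ ξ η u ∈ S.F (i + j + 1)

end Admissible

end FilteredGeometry

open FilteredGeometry

open scoped Manifold ContDiff Topology

namespace FilteredGeometry

/-! ### Calculus of smooth maps into finite dimensional vector spaces -/

section SmoothCalculus

variable {E : Type*} [NormedAddCommGroup E] [NormedSpace ℝ E]
  {N : Type*} [TopologicalSpace N] [ChartedSpace E N]
  {E' : Type*} [NormedAddCommGroup E'] [NormedSpace ℝ E']
  {N' : Type*} [TopologicalSpace N'] [ChartedSpace E' N']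
  {W : Type*} [AddCommGroup W] [Module ℝ W]
  {W' : Type*} [AddCommGroup W'] [Module ℝ W']

/-! The Cartan connection identifies each `T_u B` with `𝔤` and the vertical vectors with `𝔤^0`, so
that the derivative of the projection becomes a surjection `𝔤 → T_x M` with kernel `𝔤^0` (`anchor`).
Replacing `u` by `u · g` precomposes it with `Ad g`, which preserves the filtration. Hence the
images of the `𝔤^i` depend on `x` alone and form the filtration `T^i M`, and on the associated
graded of negative degree `u` determines linear isomorphisms `𝔪_i → gr_i(T_x M)` (`grEquiv`),
changed by `Ad_gr g`.

Regularity enters once, in `exists_bracket_form`. Sections `ξ` of `T^i M` and `η` of `T^j M` are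
lifted to the total space, where the curvature is evaluated. For negative `i` and `j` the derivative
terms and the curvature all lie in `𝔤^{i+j+1}`, so that the connection sends the bracket of the
lifts to the bracket of their values modulo `𝔤^{i+j+1}`. This makes `M` a filtered manifold and
identifies the Levi bracket with the bracket of `𝔪`. The frames along a local section of the bundle
then trivialize `gr(TM)`.

For the quotients, `P_+` is the stabilizer of one vector in a linear representation: the tuple of
all elements of a basis of `gr(𝔤)`, on which `P` acts by `Ad_gr`. The orbit map has constant rank by
homogeneity, and the constant rank theorem gives a slice for `P → P / P_+` at `1`. Left translation
moves it to every point, and local trivializations carry it over to `B → B / P_+`. Both quotient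
maps then have smooth local sections through every point (`HasSmoothSections`), so that a map on a
quotient is smooth as soon as its pullback is. In this way the group operations, the action, the
bundle charts, `β` and `Φ` descend.

Finally, let the derivative of `β` vanish on the image of `a` in the Lie algebra of `P / P_+`. Then
`ad a` raises the degree on all `𝔤^i` with `i < 0`, so `a ∈ 𝔤^1` by condition (B). An element of
`𝔤^1` acts by zero on `gr(𝔤)`, hence is killed by the slice map, which is a function of the orbit
map, and so by `P → P / P_+`. -/

/-- The derivative of a map between manifolds, as a continuous linear map between the model
spaces, to which the tangent spaces are definitionally equal. -/
noncomputable def md (E : Type*) [NormedAddCommGroup E] [NormedSpace ℝ E]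
    {N : Type*} [TopologicalSpace N] [ChartedSpace E N]
    (E' : Type*) [NormedAddCommGroup E'] [NormedSpace ℝ E']
    {N' : Type*} [TopologicalSpace N'] [ChartedSpace E' N'] (f : N → N') (x : N) : E →L[ℝ] E' :=
  mfderiv 𝓘(ℝ, E) 𝓘(ℝ, E') f x

theorem md_comp {E'' : Type*} [NormedAddCommGroup E''] [NormedSpace ℝ E'']
    {N'' : Type*} [TopologicalSpace N''] [ChartedSpace E'' N''] {g : N' → N''} {f : N → N'} {x : N}
    (hg : MDifferentiableAt 𝓘(ℝ, E') 𝓘(ℝ, E'') g (f x))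
    (hf : MDifferentiableAt 𝓘(ℝ, E) 𝓘(ℝ, E') f x) :
    md E E'' (fun y => g (f y)) x = (md E' E'' g (f x)).comp (md E E' f x) :=
  mfderiv_comp x hg hf

theorem md_congr {f g : N → N'} {x : N} (h : f =ᶠ[𝓝 x] g) : md E E' f x = md E E' g x :=
  h.mfderiv_eq

theorem md_id (x : N) : md E E (fun y : N => y) x = ContinuousLinearMap.id ℝ E :=
  mfderiv_id

theorem md_const (c : N') (x : N) : md E E' (fun _ : N => c) x = 0 :=
  mfderiv_const

theorem md_eq_fderiv {f : E → E'} {x : E} : md E E' f x = fderiv ℝ f x :=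
  mfderiv_eq_fderiv

/-- The derivative of a real function along a tangent vector. -/
noncomputable def dirDeriv (f : N → ℝ) (x : N) (v : TangentSpace 𝓘(ℝ, E) x) : ℝ :=
  mfderiv 𝓘(ℝ, E) 𝓘(ℝ, ℝ) f x v

theorem derivAlong_eq [FiniteDimensional ℝ W] (f : N → W) (x : N)
    (v : TangentSpace 𝓘(ℝ, E) x) :
    derivAlong E f x v = ∑ k, dirDeriv (fun y => (Module.finBasis ℝ W).coord k (f y)) x v •
      Module.finBasis ℝ W k := rfl

theorem dirDeriv_sum {ι : Type} (t : Finset ι) {f : ι → N → ℝ} {x : N}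
    (hf : ∀ k ∈ t, MDifferentiableAt 𝓘(ℝ, E) 𝓘(ℝ, ℝ) (f k) x) (v : TangentSpace 𝓘(ℝ, E) x) :
    dirDeriv (fun y => ∑ k ∈ t, f k y) x v = ∑ k ∈ t, dirDeriv (f k) x v := by
  have h0 : ∀ k ∈ t, HasMFDerivAt 𝓘(ℝ, E) 𝓘(ℝ, ℝ) (f k) x (md E ℝ (f k) x) :=
    fun k hk => (hf k hk).hasMFDerivAt
  have h := (HasMFDerivAt.sum h0).mfderiv
  have h2 : (∑ k ∈ t, f k) = fun y => ∑ k ∈ t, f k y := by ext; simp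
  rw [h2] at h
  refine (congrArg (fun A : E →L[ℝ] ℝ => A v) h).trans ?_
  exact _root_.sum_apply t (fun k => md E ℝ (f k) x) v

theorem dirDeriv_mul_const {f : N → ℝ} {x : N}
    (hf : MDifferentiableAt 𝓘(ℝ, E) 𝓘(ℝ, ℝ) f x) (c : ℝ) (v : TangentSpace 𝓘(ℝ, E) x) :
    dirDeriv (fun y => f y * c) x v = dirDeriv f x v * c := by
  have h := const_smul_mfderiv hf c
  have h2 : c • f = fun y => f y * c := by ext; simp [mul_comm]
  rw [h2] at h
  refine (congrArg (fun A : E →L[ℝ] ℝ => A v) h).trans ?_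
  exact mul_comm c (dirDeriv f x v)

theorem dirDeriv_congr {f g : N → ℝ} {x : N} (h : f =ᶠ[𝓝 x] g) (v : TangentSpace 𝓘(ℝ, E) x) :
    dirDeriv f x v = dirDeriv g x v := by
  unfold dirDeriv
  rw [h.mfderiv_eq]
  rfl

theorem dirDeriv_const (c : ℝ) (x : N) (v : TangentSpace 𝓘(ℝ, E) x) :
    dirDeriv (fun _ => c) x v = 0 := by
  unfold dirDeriv
  rw [mfderiv_const]
  rfl

theorem dirDeriv_comp {f : N' → ℝ} {g : N → N'} {x : N}
    (hf : MDifferentiableAt 𝓘(ℝ, E') 𝓘(ℝ, ℝ) f (g x))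
    (hg : MDifferentiableAt 𝓘(ℝ, E) 𝓘(ℝ, E') g x) (v : TangentSpace 𝓘(ℝ, E) x) :
    dirDeriv (fun y => f (g y)) x v = dirDeriv f (g x) (mfderiv 𝓘(ℝ, E) 𝓘(ℝ, E') g x v) := by
  have h := mfderiv_comp x hf hg
  change mfderiv 𝓘(ℝ, E) 𝓘(ℝ, ℝ) (f ∘ g) x v = _
  rw [h]
  rfl

/-- Differentiability of all the coordinates of a map into a finite dimensional vector space. -/
def WeakDiffAt (E : Type*) [NormedAddCommGroup E] [NormedSpace ℝ E]
    {N : Type*} [TopologicalSpace N] [ChartedSpace E N] (f : N → W) (x : N) : Prop :=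
  ∀ l : Module.Dual ℝ W, MDifferentiableAt 𝓘(ℝ, E) 𝓘(ℝ, ℝ) (fun y => l (f y)) x

theorem SmoothOn.weakDiffAt {f : N → W} {s : Set N} (hf : SmoothOn E f s) {x : N} (hs : s ∈ 𝓝 x) :
    WeakDiffAt E f x := fun l =>
  ((hf l).contMDiffAt hs).mdifferentiableAt (by simp)

theorem WeakDiffAt.map (L : W →ₗ[ℝ] W') {f : N → W} {x : N} (hf : WeakDiffAt E f x) :
    WeakDiffAt E (fun y => L (f y)) x := fun l => hf (l ∘ₗ L)

/-- A functional is a combination of the coordinates with constant coefficients. This frees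
`derivAlong` from the basis in its definition, and later arguments use only functionals. -/
theorem dual_derivAlong [FiniteDimensional ℝ W] {f : N → W} {x : N} (hf : WeakDiffAt E f x)
    (v : TangentSpace 𝓘(ℝ, E) x) (l : Module.Dual ℝ W) :
    l (derivAlong E f x v) = dirDeriv (fun y => l (f y)) x v := by
  set b := Module.finBasis ℝ W
  have h : (fun y => l (f y)) = fun y => ∑ k, b.coord k (f y) * l (b k) := by
    funext y
    conv_lhs => rw [← b.sum_repr (f y), map_sum]
    simp only [map_smul, smul_eq_mul, Module.Basis.coord_apply]
  rw [h, dirDeriv_sum Finset.univ, derivAlong_eq, map_sum]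
  · refine Finset.sum_congr rfl fun k _ => ?_
    rw [dirDeriv_mul_const (hf _), map_smul, smul_eq_mul]
  · intro k _
    have := hf (l (b k) • b.coord k)
    simpa [mul_comm] using this

theorem eq_of_forall_dual [FiniteDimensional ℝ W] {x y : W}
    (h : ∀ l : Module.Dual ℝ W, l x = l y) : x = y :=
  (Module.finBasis ℝ W).ext_elem fun k => h ((Module.finBasis ℝ W).coord k)

theorem derivAlong_map [FiniteDimensional ℝ W] [FiniteDimensional ℝ W'] (L : W →ₗ[ℝ] W')
    {f : N → W} {x : N} (hf : WeakDiffAt E f x) (v : TangentSpace 𝓘(ℝ, E) x) :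
    derivAlong E (fun y => L (f y)) x v = L (derivAlong E f x v) := by
  refine eq_of_forall_dual fun l => ?_
  rw [dual_derivAlong (hf.map L)]
  exact (dual_derivAlong hf v (l ∘ₗ L)).symm

theorem derivAlong_comp [FiniteDimensional ℝ W] {f : N' → W} {g : N → N'} {x : N}
    (hf : WeakDiffAt E' f (g x)) (hg : MDifferentiableAt 𝓘(ℝ, E) 𝓘(ℝ, E') g x)
    (v : TangentSpace 𝓘(ℝ, E) x) :
    derivAlong E (fun y => f (g y)) x v =
      derivAlong E' f (g x) (mfderiv 𝓘(ℝ, E) 𝓘(ℝ, E') g x v) := by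
  rw [derivAlong_eq, derivAlong_eq]
  exact Finset.sum_congr rfl fun k _ => by rw [← dirDeriv_comp (hf _) hg]

/-- A derivative outside `S` would be detected by a functional vanishing on `S`, but the composite
of that functional with `f` is zero near `x`. With `S` a step of the filtration of `𝔤`, this
controls the derivative terms in the curvature. -/
theorem derivAlong_mem [FiniteDimensional ℝ W] (S : Submodule ℝ W) {f : N → W} {x : N}
    (hf : WeakDiffAt E f x) (hS : ∀ᶠ y in 𝓝 x, f y ∈ S) (v : TangentSpace 𝓘(ℝ, E) x) :
    derivAlong E f x v ∈ S := by
  by_contra hn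
  obtain ⟨l, hl, hS'⟩ := Submodule.exists_le_ker_of_notMem hn
  apply hl
  rw [dual_derivAlong hf, dirDeriv_congr (g := fun _ => 0), dirDeriv_const]
  filter_upwards [hS] with y hy
  exact hS' hy

theorem SmoothOn.congr {f g : N → W} {s : Set N} (hf : SmoothOn E f s)
    (h : ∀ y ∈ s, g y = f y) : SmoothOn E g s := fun l =>
  (hf l).congr fun y hy => by rw [h y hy]

theorem SmoothOn.map (L : W →ₗ[ℝ] W') {f : N → W} {s : Set N} (hf : SmoothOn E f s) :
    SmoothOn E (fun y => L (f y)) s := fun l => hf (l ∘ₗ L)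

theorem SmoothOn.comp {f : N' → W} {g : N → N'} {t : Set N'} {s : Set N} (hf : SmoothOn E' f t)
    (hg : ContMDiffOn 𝓘(ℝ, E) 𝓘(ℝ, E') ∞ g s) (h : Set.MapsTo g s t) :
    SmoothOn E (fun y => f (g y)) s := fun l => (hf l).comp hg h

theorem smoothOn_of_locally {f : N → W} {s : Set N}
    (h : ∀ x ∈ s, ∃ u, IsOpen u ∧ x ∈ u ∧ SmoothOn E f (s ∩ u)) : SmoothOn E f s := fun l =>
  contMDiffOn_of_locally_contMDiffOn fun x hx => by
    obtain ⟨u, hu, hxu, hf⟩ := h x hx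
    exact ⟨u, hu, hxu, hf l⟩

theorem SmoothOn.smul {c : N → ℝ} {f : N → W} {s : Set N}
    (hc : ContMDiffOn 𝓘(ℝ, E) 𝓘(ℝ, ℝ) ∞ c s) (hf : SmoothOn E f s) :
    SmoothOn E (fun y => c y • f y) s := fun l => by
  simp only [map_smul]
  exact hc.smul (hf l)

theorem SmoothOn.sum {ι : Type*} {t : Finset ι} {f : ι → N → W} {s : Set N}
    (hf : ∀ k ∈ t, SmoothOn E (f k) s) : SmoothOn E (fun y => ∑ k ∈ t, f k y) s := fun l => by
  simp only [map_sum]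
  exact contMDiffOn_finsetSum fun k hk => hf k hk l

theorem SmoothOn.pi {κ : Type*} [Finite κ] {V : κ → Type*} [∀ k, AddCommGroup (V k)]
    [∀ k, Module ℝ (V k)] {f : N → ∀ k, V k} {s : Set N}
    (hf : ∀ k, SmoothOn E (fun y => f y k) s) : SmoothOn E f s := by
  classical
  cases nonempty_fintype κ
  have h : f = fun y => ∑ k, LinearMap.single ℝ V k (f y k) := by
    funext y
    exact (LinearMap.sum_single_apply _ (f y)).symm
  rw [h]
  exact SmoothOn.sum fun k _ => (hf k).map (LinearMap.single ℝ V k)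

/-- A linear map to a normed space turns weak smoothness into smoothness. -/
theorem SmoothOn.contMDiffOn {ι : Type*} [Fintype ι] (L : W →ₗ[ℝ] (ι → ℝ)) {f : N → W} {s : Set N}
    (hf : SmoothOn E f s) : ContMDiffOn 𝓘(ℝ, E) 𝓘(ℝ, ι → ℝ) ∞ (fun y => L (f y)) s := by
  rw [contMDiffOn_pi_space]
  exact fun k => hf (LinearMap.proj k ∘ₗ L)

end SmoothCalculus

end FilteredGeometry

namespace FilteredGeometry

/-! ### The constant rank theorem -/

section ConstantRank

open Module Set

variable {E V : Type*} [NormedAddCommGroup E] [NormedSpace ℝ E] [FiniteDimensional ℝ E]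
  [NormedAddCommGroup V] [NormedSpace ℝ V] [FiniteDimensional ℝ V]

/-- Coordinates on the source of a linear map, adapted to its kernel. -/
theorem exists_rank_coordinates (L : E →L[ℝ] V) :
    ∃ (a : ℕ) (p : V →L[ℝ] EuclideanSpace ℝ (Fin a))
      (k : E →L[ℝ] EuclideanSpace ℝ (Fin (finrank ℝ (LinearMap.ker L.toLinearMap)))),
      a + finrank ℝ (LinearMap.ker L.toLinearMap) = finrank ℝ E ∧
      Function.Bijective ((p.comp L).prod k).toLinearMap := by
  -- Linear projections of `V` onto the range of `L` and of `E` onto the kernel of `L`. A vector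
  -- killed by both `p₀ ∘ L` and `k₀` lies in the kernel and equals its own projection, which is
  -- zero; surjectivity follows by rank-nullity.
  obtain ⟨p₀, hp₀⟩ := LinearMap.exists_leftInverse_of_injective
    (LinearMap.range L.toLinearMap).subtype (Submodule.ker_subtype _)
  obtain ⟨k₀, hk₀⟩ := LinearMap.exists_leftInverse_of_injective
    (LinearMap.ker L.toLinearMap).subtype (Submodule.ker_subtype _)
  let e : LinearMap.range L.toLinearMap ≃ₗ[ℝ]
      EuclideanSpace ℝ (Fin (finrank ℝ (LinearMap.range L.toLinearMap))) :=
    LinearEquiv.ofFinrankEq _ _ (by simp)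
  let e' : LinearMap.ker L.toLinearMap ≃ₗ[ℝ]
      EuclideanSpace ℝ (Fin (finrank ℝ (LinearMap.ker L.toLinearMap))) :=
    LinearEquiv.ofFinrankEq _ _ (by simp)
  have hdim := LinearMap.finrank_range_add_finrank_ker L.toLinearMap
  refine ⟨_, LinearMap.toContinuousLinearMap (e.toLinearMap ∘ₗ p₀),
    LinearMap.toContinuousLinearMap (e'.toLinearMap ∘ₗ k₀), hdim, ?_⟩
  have hinj : Function.Injective (((LinearMap.toContinuousLinearMap (e.toLinearMap ∘ₗ p₀)).comp
      L).prod (LinearMap.toContinuousLinearMap (e'.toLinearMap ∘ₗ k₀))).toLinearMap := by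
    rw [← LinearMap.ker_eq_bot, LinearMap.ker_eq_bot']
    intro v hv
    obtain ⟨h1, h2⟩ := Prod.ext_iff.1 hv
    have h1' : e (p₀ (L v)) = 0 := h1
    have h2' : e' (k₀ v) = 0 := h2
    rw [LinearEquiv.map_eq_zero_iff] at h1' h2'
    have h3 := LinearMap.congr_fun hp₀ ⟨L v, v, rfl⟩
    have h3' : p₀ (L v) = ⟨L v, v, rfl⟩ := h3
    rw [h1'] at h3'
    have hv0 : L v = 0 := (congrArg Subtype.val h3').symm
    have h4 := LinearMap.congr_fun hk₀ ⟨v, hv0⟩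
    have h4' : k₀ v = ⟨v, hv0⟩ := h4
    rw [h2'] at h4'
    exact (congrArg Subtype.val h4').symm
  refine ⟨hinj, (LinearMap.injective_iff_surjective_of_finrank_eq_finrank ?_).1 hinj⟩
  simp only [finrank_prod, finrank_euclideanSpace, Fintype.card_fin]
  exact hdim.symm

/-- The hypothesis says that the rank is maximal at `x₀`; as the rank cannot drop nearby, it is
constant near `x₀`. In the coordinates `(p ∘ r, k)` the map `r` does not depend on the second
variable, so freezing that variable gives a section `s` with `r ∘ s ∘ p ∘ r = r`. -/
theorem exists_slice_of_constant_rank {r : E → V} {Ω : Set E} (hΩ : IsOpen Ω) {x₀ : E}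
    (hx₀ : x₀ ∈ Ω) (hr : ContDiffOn ℝ ∞ r Ω)
    (hrank : ∀ x ∈ Ω, finrank ℝ (LinearMap.ker (fderiv ℝ r x₀).toLinearMap) ≤
      finrank ℝ (LinearMap.ker (fderiv ℝ r x).toLinearMap)) :
    ∃ (a : ℕ) (p : V →L[ℝ] EuclideanSpace ℝ (Fin a)) (U : Set E)
      (O : Set (EuclideanSpace ℝ (Fin a))) (s : EuclideanSpace ℝ (Fin a) → E),
      IsOpen U ∧ x₀ ∈ U ∧ U ⊆ Ω ∧ IsOpen O ∧ (∀ x ∈ U, p (r x) ∈ O) ∧ ContDiffOn ℝ ∞ s O ∧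
      (∀ c ∈ O, s c ∈ U) ∧ (∀ c ∈ O, p (r (s c)) = c) ∧ ∀ x ∈ U, r (s (p (r x))) = r x := by
  obtain ⟨a, p, kk, hdim, hbij⟩ := exists_rank_coordinates (fderiv ℝ r x₀)
  set F := EuclideanSpace ℝ (Fin a)
  set K := EuclideanSpace ℝ (Fin (finrank ℝ (LinearMap.ker (fderiv ℝ r x₀).toLinearMap)))
  let Φ : E → F × K := fun x => (p (r x), kk x)
  have hrd : ∀ x ∈ Ω, ContDiffAt ℝ ∞ r x := fun x hx => hr.contDiffAt (hΩ.mem_nhds hx)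
  have hΦ : ∀ x ∈ Ω, ContDiffAt ℝ ∞ Φ x := fun x hx =>
    (p.contDiff.contDiffAt.comp x (hrd x hx)).prodMk kk.contDiff.contDiffAt
  have hΦd : ∀ x ∈ Ω, HasFDerivAt Φ ((p.comp (fderiv ℝ r x)).prod kk) x := fun x hx =>
    (p.hasFDerivAt.comp x ((hrd x hx).differentiableAt (by simp)).hasFDerivAt).prodMk
      kk.hasFDerivAt
  have hΦf : ∀ x ∈ Ω, fderiv ℝ Φ x = (p.comp (fderiv ℝ r x)).prod kk := fun x hx =>
    (hΦd x hx).fderiv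
  let e₀ : E ≃L[ℝ] F × K := (LinearEquiv.ofBijective
    ((p.comp (fderiv ℝ r x₀)).prod kk).toLinearMap hbij).toContinuousLinearEquiv
  have he₀ : (e₀ : E →L[ℝ] F × K) = (p.comp (fderiv ℝ r x₀)).prod kk := rfl
  have hΦ0 : HasFDerivAt Φ (e₀ : E →L[ℝ] F × K) x₀ := hΦd x₀ hx₀
  let h := (hΦ x₀ hx₀).toOpenPartialHomeomorph Φ hΦ0 (by simp)
  have hh : ∀ x, h x = Φ x := fun x => rfl
  have hsrc : x₀ ∈ h.source := (hΦ x₀ hx₀).mem_toOpenPartialHomeomorph_source hΦ0 (by simp)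
  have hcont : ContinuousOn (fderiv ℝ Φ) Ω :=
    ContDiffOn.continuousOn_fderiv_of_isOpen (n := ∞)
      (fun x hx => (hΦ x hx).contDiffWithinAt) hΩ (by simp)
  -- The part of the domain where the derivative of `Φ` stays invertible; there the local inverse is
  -- smooth, and `p ∘ dr` is still onto.
  let G : Set E := h.source ∩ (Ω ∩ fderiv ℝ Φ ⁻¹' range ((↑) : (E ≃L[ℝ] F × K) → _))
  have hG : IsOpen G := h.open_source.inter
    (hcont.isOpen_inter_preimage hΩ ContinuousLinearEquiv.isOpen)
  have hxG : x₀ ∈ G := ⟨hsrc, hx₀, e₀, by rw [hΦ0.fderiv]⟩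
  have hsymm : ∀ y ∈ h.target, h.symm y ∈ G → ContDiffAt ℝ ∞ h.symm y := by
    rintro y hy ⟨-, hyΩ, e, he⟩
    refine h.contDiffAt_symm hy (f₀' := e) ?_ (hΦ _ hyΩ)
    have := ((hΦ _ hyΩ).differentiableAt (by simp)).hasFDerivAt
    rwa [← he] at this
  have hTo : IsOpen (h.target ∩ h.symm ⁻¹' G) := h.isOpen_inter_preimage_symm hG
  obtain ⟨ε, hε, hball⟩ := Metric.isOpen_iff.1 hTo (Φ x₀)
    ⟨h.map_source hsrc, by
      change h.symm (h x₀) ∈ G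
      rwa [h.left_inv hsrc]⟩
  -- Since `p ∘ dr` is onto, its kernel has the dimension of the kernel of `dr` at `x₀`. It contains
  -- the kernel of `dr` at `x`, which by `hrank` is at least as large, so the two coincide.
  have hker : ∀ x ∈ G, ∀ v, p (fderiv ℝ r x v) = 0 → fderiv ℝ r x v = 0 := by
    rintro x ⟨-, hxΩ, e, he⟩
    have hsurj : Function.Surjective (p.comp (fderiv ℝ r x)).toLinearMap := by
      intro c
      obtain ⟨v, hv⟩ := e.surjective (c, 0)
      refine ⟨v, ?_⟩
      have := congrArg (fun A : E →L[ℝ] F × K => (A v).1) (he.trans (hΦf x hxΩ))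
      exact (this.symm.trans (congrArg Prod.fst hv))
    have hdim' := LinearMap.finrank_range_add_finrank_ker (p.comp (fderiv ℝ r x)).toLinearMap
    rw [LinearMap.range_eq_top.2 hsurj, finrank_top, finrank_euclideanSpace,
      Fintype.card_fin] at hdim'
    have hle : LinearMap.ker (fderiv ℝ r x).toLinearMap ≤
        LinearMap.ker (p.comp (fderiv ℝ r x)).toLinearMap := by
      intro v hv
      have hv' : fderiv ℝ r x v = 0 := hv
      change p (fderiv ℝ r x v) = 0
      rw [hv', map_zero]
    have heq := Submodule.eq_of_le_of_finrank_le hle (by have := hrank x hxΩ; omega)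
    intro v hv
    have hv' : v ∈ LinearMap.ker (p.comp (fderiv ℝ r x)).toLinearMap := hv
    rw [← heq] at hv'
    exact hv'
  set c₀ := (Φ x₀).1
  set k₀ := (Φ x₀).2
  have hball' : ∀ c ∈ Metric.ball c₀ ε, ∀ k ∈ Metric.ball k₀ ε,
      (c, k) ∈ h.target ∩ h.symm ⁻¹' G := fun c hc k hk => hball (by
    rw [Metric.mem_ball, Prod.dist_eq]
    exact max_lt hc hk)
  have hΦs : ∀ c ∈ Metric.ball c₀ ε, ∀ k ∈ Metric.ball k₀ ε, Φ (h.symm (c, k)) = (c, k) :=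
    fun c hc k hk => h.right_inv (hball' c hc k hk).1
  have hconst : ∀ c ∈ Metric.ball c₀ ε, ∀ k ∈ Metric.ball k₀ ε,
      r (h.symm (c, k)) = r (h.symm (c, k₀)) := by
    intro c hc k hk
    have hder : ∀ k ∈ Metric.ball k₀ ε,
        HasFDerivAt (fun k => r (h.symm (c, k))) (0 : K →L[ℝ] V) k := by
      intro k hk
      obtain ⟨hy, hyG⟩ := hball' c hc k hk
      have hs := ((hsymm _ hy hyG).differentiableAt (by simp)).hasFDerivAt
      have hcomp : HasFDerivAt (fun y => Φ (h.symm y)) ((fderiv ℝ Φ (h.symm (c, k))).comp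
          (fderiv ℝ h.symm (c, k))) (c, k) :=
        ((hΦ _ hyG.2.1).differentiableAt (by simp)).hasFDerivAt.comp _ hs
      have hid : HasFDerivAt (fun y => Φ (h.symm y)) (ContinuousLinearMap.id ℝ (F × K)) (c, k) :=
        (hasFDerivAt_id _).congr_of_eventuallyEq (by
          filter_upwards [h.open_target.mem_nhds hy] with y hy
          exact h.right_inv hy)
      have hu := hcomp.unique hid
      have hr' := ((hrd _ hyG.2.1).differentiableAt (by simp)).hasFDerivAt
      have hk' : HasFDerivAt (fun k : K => (c, k)) (ContinuousLinearMap.inr ℝ F K) k :=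
        hasFDerivAt_prodMk_right c k
      have h3 := hr'.comp k (hs.comp k hk')
      refine h3.congr_fderiv ?_
      ext1 v
      -- A displacement `(0, v)` in the second variable leaves the first component of `Φ`, which is
      -- `p ∘ r`, unchanged; by `hker` it then leaves `r` unchanged to first order.
      refine hker _ hyG _ ?_
      have h4 := congrArg (fun A : F × K →L[ℝ] F × K => (A (0, v)).1) hu
      rw [hΦf _ hyG.2.1] at h4
      exact h4
    exact (Metric.isOpen_ball).is_const_of_fderiv_eq_zero
      (convex_ball k₀ ε).isPreconnected
      (fun k hk => (hder k hk).differentiableAt.differentiableWithinAt)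
      (fun k hk => (hder k hk).fderiv) hk (Metric.mem_ball_self hε)
  have hGΦ : ContinuousOn Φ G := fun x hx => (hΦ x hx.2.1).continuousAt.continuousWithinAt
  have hinv : ∀ x ∈ G, h.symm (Φ x) = x := fun x hx => h.left_inv hx.1
  refine ⟨a, p, G ∩ Φ ⁻¹' (Metric.ball c₀ ε ×ˢ Metric.ball k₀ ε), Metric.ball c₀ ε,
    fun c => h.symm (c, k₀), hGΦ.isOpen_inter_preimage hG (Metric.isOpen_ball.prod
    Metric.isOpen_ball), ⟨hxG, Metric.mem_ball_self hε, Metric.mem_ball_self hε⟩,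
    fun x hx => hx.1.2.1, Metric.isOpen_ball, fun x hx => hx.2.1, ?_, ?_, ?_, ?_⟩
  · intro c hc
    have hy := hball' c hc k₀ (Metric.mem_ball_self hε)
    exact ((hsymm _ hy.1 hy.2).comp c
      (contDiff_id.prodMk contDiff_const).contDiffAt).contDiffWithinAt
  · intro c hc
    refine ⟨(hball' c hc k₀ (Metric.mem_ball_self hε)).2, ?_⟩
    rw [mem_preimage, hΦs c hc k₀ (Metric.mem_ball_self hε)]
    exact ⟨hc, Metric.mem_ball_self hε⟩
  · intro c hc
    exact congrArg Prod.fst (hΦs c hc k₀ (Metric.mem_ball_self hε))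
  · intro x hx
    have := hconst (Φ x).1 hx.2.1 (Φ x).2 hx.2.2
    rw [Prod.mk.eta, hinv x hx.1] at this
    exact this.symm

end ConstantRank

end FilteredGeometry

namespace FilteredGeometry

/-! ### Manifold structures on quotients -/

section QuotientManifold

open Set

variable (E : Type*) [NormedAddCommGroup E] [NormedSpace ℝ E]
  {N : Type*} [TopologicalSpace N] [ChartedSpace E N]
  (F : Type*) [NormedAddCommGroup F] [NormedSpace ℝ F]
  {X : Type*}

/-- A slice at `u` for a quotient map `q`: a submersion `f` near `u`, with a smooth section `s`,
whose fibres are those of `q`. -/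
structure SliceAt (q : N → X) (u : N) where
  U : Set N
  O : Set F
  f : N → F
  s : F → N
  isOpen_U : IsOpen U
  mem : u ∈ U
  isOpen_O : IsOpen O
  smooth_f : ContMDiffOn 𝓘(ℝ, E) 𝓘(ℝ, F) ∞ f U
  smooth_s : ContMDiffOn 𝓘(ℝ, F) 𝓘(ℝ, E) ∞ s O
  f_mem : ∀ x ∈ U, f x ∈ O
  s_mem : ∀ c ∈ O, s c ∈ U
  f_s : ∀ c ∈ O, f (s c) = c
  q_s : ∀ x ∈ U, q (s (f x)) = q x
  f_eq : ∀ x ∈ U, ∀ y ∈ U, q x = q y → f x = f y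

variable {E F} {q : N → X}

namespace SliceAt

variable {u : N} (D : SliceAt E F q u)

open Classical in
/-- The coordinate on the quotient defined by a slice. -/
noncomputable def coord (z : X) : F :=
  if h : ∃ x ∈ D.U, q x = z then D.f h.choose else 0

theorem coord_q {x : N} (hx : x ∈ D.U) : D.coord (q x) = D.f x := by
  have h : ∃ y ∈ D.U, q y = q x := ⟨x, hx, rfl⟩
  rw [coord, dif_pos h]
  exact D.f_eq _ h.choose_spec.1 _ hx h.choose_spec.2

/-- The coordinate is `D.f` on the slice domain, but along `q` it is defined on the whole saturation
of that domain. A local map `τ` over the quotient moves any point of the saturation into the domain,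
where smoothness is known. -/
theorem contMDiffAt_coord
    (hτ : ∀ x y, q x = q y → ∃ τ : N → N, ContMDiffAt 𝓘(ℝ, E) 𝓘(ℝ, E) ∞ τ x ∧ τ x = y ∧
      ∀ᶠ z in 𝓝 x, q (τ z) = q z) {y : N} (hy : q y ∈ q '' D.U) :
    ContMDiffAt 𝓘(ℝ, E) 𝓘(ℝ, F) ∞ (fun z => D.coord (q z)) y := by
  obtain ⟨x, hx, hxy⟩ := hy
  obtain ⟨τ, hτs, rfl, hτq⟩ := hτ y x hxy.symm
  have h := ((D.smooth_f.contMDiffAt (D.isOpen_U.mem_nhds hx)).comp y hτs)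
  refine h.congr_of_eventuallyEq ?_
  filter_upwards [hτq, hτs.continuousAt (D.isOpen_U.mem_nhds hx)] with z hz hzU
  rw [← hz]
  exact D.coord_q hzU

variable [TopologicalSpace X]

/-- The chart of the quotient defined by a slice. -/
noncomputable def chart (hq : IsOpenQuotientMap q) : OpenPartialHomeomorph X F where
  toFun := D.coord
  invFun c := q (D.s c)
  source := q '' D.U
  target := D.O
  map_source' := by
    rintro _ ⟨x, hx, rfl⟩
    rw [D.coord_q hx]
    exact D.f_mem x hx
  map_target' c hc := ⟨D.s c, D.s_mem c hc, rfl⟩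
  left_inv' := by
    rintro _ ⟨x, hx, rfl⟩
    rw [D.coord_q hx, D.q_s x hx]
  right_inv' c hc := by rw [D.coord_q (D.s_mem c hc), D.f_s c hc]
  open_source := hq.isOpenMap _ D.isOpen_U
  open_target := D.isOpen_O
  continuousOn_toFun := by
    rintro _ ⟨x, hx, rfl⟩
    refine ContinuousAt.continuousWithinAt ?_
    have h1 : Filter.Tendsto (fun y => D.coord (q y)) (𝓝 x) (𝓝 (D.coord (q x))) := by
      have h2 : (fun y => D.coord (q y)) =ᶠ[𝓝 x] D.f := by
        filter_upwards [D.isOpen_U.mem_nhds hx] with y hy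
        exact D.coord_q hy
      rw [D.coord_q hx]
      exact ((D.smooth_f.continuousOn.continuousAt (D.isOpen_U.mem_nhds hx)).tendsto).congr'
        h2.symm
    -- For an open quotient map the neighbourhoods of `q x` are the images of those of `x`, so
    -- continuity may be tested after composing with `q`.
    rw [ContinuousAt, Filter.Tendsto, ← hq.map_nhds_eq x, Filter.map_map]
    exact h1
  continuousOn_invFun := hq.continuous.comp_continuousOn D.smooth_s.continuousOn

end SliceAt

variable [TopologicalSpace X]

/-- `q` is smooth and has smooth local sections through every point. -/
structure HasSmoothSections (E : Type*) [NormedAddCommGroup E] [NormedSpace ℝ E]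
    {N : Type*} [TopologicalSpace N] [ChartedSpace E N]
    (F : Type*) [NormedAddCommGroup F] [NormedSpace ℝ F]
    {X : Type*} [TopologicalSpace X] [ChartedSpace F X] (q : N → X) : Prop where
  smooth : ContMDiff 𝓘(ℝ, E) 𝓘(ℝ, F) ∞ q
  exists_section : ∀ u, ∃ σ : X → N, ContMDiffAt 𝓘(ℝ, F) 𝓘(ℝ, E) ∞ σ (q u) ∧ σ (q u) = u ∧
    ∀ᶠ z in 𝓝 (q u), q (σ z) = z

/-- If an open quotient map has slices, and if points of the same fibre are related by local
smooth maps over the quotient, then the quotient is a manifold; the quotient map is smooth, and it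
has smooth local sections through every point. -/
theorem exists_manifold_of_slices (hq : IsOpenQuotientMap q)
    (slice : ∀ u, Nonempty (SliceAt E F q u))
    (hτ : ∀ x y, q x = q y → ∃ τ : N → N, ContMDiffAt 𝓘(ℝ, E) 𝓘(ℝ, E) ∞ τ x ∧ τ x = y ∧
      ∀ᶠ z in 𝓝 x, q (τ z) = q z) :
    ∃ _ : ChartedSpace F X, IsManifold 𝓘(ℝ, F) ∞ X ∧ HasSmoothSections E F q := by
  let D := fun u => (slice u).some
  let lift : X → N := fun z => (hq.surjective z).choose
  have hlift : ∀ z, q (lift z) = z := fun z => (hq.surjective z).choose_spec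
  let cs : ChartedSpace F X :=
    { atlas := range fun z => (D (lift z)).chart hq
      chartAt := fun z => (D (lift z)).chart hq
      mem_chart_source := fun z => ⟨lift z, (D (lift z)).mem, hlift z⟩
      chart_mem_atlas := fun z => ⟨z, rfl⟩ }
  have hmf : IsManifold 𝓘(ℝ, F) ∞ X := by
    refine isManifold_of_contDiffOn _ _ _ ?_
    rintro _ _ ⟨z, rfl⟩ ⟨w, rfl⟩
    intro c hc
    have hc' : c ∈ (D (lift z)).O ∧ q ((D (lift z)).s c) ∈ q '' (D (lift w)).U := by
      have h := hc.1
      rw [mem_preimage, OpenPartialHomeomorph.trans_source] at h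
      exact h
    -- A change of charts is the section of one slice followed by the coordinate of the other,
    -- pulled back along `q`.
    have h := ((D (lift w)).contMDiffAt_coord hτ hc'.2).comp c
      ((D (lift z)).smooth_s.contMDiffAt ((D (lift z)).isOpen_O.mem_nhds hc'.1))
    exact (contMDiffAt_iff_contDiffAt.1 h).contDiffWithinAt
  have hqs : ContMDiff 𝓘(ℝ, E) 𝓘(ℝ, F) ∞ q := by
    intro u
    rw [contMDiffAt_iff_target]
    exact ⟨hq.continuous.continuousAt, (D (lift (q u))).contMDiffAt_coord hτ
      (mem_chart_source F (q u))⟩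
  refine ⟨cs, hmf, hqs, fun u => ?_⟩
  set S := D (lift (q u))
  have hmem : q u ∈ q '' S.U := mem_chart_source F (q u)
  have hc : S.coord (q u) ∈ S.O := (S.chart hq).map_source hmem
  have h1 : ContMDiffAt 𝓘(ℝ, F) 𝓘(ℝ, F) ∞ S.coord (q u) :=
    contMDiffAt_extChartAt (I := 𝓘(ℝ, F)) (x := q u)
  have h2 := (S.smooth_s.contMDiffAt (S.isOpen_O.mem_nhds hc)).comp (q u) h1
  have h3 : ∀ z ∈ q '' S.U, q (S.s (S.coord z)) = z := fun z hz => (S.chart hq).left_inv hz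
  -- The section of the chart meets the fibre of `u` in a point that need not be `u`; `τ` moves it
  -- there.
  obtain ⟨τ, hτs, hτu, hτq⟩ := hτ (S.s (S.coord (q u))) u (h3 _ hmem)
  refine ⟨fun z => τ (S.s (S.coord z)), ContMDiffAt.comp (q u) hτs h2, hτu, ?_⟩
  filter_upwards [h2.continuousAt.eventually hτq, (hq.isOpenMap _ S.isOpen_U).mem_nhds hmem]
    with z hz hzU
  exact hz.trans (h3 z hzU)

namespace HasSmoothSections

variable [ChartedSpace F X]
  {E' : Type*} [NormedAddCommGroup E'] [NormedSpace ℝ E']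
  {N' : Type*} [TopologicalSpace N'] [ChartedSpace E' N']
  {E'' : Type*} [NormedAddCommGroup E''] [NormedSpace ℝ E'']
  {N'' : Type*} [TopologicalSpace N''] [ChartedSpace E'' N'']
  {F' : Type*} [NormedAddCommGroup F'] [NormedSpace ℝ F']
  {X' : Type*} [TopologicalSpace X'] [ChartedSpace F' X'] {q' : N' → X'}
  {W : Type*} [AddCommGroup W] [Module ℝ W]

/-- Near `q u` the map `g` is `(g ∘ q) ∘ σ` for a local section `σ`. This is the universal property
by which smoothness descends to both quotients. -/
theorem contMDiffAt_of_comp (h : HasSmoothSections E F q) {g : X → N''} {u : N}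
    (hg : ContMDiffAt 𝓘(ℝ, E) 𝓘(ℝ, E'') ∞ (fun x => g (q x)) u) :
    ContMDiffAt 𝓘(ℝ, F) 𝓘(ℝ, E'') ∞ g (q u) := by
  obtain ⟨σ, hσ, hu, hq⟩ := h.exists_section u
  have hg' : ContMDiffAt 𝓘(ℝ, E) 𝓘(ℝ, E'') ∞ (fun x => g (q x)) (σ (q u)) := by rwa [hu]
  refine (ContMDiffAt.comp (q u) hg' hσ).congr_of_eventuallyEq ?_
  filter_upwards [hq] with z hz
  exact congrArg g hz.symm

theorem contMDiffAt_of_comp_prod (h : HasSmoothSections E F q) (h' : HasSmoothSections E' F' q')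
    {g : X × X' → N''} {u : N} {v : N'}
    (hg : ContMDiffAt (𝓘(ℝ, E).prod 𝓘(ℝ, E')) 𝓘(ℝ, E'') ∞ (fun x => g (q x.1, q' x.2)) (u, v)) :
    ContMDiffAt (𝓘(ℝ, F).prod 𝓘(ℝ, F')) 𝓘(ℝ, E'') ∞ g (q u, q' v) := by
  obtain ⟨σ, hσ, hu, hq⟩ := h.exists_section u
  obtain ⟨σ', hσ', hv, hq'⟩ := h'.exists_section v
  have hs : ContMDiffAt (𝓘(ℝ, F).prod 𝓘(ℝ, F')) (𝓘(ℝ, E).prod 𝓘(ℝ, E')) ∞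
      (Prod.map σ σ') (q u, q' v) := ContMDiffAt.prodMap hσ hσ'
  have hg' : ContMDiffAt (𝓘(ℝ, E).prod 𝓘(ℝ, E')) 𝓘(ℝ, E'') ∞ (fun x => g (q x.1, q' x.2))
      (Prod.map σ σ' (q u, q' v)) := by rwa [Prod.map_apply, hu, hv]
  refine (ContMDiffAt.comp (q u, q' v) hg' hs).congr_of_eventuallyEq ?_
  filter_upwards [hq.prod_nhds hq'] with z hz
  exact congrArg g (Prod.ext hz.1 hz.2).symm

theorem smoothOn_of_comp (h : HasSmoothSections E F q) (hq : Function.Surjective q) {f : X → W}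
    {S : Set X} (hS : IsOpen S) (hf : SmoothOn E (fun x => f (q x)) (q ⁻¹' S)) :
    SmoothOn F f S := fun l z hz => by
  obtain ⟨u, rfl⟩ := hq z
  exact (h.contMDiffAt_of_comp ((hf l).contMDiffAt
    ((hS.preimage h.smooth.continuous).mem_nhds hz))).contMDiffWithinAt

/-- Differentiating `q ∘ σ = id` for a section `σ` through `u` gives a right inverse of the
derivative of `q`. -/
theorem mfderiv_surjective (h : HasSmoothSections E F q) (u : N) :
    Function.Surjective (mfderiv 𝓘(ℝ, E) 𝓘(ℝ, F) q u) := by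
  obtain ⟨σ, hσ, hu, hq⟩ := h.exists_section u
  have h1 : md F F (fun z => q (σ z)) (q u) = ContinuousLinearMap.id ℝ F := by
    rw [← md_id (N := X) (q u)]
    exact md_congr hq
  rw [md_comp (h.smooth.mdifferentiableAt (by simp)) (hσ.mdifferentiableAt (by simp)), hu] at h1
  intro w
  exact ⟨md F E σ (q u) w, congrArg (fun A : F →L[ℝ] F => A w) h1⟩

end HasSmoothSections

end QuotientManifold

end FilteredGeometry

namespace FilteredGeometry

/-! ### Slices on Lie groups for stabilizers in linear representations -/

section LieGroupSlices

open Set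

variable {E : Type*} [NormedAddCommGroup E] [NormedSpace ℝ E]
  {P : Type*} [Group P] [TopologicalSpace P] [ChartedSpace E P] [LieGroup 𝓘(ℝ, E) ∞ P]
  {V : Type*} [NormedAddCommGroup V] [NormedSpace ℝ V]

theorem contMDiff_leftMul (g : P) : ContMDiff 𝓘(ℝ, E) 𝓘(ℝ, E) ∞ (fun x => g * x) :=
  contMDiff_mul_left

variable {N : Subgroup P}

/-- A slice at `1` for the quotient by `N` gives slices everywhere. -/
noncomputable def SliceAt.translate {F : Type*} [NormedAddCommGroup F] [NormedSpace ℝ F]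
    (D : SliceAt E F (QuotientGroup.mk : P → P ⧸ N) 1) (g : P) :
    SliceAt E F (QuotientGroup.mk : P → P ⧸ N) g where
  U := (fun x => g⁻¹ * x) ⁻¹' D.U
  O := D.O
  f x := D.f (g⁻¹ * x)
  s c := g * D.s c
  isOpen_U := D.isOpen_U.preimage (contMDiff_leftMul (E := E) g⁻¹).continuous
  mem := by
    rw [mem_preimage, inv_mul_cancel]
    exact D.mem
  isOpen_O := D.isOpen_O
  smooth_f := D.smooth_f.comp (contMDiff_leftMul g⁻¹).contMDiffOn fun x hx => hx
  smooth_s := (contMDiff_leftMul g).comp_contMDiffOn D.smooth_s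
  f_mem x hx := D.f_mem _ hx
  s_mem c hc := by
    rw [mem_preimage, inv_mul_cancel_left]
    exact D.s_mem c hc
  f_s c hc := by rw [inv_mul_cancel_left, D.f_s c hc]
  q_s x hx := by
    have h := D.q_s _ hx
    rw [QuotientGroup.eq] at h ⊢
    simpa [mul_assoc] using h
  f_eq x hx y hy h := by
    refine D.f_eq _ hx _ hy ?_
    rw [QuotientGroup.eq] at h ⊢
    simpa [mul_assoc] using h

variable [FiniteDimensional ℝ E]

/-- Homogeneity: as `ρ (g * h) = Λ (ρ h)`, the derivative of left translation by `g` maps the kernel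
of `dρ` at `1` into the kernel at `g`, and it is injective because translation by `g⁻¹` undoes it.
This is the rank condition of `exists_slice_of_constant_rank`, read in the chart at `1`. -/
theorem finrank_ker_fderiv_chart_le {ρ : P → V} (hρ : ContMDiff 𝓘(ℝ, E) 𝓘(ℝ, V) ∞ ρ)
    (hΛ : ∀ x, ∃ Λ : V →L[ℝ] V, ∀ h, ρ (x * h) = Λ (ρ h)) {x : E}
    (hx : x ∈ (chartAt E (1 : P)).target) :
    Module.finrank ℝ (LinearMap.ker (fderiv ℝ (fun y => ρ ((chartAt E (1 : P)).symm y))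
      (chartAt E (1 : P) 1)).toLinearMap) ≤
    Module.finrank ℝ (LinearMap.ker (fderiv ℝ (fun y => ρ ((chartAt E (1 : P)).symm y))
      x).toLinearMap) := by
  set e := chartAt E (1 : P)
  set x₀ := e 1
  have h1 : (1 : P) ∈ e.source := mem_chart_source E 1
  have hx₀ : x₀ ∈ e.target := e.map_source h1
  have hes : ∀ y ∈ e.target, ContMDiffAt 𝓘(ℝ, E) 𝓘(ℝ, E) ∞ e.symm y := fun y hy =>
    (contMDiffOn_chart_symm (I := 𝓘(ℝ, E)) (x := (1 : P))).contMDiffAt (e.open_target.mem_nhds hy)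
  have he : ∀ y ∈ e.source, ContMDiffAt 𝓘(ℝ, E) 𝓘(ℝ, E) ∞ e y := fun y hy =>
    (contMDiffOn_chart (I := 𝓘(ℝ, E)) (x := (1 : P))).contMDiffAt (e.open_source.mem_nhds hy)
  set r : E → V := fun y => ρ (e.symm y)
  have hr : ∀ y ∈ e.target, DifferentiableAt ℝ r y := fun y hy =>
    (contMDiffAt_iff_contDiffAt.1 ((hρ _).comp y (hes y hy))).differentiableAt (by simp)
  set g := e.symm x
  have hg : g ∈ e.source := e.map_target hx
  have he1 : e.symm x₀ = 1 := e.left_inv h1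
  -- Left multiplication by `k`, read in the chart at `1`.
  let t : P → E → E := fun k y => e (k * e.symm y)
  have ht : ∀ k, ∀ y ∈ e.target, k * e.symm y ∈ e.source → DifferentiableAt ℝ (t k) y :=
    fun k y hy hky => (contMDiffAt_iff_contDiffAt.1 (ContMDiffAt.comp y (he _ hky)
      (((contMDiff_leftMul k) _).comp y (hes y hy)))).differentiableAt (by simp)
  have htx : t g x₀ = x := by
    change e (g * e.symm x₀) = x
    rw [he1, mul_one]
    exact e.right_inv hx
  have hgx : g * e.symm x₀ ∈ e.source := by rwa [he1, mul_one]
  have hd1 : HasFDerivAt (t g) (fderiv ℝ (t g) x₀) x₀ := (ht g x₀ hx₀ hgx).hasFDerivAt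
  have hd2 : HasFDerivAt (t g⁻¹) (fderiv ℝ (t g⁻¹) x) (t g x₀) := by
    rw [htx]
    refine (ht g⁻¹ x hx ?_).hasFDerivAt
    change g⁻¹ * g ∈ e.source
    rwa [inv_mul_cancel]
  have hnear : ∀ᶠ y in 𝓝 x₀, y ∈ e.target ∧ g * e.symm y ∈ e.source := by
    refine (e.open_target.eventually_mem hx₀).and ?_
    have hc : ContinuousAt (fun y => g * e.symm y) x₀ :=
      (((contMDiff_leftMul g) (e.symm x₀)).comp x₀ (hes x₀ hx₀)).continuousAt
    exact hc (e.open_source.mem_nhds hgx)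
  have hinv : (fderiv ℝ (t g⁻¹) x).comp (fderiv ℝ (t g) x₀) = ContinuousLinearMap.id ℝ E := by
    refine (hd2.comp x₀ hd1).unique ((hasFDerivAt_id x₀).congr_of_eventuallyEq ?_)
    filter_upwards [hnear] with y hy
    change e (g⁻¹ * e.symm (e (g * e.symm y))) = y
    rw [e.left_inv hy.2, inv_mul_cancel_left, e.right_inv hy.1]
  obtain ⟨Λ, hΛg⟩ := hΛ g
  have hcomp : (fderiv ℝ r x).comp (fderiv ℝ (t g) x₀) = Λ.comp (fderiv ℝ r x₀) := by
    have h2 : HasFDerivAt r (fderiv ℝ r x) (t g x₀) := by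
      rw [htx]; exact (hr x hx).hasFDerivAt
    refine (h2.comp x₀ hd1).unique
      ((Λ.hasFDerivAt.comp x₀ (hr x₀ hx₀).hasFDerivAt).congr_of_eventuallyEq ?_)
    filter_upwards [hnear] with y hy
    change ρ (e.symm (e (g * e.symm y))) = Λ (ρ (e.symm y))
    rw [e.left_inv hy.2, hΛg]
  let T : LinearMap.ker (fderiv ℝ r x₀).toLinearMap →ₗ[ℝ]
      LinearMap.ker (fderiv ℝ r x).toLinearMap :=
    (fderiv ℝ (t g) x₀).toLinearMap.restrict fun v hv => by
      have hv' : fderiv ℝ r x₀ v = 0 := hv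
      have := congrArg (fun A : E →L[ℝ] V => A v) hcomp
      change fderiv ℝ r x (fderiv ℝ (t g) x₀ v) = Λ (fderiv ℝ r x₀ v) at this
      rw [hv', map_zero] at this
      exact this
  refine LinearMap.finrank_le_finrank_of_injective (f := T) fun v w hvw => ?_
  have h3 : fderiv ℝ (t g) x₀ v = fderiv ℝ (t g) x₀ w := congrArg Subtype.val hvw
  have h4 := fun v => congrArg (fun A : E →L[ℝ] E => A v) hinv
  have h5 : ∀ v, fderiv ℝ (t g⁻¹) x (fderiv ℝ (t g) x₀ v) = v := h4
  exact Subtype.ext (by rw [← h5 v, h3, h5])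

variable [FiniteDimensional ℝ V]

/-- The quotient of a Lie group by the stabilizer of a vector in a linear representation has
slices. -/
theorem exists_slice_stabilizer {ρ : P → V} (hρ : ContMDiff 𝓘(ℝ, E) 𝓘(ℝ, V) ∞ ρ)
    (hΛ : ∀ x, ∃ Λ : V →L[ℝ] V, ∀ h, ρ (x * h) = Λ (ρ h))
    (hN : ∀ x y, ρ x = ρ y ↔ x⁻¹ * y ∈ N) :
    ∃ (a : ℕ) (D : SliceAt E (EuclideanSpace ℝ (Fin a)) (QuotientGroup.mk : P → P ⧸ N) 1),
      ∃ p : V →L[ℝ] EuclideanSpace ℝ (Fin a), ∀ x, D.f x = p (ρ x) := by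
  set e := chartAt E (1 : P)
  have h1 : (1 : P) ∈ e.source := mem_chart_source E 1
  have hes : ContMDiffOn 𝓘(ℝ, E) 𝓘(ℝ, E) ∞ e.symm e.target := contMDiffOn_chart_symm
  have he : ContMDiffOn 𝓘(ℝ, E) 𝓘(ℝ, E) ∞ e e.source := contMDiffOn_chart
  -- The constant rank theorem for `ρ` in the chart at `1`. The slice map `p ∘ ρ` is a function of
  -- `ρ`, whose fibres are the cosets of `N`, so it is automatically constant on cosets.
  obtain ⟨a, p, U, O, s, hU, h1U, hUe, hO, hfO, hs, hsU, hfs, hrs⟩ :=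
    exists_slice_of_constant_rank (r := fun y => ρ (e.symm y)) e.open_target (e.map_source h1)
      (contMDiffOn_iff_contDiffOn.1 (hρ.comp_contMDiffOn hes))
      (fun x hx => finrank_ker_fderiv_chart_le hρ hΛ hx)
  have hback : ∀ x ∈ e.source, e.symm (e x) = x := fun x hx => e.left_inv hx
  refine ⟨a, {
    U := e.source ∩ e ⁻¹' U
    O := O
    f := fun x => p (ρ x)
    s := fun c => e.symm (s c)
    isOpen_U := e.isOpen_inter_preimage hU
    mem := ⟨h1, h1U⟩
    isOpen_O := hO
    smooth_f := (p.contMDiff.comp hρ).contMDiffOn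
    smooth_s := hes.comp (contMDiffOn_iff_contDiffOn.2 hs) fun c hc => hUe (hsU c hc)
    f_mem := ?_
    s_mem := ?_
    f_s := hfs
    q_s := ?_
    f_eq := ?_ }, p, fun x => rfl⟩
  · intro x hx
    have := hfO _ hx.2
    rwa [hback x hx.1] at this
  · intro c hc
    refine ⟨e.map_target (hUe (hsU c hc)), ?_⟩
    rw [mem_preimage, e.right_inv (hUe (hsU c hc))]
    exact hsU c hc
  · intro x hx
    have := hrs _ hx.2
    rw [hback x hx.1] at this
    rw [QuotientGroup.eq]
    exact (hN _ _).1 this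
  · intro x _ y _ h
    rw [QuotientGroup.eq] at h
    rw [(hN x y).2 h]

/-- A slice contains the kernel of its derivative in the kernel of the derivative of the
quotient map. -/
theorem SliceAt.md_eq_zero {E : Type*} [NormedAddCommGroup E] [NormedSpace ℝ E]
    {N : Type*} [TopologicalSpace N] [ChartedSpace E N]
    {F : Type*} [NormedAddCommGroup F] [NormedSpace ℝ F]
    {F' : Type*} [NormedAddCommGroup F'] [NormedSpace ℝ F']
    {X : Type*} [TopologicalSpace X] [ChartedSpace F' X] {q : N → X} {u : N}
    (D : SliceAt E F q u) (hq : ContMDiff 𝓘(ℝ, E) 𝓘(ℝ, F') ∞ q) {v : E}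
    (hv : md E F D.f u v = 0) : md E F' q u v = 0 := by
  have hu : D.f u ∈ D.O := D.f_mem u D.mem
  -- Near `u` the quotient map factors through the slice map as `q = (q ∘ s) ∘ f`.
  have h1 : md E F' q u = md E F' (fun x => q (D.s (D.f x))) u := md_congr (by
    filter_upwards [D.isOpen_U.mem_nhds D.mem] with x hx
    exact (D.q_s x hx).symm)
  have h2 : MDifferentiableAt 𝓘(ℝ, F) 𝓘(ℝ, F') (fun c => q (D.s c)) (D.f u) :=
    ((hq _).comp _ (D.smooth_s.contMDiffAt (D.isOpen_O.mem_nhds hu))).mdifferentiableAt (by simp)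
  rw [h1, md_comp (g := fun c => q (D.s c)) h2
    ((D.smooth_f.contMDiffAt (D.isOpen_U.mem_nhds D.mem)).mdifferentiableAt (by simp))]
  change md F F' _ _ (md E F D.f u v) = 0
  rw [hv, map_zero]

end LieGroupSlices

end FilteredGeometry

namespace FilteredGeometry

/-! ### The associated graded of a filtration -/

section GradedQuotients

variable {V : Type*} [AddCommGroup V] [Module ℝ V] {F : ℤ → Submodule ℝ V}

theorem Gr.mk_surjective {i : ℤ} (x : Gr F i) : ∃ (v : V) (h : v ∈ F i), x = Gr.mk h := by
  obtain ⟨⟨v, h⟩, rfl⟩ := Submodule.Quotient.mk_surjective _ x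
  exact ⟨v, h, rfl⟩

theorem Gr.mk_eq_zero_iff {i : ℤ} {v : V} (h : v ∈ F i) :
    (Gr.mk h : Gr F i) = 0 ↔ v ∈ F (i + 1) :=
  Submodule.Quotient.mk_eq_zero _

theorem Gr.mk_eq_mk_iff {i : ℤ} {v w : V} (hv : v ∈ F i) (hw : w ∈ F i) :
    (Gr.mk hv : Gr F i) = Gr.mk hw ↔ v - w ∈ F (i + 1) :=
  Submodule.Quotient.eq _

/-- The projection of `F i` to `Gr F i`, extended to a linear map on the whole space. -/
noncomputable def Gr.proj (F : ℤ → Submodule ℝ V) (i : ℤ) : V →ₗ[ℝ] Gr F i :=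
  (LinearMap.exists_extend (((F (i + 1)).submoduleOf (F i)).mkQ)).choose

theorem Gr.proj_apply {i : ℤ} {v : V} (h : v ∈ F i) : Gr.proj F i v = Gr.mk h :=
  LinearMap.congr_fun
    (LinearMap.exists_extend (((F (i + 1)).submoduleOf (F i)).mkQ)).choose_spec ⟨v, h⟩

end GradedQuotients

/-! ### The quotient of the structure group -/

section StructureGroup

variable {𝔤 : Type*} [LieRing 𝔤] [LieAlgebra ℝ 𝔤] [FiniteDimensional ℝ 𝔤]
  {E_P : Type*} [NormedAddCommGroup E_P] [NormedSpace ℝ E_P]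
  {P : Type*} [Group P] [TopologicalSpace P] [ChartedSpace E_P P] {μ ν : ℕ}
  (A : AdmissiblePair 𝔤 E_P P μ ν)

namespace AdmissiblePair

theorem adGr_eq_proj (i : ℤ) {Z : 𝔤} (hZ : Z ∈ A.S.F i) :
    (fun g => A.adGr i g (Gr.mk hZ)) = fun g => Gr.proj A.S.F i (A.Ad g Z) := by
  funext g
  rw [adGr_mk, Gr.proj_apply]

theorem adGr_smooth (i : ℤ) (X : Gr A.S.F i) :
    SmoothOn E_P (fun g => A.adGr i g X) Set.univ := by
  obtain ⟨Z, hZ, rfl⟩ := Gr.mk_surjective X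
  rw [adGr_eq_proj]
  exact (A.Ad_smooth Z).map _

theorem derivAlong_adGr (i : ℤ) (a : GroupLieAlgebra 𝓘(ℝ, E_P) P) {Z : 𝔤} (hZ : Z ∈ A.S.F i) :
    derivAlong E_P (fun g => A.adGr i g (Gr.mk hZ)) 1 a = Gr.proj A.S.F i ⁅A.ι a, Z⁆ := by
  rw [adGr_eq_proj, derivAlong_map _ ((A.Ad_smooth Z).weakDiffAt Filter.univ_mem), A.Ad_deriv]

theorem ι_mem (a : GroupLieAlgebra 𝓘(ℝ, E_P) P) : A.ι a ∈ A.S.F 0 := by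
  rw [← A.ι_range]
  exact ⟨a, rfl⟩

theorem lie_ι_mem (a : GroupLieAlgebra 𝓘(ℝ, E_P) P) {i : ℤ} {Z : 𝔤} (hZ : Z ∈ A.S.F i) :
    ⁅A.ι a, Z⁆ ∈ A.S.F i := by
  have := A.S.lie_mem 0 i _ _ (A.ι_mem a) hZ
  rwa [zero_add] at this

/-- Only finitely many degrees contribute, so the conditions in all degrees that define `P_+` amount
to a condition on one vector of a finite dimensional space. -/
theorem gr_subsingleton {i : ℤ} (hi : i ∉ Finset.Icc (-(μ : ℤ)) ν) (X : Gr A.S.F i) : X = 0 := by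
  obtain ⟨Z, hZ, rfl⟩ := Gr.mk_surjective X
  rw [Gr.mk_eq_zero_iff]
  rw [Finset.mem_Icc, not_and_or, not_le, not_le] at hi
  rcases hi with hi | hi
  -- Below `-μ` the next step `i + 1` is still at most `-μ`, hence is all of `𝔤`.
  · rw [A.S.top _ (by omega)]
    trivial
  · rw [A.S.bot _ hi, Submodule.mem_bot] at hZ
    rw [hZ]
    exact zero_mem _

variable (μ ν) in
/-- The index set of a basis of `gr(𝔤)`. -/
abbrev GrIndex : Type := Σ i : Finset.Icc (-(μ : ℤ)) ν, Fin (Module.finrank ℝ (Gr A.S.F i))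

/-- The images of the elements of a basis of `gr(𝔤)` under `Ad_gr g`. -/
noncomputable def grOrbit (g : P) : ∀ k : A.GrIndex, Gr A.S.F k.1 := fun k =>
  A.adGr k.1 g (Module.finBasis ℝ (Gr A.S.F k.1) k.2)

/-- A linear automorphism is determined by its values on a basis. Thus `P_+` is a stabilizer, and
the fibres of the orbit map are its cosets. -/
theorem grOrbit_eq_iff (x y : P) : A.grOrbit x = A.grOrbit y ↔ x⁻¹ * y ∈ A.Pplus := by
  have key : ∀ i : ℤ, A.adGr i x = A.adGr i y ↔ x⁻¹ * y ∈ (A.adGr i).ker := fun i => by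
    rw [MonoidHom.mem_ker, map_mul, map_inv, inv_mul_eq_one]
  rw [Pplus, Subgroup.mem_iInf]
  simp only [← key]
  constructor
  · intro h i
    by_cases hi : i ∈ Finset.Icc (-(μ : ℤ)) ν
    · refine LinearEquiv.toLinearMap_injective ((Module.finBasis ℝ (Gr A.S.F i)).ext fun k => ?_)
      exact congrFun h ⟨⟨i, hi⟩, k⟩
    · refine LinearEquiv.ext fun X => ?_
      rw [A.gr_subsingleton hi X, map_zero, map_zero]
  · intro h
    funext k
    exact LinearEquiv.congr_fun (h k.1) _

theorem grOrbit_smooth : SmoothOn E_P A.grOrbit Set.univ :=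
  SmoothOn.pi fun _ => A.adGr_smooth _ _

/-- Bracketing with an element of `𝔤^1` raises the degree by one, so it induces zero on `gr(𝔤)`.
This is the infinitesimal reason why `P → P / P_+` kills `𝔤^1`. -/
theorem derivAlong_grOrbit {a : GroupLieAlgebra 𝓘(ℝ, E_P) P} (ha : A.ι a ∈ A.S.F 1) :
    derivAlong E_P A.grOrbit 1 a = 0 := by
  funext k
  have h := derivAlong_map (LinearMap.proj (R := ℝ) (φ := fun k : A.GrIndex => Gr A.S.F k.1) k)
    (A.grOrbit_smooth.weakDiffAt (x := 1) Filter.univ_mem) a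
  refine h.symm.trans ?_
  obtain ⟨Z, hZ, hb⟩ := Gr.mk_surjective (Module.finBasis ℝ (Gr A.S.F k.1) k.2)
  change derivAlong E_P (fun g => A.adGr k.1 g (Module.finBasis ℝ (Gr A.S.F k.1) k.2)) 1 a = 0
  rw [hb, derivAlong_adGr, Gr.proj_apply (A.lie_ι_mem a hZ), Gr.mk_eq_zero_iff, add_comm]
  exact A.S.lie_mem 1 _ _ _ ha hZ

/-- The space of coordinates of `grOrbit`. -/
abbrev GrCoord : Type := Fin (Module.finrank ℝ (∀ k : A.GrIndex, Gr A.S.F k.1)) → ℝ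

/-- Coordinates of `grOrbit`. -/
noncomputable def grOrbitCoord (g : P) : A.GrCoord :=
  (Module.finBasis ℝ (∀ k : A.GrIndex, Gr A.S.F k.1)).equivFun (A.grOrbit g)

theorem grOrbitCoord_eq_iff (x y : P) :
    A.grOrbitCoord x = A.grOrbitCoord y ↔ x⁻¹ * y ∈ A.Pplus := by
  rw [← A.grOrbit_eq_iff]
  exact (LinearEquiv.injective _).eq_iff

theorem contMDiff_grOrbitCoord : ContMDiff 𝓘(ℝ, E_P) 𝓘(ℝ, A.GrCoord) ∞ A.grOrbitCoord :=
  contMDiffOn_univ.1 (A.grOrbit_smooth.contMDiffOn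
    (Module.finBasis ℝ (∀ k : A.GrIndex, Gr A.S.F k.1)).equivFun.toLinearMap)

theorem md_pi_apply {E : Type*} [NormedAddCommGroup E] [NormedSpace ℝ E]
    {N : Type*} [TopologicalSpace N] [ChartedSpace E N] {κ : Type*} [Fintype κ] {f : N → κ → ℝ}
    {x : N} (hf : MDifferentiableAt 𝓘(ℝ, E) 𝓘(ℝ, κ → ℝ) f x) (v : E) (k : κ) :
    md E (κ → ℝ) f x v k = dirDeriv (E := E) (fun y => f y k) x v := by
  have hp : HasFDerivAt (ContinuousLinearMap.proj (R := ℝ) (φ := fun _ : κ => ℝ) k)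
    (ContinuousLinearMap.proj (R := ℝ) (φ := fun _ : κ => ℝ) k) (f x) :=
    ContinuousLinearMap.hasFDerivAt _
  have h := md_comp (g := fun w : κ → ℝ => w k) hp.differentiableAt.mdifferentiableAt hf
  refine (congrArg (fun B : E →L[ℝ] ℝ => B v) (h.trans (congrArg
    (fun B : (κ → ℝ) →L[ℝ] ℝ => B.comp (md E (κ → ℝ) f x)) (md_eq_fderiv.trans hp.fderiv)))).symm

theorem md_grOrbitCoord {a : GroupLieAlgebra 𝓘(ℝ, E_P) P} (ha : A.ι a ∈ A.S.F 1) :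
    md E_P A.GrCoord A.grOrbitCoord 1 a = 0 := by
  funext k
  refine (md_pi_apply ((A.contMDiff_grOrbitCoord 1).mdifferentiableAt (by simp)) a k).trans ?_
  have h := dual_derivAlong (A.grOrbit_smooth.weakDiffAt (x := 1) Filter.univ_mem) a
    ((Module.finBasis ℝ (∀ k : A.GrIndex, Gr A.S.F k.1)).coord k)
  rw [A.derivAlong_grOrbit ha, map_zero] at h
  exact h.symm

/-- The map `Λ` is `Ad_gr x` acting on tuples, written in coordinates; this is the equivariance that
makes the rank constant. -/
theorem grOrbitCoord_mul (x : P) : ∃ Λ : A.GrCoord →L[ℝ] A.GrCoord, ∀ h,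
    A.grOrbitCoord (x * h) = Λ (A.grOrbitCoord h) := by
  let L : (∀ k : A.GrIndex, Gr A.S.F k.1) →ₗ[ℝ] (∀ k : A.GrIndex, Gr A.S.F k.1) :=
    LinearMap.pi fun k => (A.adGr k.1 x).toLinearMap ∘ₗ LinearMap.proj k
  let B := (Module.finBasis ℝ (∀ k : A.GrIndex, Gr A.S.F k.1)).equivFun
  refine ⟨LinearMap.toContinuousLinearMap (B.toLinearMap ∘ₗ L ∘ₗ B.symm.toLinearMap),
    fun h => ?_⟩
  change B (A.grOrbit (x * h)) = B (L (B.symm (B (A.grOrbit h))))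
  rw [B.symm_apply_apply]
  congr 1
  funext k
  change A.adGr k.1 (x * h) _ = A.adGr k.1 x (A.adGr k.1 h _)
  rw [map_mul]
  rfl

/-- Slices for `P → P / P_+`; the derivative at `1` of the one at `1` vanishes on `𝔤^1`. -/
theorem exists_slice [LieGroup 𝓘(ℝ, E_P) ∞ P] [FiniteDimensional ℝ E_P] :
    ∃ (a : ℕ) (D : SliceAt E_P (EuclideanSpace ℝ (Fin a)) (QuotientGroup.mk : P → P ⧸ A.Pplus) 1),
      ∀ v : GroupLieAlgebra 𝓘(ℝ, E_P) P, A.ι v ∈ A.S.F 1 →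
        md E_P (EuclideanSpace ℝ (Fin a)) D.f 1 v = 0 := by
  obtain ⟨a, D, p, hp⟩ := exists_slice_stabilizer (N := A.Pplus) A.contMDiff_grOrbitCoord
    A.grOrbitCoord_mul A.grOrbitCoord_eq_iff
  refine ⟨a, D, fun v hv => ?_⟩
  have hD : D.f = fun x => p (A.grOrbitCoord x) := funext hp
  rw [hD, md_comp p.differentiableAt.mdifferentiableAt
    ((A.contMDiff_grOrbitCoord 1).mdifferentiableAt (by simp))]
  change md _ _ _ _ (md E_P A.GrCoord A.grOrbitCoord 1 v) = 0
  rw [A.md_grOrbitCoord hv, map_zero]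

/-- A stabilizer is the preimage of a point under a continuous orbit map. Closedness makes both
quotients Hausdorff. -/
theorem isClosed_Pplus : IsClosed (A.Pplus : Set P) := by
  have h : (A.Pplus : Set P) = A.grOrbitCoord ⁻¹' {A.grOrbitCoord 1} := by
    ext x
    rw [Set.mem_preimage, Set.mem_singleton_iff, eq_comm, A.grOrbitCoord_eq_iff, inv_one, one_mul,
      SetLike.mem_coe]
  rw [h]
  exact isClosed_singleton.preimage A.contMDiff_grOrbitCoord.continuous

end AdmissiblePair

end StructureGroup

end FilteredGeometry

namespace FilteredGeometry

/-! ### Local trivializations of principal bundles -/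

section LocalTrivializations

open MulOpposite Set

variable {E_B E_K E_M : Type*} [NormedAddCommGroup E_B] [NormedSpace ℝ E_B]
  [NormedAddCommGroup E_K] [NormedSpace ℝ E_K] [NormedAddCommGroup E_M] [NormedSpace ℝ E_M]
  {K : Type*} [Group K] [TopologicalSpace K] [ChartedSpace E_K K]
  {B : Type*} [TopologicalSpace B] [ChartedSpace E_B B] [MulAction Kᵐᵒᵖ B]
  {M : Type*} [TopologicalSpace M] [ChartedSpace E_M M]

variable (E_B E_K E_M) in
/-- `χ` is a local trivialization over `U` of the principal bundle `π`. -/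
structure IsBundleChart (π : B → M) (U : Set M) (χ : OpenPartialHomeomorph B (M × K)) : Prop where
  isOpen : IsOpen U
  source_eq : χ.source = π ⁻¹' U
  target_eq : χ.target = U ×ˢ Set.univ
  smooth : ContMDiffOn 𝓘(ℝ, E_B) (𝓘(ℝ, E_M).prod 𝓘(ℝ, E_K)) ∞ χ χ.source
  smooth_symm : ContMDiffOn (𝓘(ℝ, E_M).prod 𝓘(ℝ, E_K)) 𝓘(ℝ, E_B) ∞ χ.symm χ.target
  fst_eq : ∀ u ∈ χ.source, (χ u).1 = π u
  smul_eq : ∀ u ∈ χ.source, ∀ g : K, χ (op g • u) = ((χ u).1, (χ u).2 * g)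

theorem IsPrincipalBundle.exists_chart {π : B → M} (h : IsPrincipalBundle E_B E_K E_M K π)
    (x : M) : ∃ (U : Set M) (χ : OpenPartialHomeomorph B (M × K)),
      x ∈ U ∧ IsBundleChart E_B E_K E_M π U χ := by
  obtain ⟨U, χ, hU, hx, hs, ht, h1, h2, h3⟩ := h.locallyTrivial x
  exact ⟨U, χ, hx, hU, hs, ht, h1, h2, fun u hu => (h3 u hu).1, fun u hu => (h3 u hu).2⟩

theorem IsPrincipalBundle.smooth_smul {π : B → M} (h : IsPrincipalBundle E_B E_K E_M K π) (g : K) :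
    ContMDiff 𝓘(ℝ, E_B) 𝓘(ℝ, E_B) ∞ (fun u : B => op g • u) :=
  h.smooth_act.comp (contMDiff_id.prodMk contMDiff_const)

theorem IsPrincipalBundle.smooth_orbit {π : B → M} (h : IsPrincipalBundle E_B E_K E_M K π) (u : B) :
    ContMDiff 𝓘(ℝ, E_K) 𝓘(ℝ, E_B) ∞ (fun g : K => op g • u) :=
  h.smooth_act.comp (contMDiff_const.prodMk contMDiff_id)

theorem IsPrincipalBundle.continuousConstSMul {π : B → M}
    (h : IsPrincipalBundle E_B E_K E_M K π) : ContinuousConstSMul Kᵐᵒᵖ B :=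
  ⟨fun g => (h.smooth_smul g.unop).continuous⟩

namespace IsBundleChart

variable {π : B → M} {U : Set M} {χ : OpenPartialHomeomorph B (M × K)}

theorem mem_source (h : IsBundleChart E_B E_K E_M π U χ) {u : B} : u ∈ χ.source ↔ π u ∈ U := by
  rw [h.source_eq, mem_preimage]

theorem mem_target (h : IsBundleChart E_B E_K E_M π U χ) {y : M} {g : K} :
    (y, g) ∈ χ.target ↔ y ∈ U := by
  rw [h.target_eq]
  simp

theorem symm_mem (h : IsBundleChart E_B E_K E_M π U χ) {y : M} (hy : y ∈ U) (g : K) :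
    χ.symm (y, g) ∈ χ.source :=
  χ.map_target (h.mem_target.2 hy)

theorem apply_symm (h : IsBundleChart E_B E_K E_M π U χ) {y : M} (hy : y ∈ U) (g : K) :
    χ (χ.symm (y, g)) = (y, g) :=
  χ.right_inv (h.mem_target.2 hy)

theorem proj_symm (h : IsBundleChart E_B E_K E_M π U χ) {y : M} (hy : y ∈ U) (g : K) :
    π (χ.symm (y, g)) = y := by
  rw [← h.fst_eq _ (h.symm_mem hy g), h.apply_symm hy]

theorem apply_eq (h : IsBundleChart E_B E_K E_M π U χ) {u : B} (hu : π u ∈ U) :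
    χ u = (π u, (χ u).2) :=
  Prod.ext (h.fst_eq u (h.mem_source.2 hu)) rfl

theorem symm_apply (h : IsBundleChart E_B E_K E_M π U χ) {u : B} (hu : π u ∈ U) :
    χ.symm (π u, (χ u).2) = u := by
  rw [← h.apply_eq hu]
  exact χ.left_inv (h.mem_source.2 hu)

theorem snd_smul (h : IsBundleChart E_B E_K E_M π U χ) {u : B} (hu : π u ∈ U) (g : K) :
    (χ (op g • u)).2 = (χ u).2 * g := by
  rw [h.smul_eq u (h.mem_source.2 hu)]

theorem contMDiffAt (h : IsBundleChart E_B E_K E_M π U χ) {u : B} (hu : π u ∈ U) :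
    ContMDiffAt 𝓘(ℝ, E_B) (𝓘(ℝ, E_M).prod 𝓘(ℝ, E_K)) ∞ χ u :=
  h.smooth.contMDiffAt (χ.open_source.mem_nhds (h.mem_source.2 hu))

theorem contMDiffAt_snd (h : IsBundleChart E_B E_K E_M π U χ) {u : B} (hu : π u ∈ U) :
    ContMDiffAt 𝓘(ℝ, E_B) 𝓘(ℝ, E_K) ∞ (fun w => (χ w).2) u :=
  (h.contMDiffAt hu).snd

theorem contMDiffAt_symm (h : IsBundleChart E_B E_K E_M π U χ) {y : M} (hy : y ∈ U) (g : K) :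
    ContMDiffAt (𝓘(ℝ, E_M).prod 𝓘(ℝ, E_K)) 𝓘(ℝ, E_B) ∞ χ.symm (y, g) :=
  h.smooth_symm.contMDiffAt (χ.open_target.mem_nhds (h.mem_target.2 hy))

theorem contMDiffAt_section (h : IsBundleChart E_B E_K E_M π U χ) {y : M} (hy : y ∈ U) (g : K) :
    ContMDiffAt 𝓘(ℝ, E_M) 𝓘(ℝ, E_B) ∞ (fun y => χ.symm (y, g)) y :=
  ContMDiffAt.comp y (h.contMDiffAt_symm hy g) (contMDiffAt_id.prodMk contMDiffAt_const)

theorem smul_symm (h : IsBundleChart E_B E_K E_M π U χ) (hp : IsPrincipalBundle E_B E_K E_M K π)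
    {y : M} (hy : y ∈ U) (g k : K) : op k • χ.symm (y, g) = χ.symm (y, g * k) := by
  have h1 : π (op k • χ.symm (y, g)) = y := by rw [hp.proj_act, h.proj_symm hy]
  have h2 := h.symm_apply (u := op k • χ.symm (y, g)) (by rwa [h1])
  rw [h1, h.snd_smul (by rwa [h.proj_symm hy]), h.apply_symm hy] at h2
  exact h2.symm

end IsBundleChart

end LocalTrivializations

/-! ### Quotients of principal bundles by normal subgroups of the structure group -/

section Orbits

open MulOpposite

variable {P : Type*} [Group P] {B : Type*} [MulAction Pᵐᵒᵖ B] {N : Subgroup P}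

namespace OrbitSpace

theorem mk_eq_mk_iff {u u' : B} : mk N u = mk N u' ↔ ∃ n ∈ N, op n • u' = u := by
  constructor
  · intro h
    obtain ⟨n, hn⟩ := Quotient.exact h
    exact ⟨n.1.unop, n.2, hn⟩
  · rintro ⟨n, hn, rfl⟩
    exact mk_act N u' hn

theorem mk_surjective : Function.Surjective (mk N : B → OrbitSpace N B) :=
  Quotient.mk_surjective

end OrbitSpace

end Orbits

/-! ### Topology, charts and bundle structure of the orbit space `B / N`. -/

section QuotientBundle

open MulOpposite Set

variable {E_B E_P E_M : Type*} [NormedAddCommGroup E_B] [NormedSpace ℝ E_B]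
  [NormedAddCommGroup E_P] [NormedSpace ℝ E_P] [NormedAddCommGroup E_M] [NormedSpace ℝ E_M]
  {P : Type*} [Group P] [TopologicalSpace P] [ChartedSpace E_P P]
  {B : Type*} [TopologicalSpace B] [ChartedSpace E_B B] [MulAction Pᵐᵒᵖ B]
  {M : Type*} [TopologicalSpace M] [ChartedSpace E_M M]
  {N : Subgroup P} {π : B → M}

namespace OrbitSpace

/-- The projection of the orbit space to the base. -/
def proj (hπ : IsPrincipalBundle E_B E_P E_M P π) : OrbitSpace N B → M :=
  Quotient.lift π (by
    rintro u u' ⟨n, hn⟩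
    have hn' : op n.1.unop • u' = u := hn
    rw [← hn', hπ.proj_act])

theorem proj_mk (hπ : IsPrincipalBundle E_B E_P E_M P π) (u : B) :
    proj hπ (mk N u) = π u := rfl

theorem isOpenQuotientMap_mk (hπ : IsPrincipalBundle E_B E_P E_M P π) :
    IsOpenQuotientMap (mk N : B → OrbitSpace N B) := by
  have := hπ.continuousConstSMul
  have : ContinuousConstSMul N.op B := ⟨fun n => continuous_const_smul (n : Pᵐᵒᵖ)⟩
  exact MulAction.isOpenQuotientMap_quotientMk

end OrbitSpace

/-- In a bundle chart the action is right multiplication on the second factor, so the orbits of `N`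
are the products of points of the base with left cosets of `N`. -/
theorem IsBundleChart.orbit_eq_iff {U : Set M} {χ : OpenPartialHomeomorph B (M × P)}
    (h : IsBundleChart E_B E_P E_M π U χ) (hπ : IsPrincipalBundle E_B E_P E_M P π) {u u' : B}
    (hu : π u ∈ U) (hu' : π u' ∈ U) :
    OrbitSpace.mk N u = OrbitSpace.mk N u' ↔
      π u = π u' ∧ ((χ u).2 : P ⧸ N) = ((χ u').2 : P ⧸ N) := by
  rw [OrbitSpace.mk_eq_mk_iff]
  constructor
  · rintro ⟨n, hn, rfl⟩
    refine ⟨hπ.proj_act _ _, ?_⟩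
    rw [h.snd_smul hu', QuotientGroup.mk_mul_of_mem _ hn]
  · rintro ⟨h1, h2⟩
    rw [QuotientGroup.eq] at h2
    -- The element carrying `u'` to `u` is `(χ u').2⁻¹ * (χ u).2`, written as an inverse to match
    -- the membership given by the coset equality.
    refine ⟨((χ u).2⁻¹ * (χ u').2)⁻¹, N.inv_mem h2, ?_⟩
    have e := h.smul_symm hπ hu' (χ u').2 ((χ u).2⁻¹ * (χ u').2)⁻¹
    rw [h.symm_apply hu'] at e
    rw [e, mul_inv_rev, inv_inv, mul_inv_cancel_left, ← h1, h.symm_apply hu]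

/-- Slices for the orbit space of a principal bundle, from slices for the quotient of the
structure group. -/
noncomputable def IsBundleChart.slice [IsManifold 𝓘(ℝ, E_M) ∞ M]
    {F : Type*} [NormedAddCommGroup F] [NormedSpace ℝ F]
    {U : Set M} {χ : OpenPartialHomeomorph B (M × P)}
    (h : IsBundleChart E_B E_P E_M π U χ) (hπ : IsPrincipalBundle E_B E_P E_M P π) (u : B)
    (hu : π u ∈ U) (D : SliceAt E_P F (QuotientGroup.mk : P → P ⧸ N) (χ u).2) :
    SliceAt E_B (E_M × F) (OrbitSpace.mk N : B → OrbitSpace N B) u where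
  U := {w | π w ∈ U ∩ (chartAt E_M (π u)).source ∧ (χ w).2 ∈ D.U}
  O := ((chartAt E_M (π u)).target ∩ (chartAt E_M (π u)).symm ⁻¹' U) ×ˢ D.O
  f w := (chartAt E_M (π u) (π w), D.f (χ w).2)
  s c := χ.symm ((chartAt E_M (π u)).symm c.1, D.s c.2)
  isOpen_U := by
    have h1 : IsOpen (π ⁻¹' (U ∩ (chartAt E_M (π u)).source)) :=
      (h.isOpen.inter (chartAt E_M (π u)).open_source).preimage hπ.smooth_proj.continuous
    have h2 : ContinuousOn (fun w => (χ w).2) (π ⁻¹' (U ∩ (chartAt E_M (π u)).source)) :=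
      fun w hw => (h.contMDiffAt_snd hw.1).continuousAt.continuousWithinAt
    exact h2.isOpen_inter_preimage h1 D.isOpen_U
  mem := ⟨⟨hu, mem_chart_source _ _⟩, D.mem⟩
  isOpen_O := ((chartAt E_M (π u)).isOpen_inter_preimage_symm h.isOpen).prod D.isOpen_O
  smooth_f := fun w hw => by
    have h1 := (contMDiffOn_chart (I := 𝓘(ℝ, E_M)) (n := ∞) (x := π u)).contMDiffAt
      ((chartAt E_M (π u)).open_source.mem_nhds hw.1.2)
    have h2 := ContMDiffAt.comp w h1 (hπ.smooth_proj w)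
    have h3 := ContMDiffAt.comp w (D.smooth_f.contMDiffAt (D.isOpen_U.mem_nhds hw.2))
      (h.contMDiffAt_snd hw.1.1)
    exact (h2.prodMk_space h3).contMDiffWithinAt
  smooth_s := fun c hc => by
    have h1 := (contMDiffOn_chart_symm (I := 𝓘(ℝ, E_M)) (n := ∞) (x := π u)).contMDiffAt
      ((chartAt E_M (π u)).open_target.mem_nhds hc.1.1)
    have h2 : ContMDiffAt 𝓘(ℝ, E_M × F) 𝓘(ℝ, E_M) ∞
        (fun c : E_M × F => (chartAt E_M (π u)).symm c.1) c :=
      ContMDiffAt.comp c h1 contDiff_fst.contMDiff.contMDiffAt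
    have h3 : ContMDiffAt 𝓘(ℝ, E_M × F) 𝓘(ℝ, E_P) ∞ (fun c : E_M × F => D.s c.2) c :=
      ContMDiffAt.comp c (D.smooth_s.contMDiffAt (D.isOpen_O.mem_nhds hc.2))
        contDiff_snd.contMDiff.contMDiffAt
    exact (ContMDiffAt.comp c (h.contMDiffAt_symm hc.1.2 _) (h2.prodMk h3)).contMDiffWithinAt
  f_mem w hw := by
    refine ⟨⟨(chartAt E_M (π u)).map_source hw.1.2, ?_⟩, D.f_mem _ hw.2⟩
    rw [mem_preimage, (chartAt E_M (π u)).left_inv hw.1.2]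
    exact hw.1.1
  s_mem c hc := by
    rw [mem_ofPred_eq, h.proj_symm hc.1.2, h.apply_symm hc.1.2]
    exact ⟨⟨hc.1.2, (chartAt E_M (π u)).map_target hc.1.1⟩, D.s_mem _ hc.2⟩
  f_s c hc := by
    rw [h.proj_symm hc.1.2, h.apply_symm hc.1.2, (chartAt E_M (π u)).right_inv hc.1.1,
      D.f_s _ hc.2]
  q_s w hw := by
    rw [(chartAt E_M (π u)).left_inv hw.1.2, h.orbit_eq_iff hπ _ hw.1.1, h.proj_symm hw.1.1,
      h.apply_symm hw.1.1]
    · exact ⟨rfl, D.q_s _ hw.2⟩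
    · rw [h.proj_symm hw.1.1]
      exact hw.1.1
  f_eq w hw w' hw' e := by
    rw [h.orbit_eq_iff hπ hw.1.1 hw'.1.1] at e
    rw [e.1, D.f_eq _ hw.2 _ hw'.2 e.2]

/-- For an open quotient map it suffices that the orbit relation be closed. Points over different
base points are separated in `M`; over the same base point a chart measures their difference by a
group element, and lying outside the closed subgroup `N` is an open condition. -/
theorem OrbitSpace.t2Space [T2Space M] [IsTopologicalGroup P] (hN : IsClosed (N : Set P))
    (hπ : IsPrincipalBundle E_B E_P E_M P π) : T2Space (OrbitSpace N B) := by
  rw [t2Space_iff_of_isOpenQuotientMap (OrbitSpace.isOpenQuotientMap_mk hπ), ← isOpen_compl_iff,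
    isOpen_iff_mem_nhds]
  rintro ⟨u, u'⟩ huu'
  have huu : ¬ OrbitSpace.mk N u = OrbitSpace.mk N u' := huu'
  have hc := hπ.smooth_proj.continuous
  by_cases hx : π u = π u'
  · obtain ⟨U, χ, hu, h⟩ := hπ.exists_chart (π u)
    have hu' : π u' ∈ U := hx ▸ hu
    have hne : ¬ (χ u).2⁻¹ * (χ u').2 ∈ N := fun hn =>
      huu ((h.orbit_eq_iff hπ hu hu').2 ⟨hx, QuotientGroup.eq.2 hn⟩)
    have h1 : ContinuousAt (fun p : B × B => (χ p.1).2⁻¹ * (χ p.2).2) (u, u') :=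
      (ContinuousAt.comp (x := (u, u')) (h.contMDiffAt_snd hu).continuousAt
        continuousAt_fst).inv.mul
        (ContinuousAt.comp (x := (u, u')) (h.contMDiffAt_snd hu').continuousAt continuousAt_snd)
    filter_upwards [h1 (hN.isOpen_compl.mem_nhds hne),
      (h.isOpen.preimage (hc.comp continuous_fst)).mem_nhds hu,
      (h.isOpen.preimage (hc.comp continuous_snd)).mem_nhds hu'] with p hp hp1 hp2 e
    exact hp (QuotientGroup.eq.1 ((h.orbit_eq_iff hπ hp1 hp2).1 e).2)
  · have h1 : IsOpen {p : B × B | π p.1 ≠ π p.2} :=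
      isOpen_ne_fun (hc.comp continuous_fst) (hc.comp continuous_snd)
    filter_upwards [h1.mem_nhds hx] with p hp e
    exact hp (congrArg (OrbitSpace.proj hπ) e)

theorem OrbitSpace.secondCountableTopology [SecondCountableTopology B]
    (hπ : IsPrincipalBundle E_B E_P E_M P π) : SecondCountableTopology (OrbitSpace N B) := by
  have := hπ.continuousConstSMul
  have : ContinuousConstSMul N.op B := ⟨fun n => continuous_const_smul (n : Pᵐᵒᵖ)⟩
  exact ContinuousConstSMul.secondCountableTopology

/-- The maps `τ` required by `exists_manifold_of_slices` are the right translations by elements of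
`N`. -/
theorem OrbitSpace.exists_translation (hπ : IsPrincipalBundle E_B E_P E_M P π) (u u' : B)
    (h : mk N u = mk N u') : ∃ τ : B → B, ContMDiffAt 𝓘(ℝ, E_B) 𝓘(ℝ, E_B) ∞ τ u ∧ τ u = u' ∧
      ∀ᶠ z in 𝓝 u, mk N (τ z) = mk N z := by
  obtain ⟨n, hn, hu⟩ := mk_eq_mk_iff.1 h.symm
  exact ⟨fun w => op n • w, (hπ.smooth_smul n) u, hu, Filter.Eventually.of_forall fun z =>
    mk_act N z hn⟩

/-- A slice composed with a linear isomorphism. -/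
noncomputable def SliceAt.mapEquiv {F F' : Type*} [NormedAddCommGroup F] [NormedSpace ℝ F]
    [NormedAddCommGroup F'] [NormedSpace ℝ F'] {X : Type*} {q : B → X} {u : B}
    (D : SliceAt E_B F q u) (e : F ≃L[ℝ] F') : SliceAt E_B F' q u where
  U := D.U
  O := e.symm ⁻¹' D.O
  f w := e (D.f w)
  s c := D.s (e.symm c)
  isOpen_U := D.isOpen_U
  mem := D.mem
  isOpen_O := D.isOpen_O.preimage e.symm.continuous
  smooth_f := e.contDiff.contMDiff.comp_contMDiffOn D.smooth_f
  smooth_s := D.smooth_s.comp e.symm.contDiff.contMDiff.contMDiffOn fun c hc => hc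
  f_mem w hw := by
    rw [mem_preimage, e.symm_apply_apply]
    exact D.f_mem w hw
  s_mem c hc := D.s_mem _ hc
  f_s c hc := by rw [D.f_s _ hc, e.apply_symm_apply]
  q_s w hw := by rw [e.symm_apply_apply, D.q_s w hw]
  f_eq w hw w' hw' h := by rw [D.f_eq w hw w' hw' h]

/-- The orbit space of a principal bundle is a manifold if the quotient of the structure group has
slices. -/
theorem OrbitSpace.exists_manifold [IsManifold 𝓘(ℝ, E_M) ∞ M] [FiniteDimensional ℝ E_M]
    {F : Type*} [NormedAddCommGroup F] [NormedSpace ℝ F] [FiniteDimensional ℝ F]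
    (hπ : IsPrincipalBundle E_B E_P E_M P π)
    (D : ∀ g, SliceAt E_P F (QuotientGroup.mk : P → P ⧸ N) g) :
    ∃ (b : ℕ) (_ : ChartedSpace (EuclideanSpace ℝ (Fin b)) (OrbitSpace N B)),
      IsManifold 𝓘(ℝ, EuclideanSpace ℝ (Fin b)) ∞ (OrbitSpace N B) ∧
      HasSmoothSections E_B (EuclideanSpace ℝ (Fin b)) (mk N : B → OrbitSpace N B) := by
  have e : (E_M × F) ≃L[ℝ] EuclideanSpace ℝ (Fin (Module.finrank ℝ (E_M × F))) :=
    ContinuousLinearEquiv.ofFinrankEq (by simp)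
  refine ⟨Module.finrank ℝ (E_M × F), exists_manifold_of_slices (E := E_B)
    (isOpenQuotientMap_mk hπ) (fun u => ?_) (exists_translation hπ)⟩
  obtain ⟨U, χ, hu, h⟩ := hπ.exists_chart (π u)
  exact ⟨(h.slice hπ u hu (D _)).mapEquiv e⟩

/-- The quotient of a Lie group by a normal subgroup with slices is a manifold. -/
theorem exists_manifold_quotientGroup [LieGroup 𝓘(ℝ, E_P) ∞ P]
    {F : Type*} [NormedAddCommGroup F] [NormedSpace ℝ F]
    (D : ∀ g, SliceAt E_P F (QuotientGroup.mk : P → P ⧸ N) g) :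
    ∃ (_ : ChartedSpace F (P ⧸ N)), IsManifold 𝓘(ℝ, F) ∞ (P ⧸ N) ∧
      HasSmoothSections E_P F (QuotientGroup.mk : P → P ⧸ N) := by
  have : IsTopologicalGroup P := topologicalGroup_of_lieGroup 𝓘(ℝ, E_P) ∞
  refine exists_manifold_of_slices QuotientGroup.isOpenQuotientMap_mk (fun g => ⟨D g⟩)
    fun x y h => ?_
  rw [QuotientGroup.eq] at h
  refine ⟨fun z => z * (x⁻¹ * y), contMDiff_mul_right.contMDiffAt, by simp,
    Filter.Eventually.of_forall fun z => ?_⟩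
  exact QuotientGroup.mk_mul_of_mem z h

theorem HasSmoothSections.lieGroup [LieGroup 𝓘(ℝ, E_P) ∞ P] [N.Normal]
    {F : Type*} [NormedAddCommGroup F] [NormedSpace ℝ F] [ChartedSpace F (P ⧸ N)]
    [IsManifold 𝓘(ℝ, F) ∞ (P ⧸ N)]
    (h : HasSmoothSections E_P F (QuotientGroup.mk : P → P ⧸ N)) :
    LieGroup 𝓘(ℝ, F) ∞ (P ⧸ N) where
  contMDiff_mul := by
    rintro ⟨a, b⟩
    obtain ⟨x, rfl⟩ := QuotientGroup.mk_surjective a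
    obtain ⟨y, rfl⟩ := QuotientGroup.mk_surjective b
    refine h.contMDiffAt_of_comp_prod (g := fun p => p.1 * p.2) h ?_
    exact ((h.smooth.comp (contMDiff_mul 𝓘(ℝ, E_P) ∞)) (x, y))
  contMDiff_inv := by
    intro a
    obtain ⟨x, rfl⟩ := QuotientGroup.mk_surjective a
    refine h.contMDiffAt_of_comp (g := fun p => p⁻¹) ?_
    exact (h.smooth.comp (contMDiff_inv 𝓘(ℝ, E_P) ∞)) x

variable {F : Type*} [NormedAddCommGroup F] [NormedSpace ℝ F] [ChartedSpace F (P ⧸ N)]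
  {F' : Type*} [NormedAddCommGroup F'] [NormedSpace ℝ F'] [ChartedSpace F' (OrbitSpace N B)]

theorem OrbitSpace.contMDiff_proj (hπ : IsPrincipalBundle E_B E_P E_M P π)
    (hB : HasSmoothSections E_B F' (mk N : B → OrbitSpace N B)) :
    ContMDiff 𝓘(ℝ, F') 𝓘(ℝ, E_M) ∞ (proj hπ : OrbitSpace N B → M) := by
  intro w
  obtain ⟨u, rfl⟩ := mk_surjective w
  exact hB.contMDiffAt_of_comp (hπ.smooth_proj u)

/-- The local trivialization of the quotient of a principal bundle. -/
theorem IsBundleChart.exists_quotient_chart {U : Set M} {χ : OpenPartialHomeomorph B (M × P)}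
    (h : IsBundleChart E_B E_P E_M π U χ) (hπ : IsPrincipalBundle E_B E_P E_M P π)
    (hP : HasSmoothSections E_P F (QuotientGroup.mk : P → P ⧸ N))
    (hB : HasSmoothSections E_B F' (OrbitSpace.mk N : B → OrbitSpace N B)) :
    ∃ χ₀ : OpenPartialHomeomorph (OrbitSpace N B) (M × (P ⧸ N)),
      χ₀.source = OrbitSpace.proj hπ ⁻¹' U ∧ χ₀.target = U ×ˢ Set.univ ∧
      ContMDiffOn 𝓘(ℝ, F') (𝓘(ℝ, E_M).prod 𝓘(ℝ, F)) ∞ χ₀ χ₀.source ∧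
      ContMDiffOn (𝓘(ℝ, E_M).prod 𝓘(ℝ, F)) 𝓘(ℝ, F') ∞ χ₀.symm χ₀.target ∧
      ∀ u, π u ∈ U → χ₀ (OrbitSpace.mk N u) = (π u, ((χ u).2 : P ⧸ N)) := by
  let lift : OrbitSpace N B → B := fun w => (OrbitSpace.mk_surjective w).choose
  have hlift : ∀ w, OrbitSpace.mk N (lift w) = w :=
    fun w => (OrbitSpace.mk_surjective w).choose_spec
  -- The chart and its inverse are built from arbitrary representatives; `hf` and `hg` show that the
  -- choices do not matter over `U`, which also gives smoothness, because the pullbacks to `B` and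
  -- `M × P` come from `χ`.
  let f : OrbitSpace N B → M × (P ⧸ N) := fun w => (OrbitSpace.proj hπ w, (χ (lift w)).2)
  let g : M × (P ⧸ N) → OrbitSpace N B := fun c => OrbitSpace.mk N (χ.symm (c.1, c.2.out))
  have hf : ∀ u, π u ∈ U → f (OrbitSpace.mk N u) = (π u, ((χ u).2 : P ⧸ N)) := by
    intro u hu
    have h1 : π (lift (OrbitSpace.mk N u)) = π u :=
      congrArg (OrbitSpace.proj hπ) (hlift (OrbitSpace.mk N u))
    exact Prod.ext rfl ((h.orbit_eq_iff hπ (by rwa [h1]) hu).1 (hlift _)).2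
  have hg : ∀ y ∈ U, ∀ k : P, g (y, (k : P ⧸ N)) = OrbitSpace.mk N (χ.symm (y, k)) := by
    intro y hy k
    rw [h.orbit_eq_iff hπ, h.proj_symm hy, h.proj_symm hy, h.apply_symm hy, h.apply_symm hy]
    · exact ⟨rfl, Quotient.out_eq' (k : P ⧸ N)⟩
    · rwa [h.proj_symm hy]
    · rwa [h.proj_symm hy]
  have hproj := OrbitSpace.contMDiff_proj hπ hB
  have hS : IsOpen (OrbitSpace.proj hπ ⁻¹' U : Set (OrbitSpace N B)) :=
    h.isOpen.preimage hproj.continuous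
  have hfs : ContMDiffOn 𝓘(ℝ, F') (𝓘(ℝ, E_M).prod 𝓘(ℝ, F)) ∞ f (OrbitSpace.proj hπ ⁻¹' U) := by
    intro w hw
    obtain ⟨u, rfl⟩ := OrbitSpace.mk_surjective w
    have hw' : π u ∈ U := hw
    refine (hproj.contMDiffAt.prodMk ?_).contMDiffWithinAt
    refine hB.contMDiffAt_of_comp (g := fun w => ((χ (lift w)).2 : P ⧸ N)) ?_
    refine ((hP.smooth _).comp u (h.contMDiffAt_snd hw')).congr_of_eventuallyEq ?_
    filter_upwards [(h.isOpen.preimage hπ.smooth_proj.continuous).mem_nhds hw'] with z hz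
    exact congrArg Prod.snd (hf z hz)
  have hgs : ContMDiffOn (𝓘(ℝ, E_M).prod 𝓘(ℝ, F)) 𝓘(ℝ, F') ∞ g (U ×ˢ Set.univ) := by
    rintro ⟨y, a⟩ ⟨hy, -⟩
    obtain ⟨k, rfl⟩ := QuotientGroup.mk_surjective a
    -- Only the group factor is a quotient; the identity of `M` fills the other place in the descent
    -- lemma for products.
    have hid : HasSmoothSections E_M E_M (fun y : M => y) :=
      ⟨contMDiff_id, fun u => ⟨fun y => y, contMDiffAt_id, rfl,
        Filter.Eventually.of_forall fun _ => rfl⟩⟩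
    refine (hid.contMDiffAt_of_comp_prod hP (g := g) (u := y) (v := k) ?_).contMDiffWithinAt
    refine ((hB.smooth _).comp _ (h.contMDiffAt_symm hy k)).congr_of_eventuallyEq ?_
    filter_upwards [(h.isOpen.preimage continuous_fst).mem_nhds (x := (y, k)) hy] with z hz
    exact hg z.1 hz z.2
  refine ⟨
    { toFun := f
      invFun := g
      source := OrbitSpace.proj hπ ⁻¹' U
      target := U ×ˢ Set.univ
      map_source' := fun w hw => ⟨hw, trivial⟩
      map_target' := ?_
      left_inv' := ?_
      right_inv' := ?_
      open_source := hS
      open_target := h.isOpen.prod isOpen_univ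
      continuousOn_toFun := hfs.continuousOn
      continuousOn_invFun := hgs.continuousOn }, rfl, rfl, hfs, hgs, hf⟩
  · rintro ⟨y, a⟩ ⟨hy, -⟩
    obtain ⟨k, rfl⟩ := QuotientGroup.mk_surjective a
    have hy' : y ∈ U := hy
    rw [hg y hy' k, mem_preimage, OrbitSpace.proj_mk, h.proj_symm hy']
    exact hy'
  · intro w hw
    obtain ⟨u, rfl⟩ := OrbitSpace.mk_surjective w
    have hw' : π u ∈ U := hw
    rw [hf u hw', hg _ hw', h.symm_apply hw']
  · rintro ⟨y, a⟩ ⟨hy, -⟩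
    obtain ⟨k, rfl⟩ := QuotientGroup.mk_surjective a
    have hy' : y ∈ U := hy
    rw [hg y hy' k, hf _ (by rwa [h.proj_symm hy']), h.proj_symm hy', h.apply_symm hy']

theorem OrbitSpace.isPrincipalBundle [N.Normal] (hπ : IsPrincipalBundle E_B E_P E_M P π)
    (hP : HasSmoothSections E_P F (QuotientGroup.mk : P → P ⧸ N))
    (hB : HasSmoothSections E_B F' (mk N : B → OrbitSpace N B)) :
    IsPrincipalBundle F' F E_M (P ⧸ N) (proj hπ : OrbitSpace N B → M) where
  smooth_proj := contMDiff_proj hπ hB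
  smooth_act := by
    rintro ⟨w, a⟩
    obtain ⟨u, rfl⟩ := mk_surjective w
    obtain ⟨g, rfl⟩ := QuotientGroup.mk_surjective a
    exact hB.contMDiffAt_of_comp_prod hP (g := fun q => op q.2 • q.1)
      ((hB.smooth.comp hπ.smooth_act) (u, g))
  proj_act := by
    intro w a
    obtain ⟨u, rfl⟩ := mk_surjective w
    obtain ⟨g, rfl⟩ := QuotientGroup.mk_surjective a
    exact hπ.proj_act u g
  locallyTrivial := by
    intro x
    obtain ⟨U, χ, hx, h⟩ := hπ.exists_chart x
    obtain ⟨χ₀, hs, ht, h1, h2, h3⟩ := h.exists_quotient_chart hπ hP hB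
    refine ⟨U, χ₀, h.isOpen, hx, hs, ht, h1, h2, ?_⟩
    rw [hs]
    intro w hw
    obtain ⟨u, rfl⟩ := mk_surjective w
    have hu : π u ∈ U := hw
    refine ⟨by rw [h3 u hu]; rfl, fun a => ?_⟩
    obtain ⟨g, rfl⟩ := QuotientGroup.mk_surjective a
    rw [op_mk_smul_mk, h3 _ (by rwa [hπ.proj_act]), h3 u hu, hπ.proj_act, h.snd_smul hu]
    rfl

end QuotientBundle

end FilteredGeometry

namespace FilteredGeometry

/-! ### Lie brackets of related vector fields -/

section Brackets

open VectorField Set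

variable {E : Type*} [NormedAddCommGroup E] [NormedSpace ℝ E]
  {N : Type*} [TopologicalSpace N] [ChartedSpace E N]
  {F : Type*} [NormedAddCommGroup F] [NormedSpace ℝ F]

/-- A vector field read in the preferred chart at `x`. -/
noncomputable def fieldInChart (x : N) (V : ∀ y : N, TangentSpace 𝓘(ℝ, E) y) : E → E :=
  mpullbackWithin 𝓘(ℝ, E) 𝓘(ℝ, E) (extChartAt 𝓘(ℝ, E) x).symm V (range 𝓘(ℝ, E))

theorem md_eq_fderiv_chart {f : N → F} {x : N} (hf : MDifferentiableAt 𝓘(ℝ, E) 𝓘(ℝ, F) f x) :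
    md E F f x =
      fderiv ℝ (fun z => f ((extChartAt 𝓘(ℝ, E) x).symm z)) (extChartAt 𝓘(ℝ, E) x x) := by
  have h : md E F f x = fderivWithin ℝ (writtenInExtChartAt 𝓘(ℝ, E) 𝓘(ℝ, F) x f)
      (range 𝓘(ℝ, E)) ((extChartAt 𝓘(ℝ, E) x) x) := by
    unfold md mfderiv
    exact if_pos hf
  rw [h, ModelWithCorners.range_eq_univ, fderivWithin_univ]
  rfl

variable [IsManifold 𝓘(ℝ, E) ∞ N]

/-- The preferred chart at `x` has identity derivative at `x`, so no change of coordinates remains.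
-/
theorem mlieBracket_eq_fieldInChart (x : N) (V W : ∀ y : N, TangentSpace 𝓘(ℝ, E) y) :
    (mlieBracket 𝓘(ℝ, E) V W x : E) =
      lieBracket ℝ (fieldInChart x V) (fieldInChart x W) (extChartAt 𝓘(ℝ, E) x x) := by
  have h := mlieBracketWithin_apply (I := 𝓘(ℝ, E)) (V := V) (W := W) (s := univ) (x₀ := x)
  rw [mlieBracketWithin_univ] at h
  have hid : md E E (extChartAt 𝓘(ℝ, E) x) x = ContinuousLinearMap.id ℝ E :=
    mfderiv_extChartAt_self
  have h1 : ∀ v : E, (md E E (extChartAt 𝓘(ℝ, E) x) x).inverse v = v := fun v => by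
    rw [hid, ContinuousLinearMap.inverse_id, ContinuousLinearMap.id_apply]
  refine (h.trans (h1 _)).trans ?_
  have h2 : range 𝓘(ℝ, E) = univ := ModelWithCorners.range_eq_univ _
  have h3 : lieBracketWithin ℝ (fieldInChart x V) (fieldInChart x W)
      ((extChartAt 𝓘(ℝ, E) x).symm ⁻¹' univ ∩ range 𝓘(ℝ, E)) (extChartAt 𝓘(ℝ, E) x x) =
      lieBracket ℝ (fieldInChart x V) (fieldInChart x W) (extChartAt 𝓘(ℝ, E) x x) := by
    rw [preimage_univ, univ_inter, h2, lieBracketWithin_univ]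
  exact h3

theorem fieldInChart_self (x : N) (V : ∀ y : N, TangentSpace 𝓘(ℝ, E) y) :
    fieldInChart x V (extChartAt 𝓘(ℝ, E) x x) = V x := by
  have h : (V ((extChartAt 𝓘(ℝ, E) x).symm (extChartAt 𝓘(ℝ, E) x x)) : E) = V x := by
    rw [extChartAt_to_inv]
  have h2 : fieldInChart x V (extChartAt 𝓘(ℝ, E) x x) = (mfderivWithin 𝓘(ℝ, E) 𝓘(ℝ, E)
      (extChartAt 𝓘(ℝ, E) x).symm (range 𝓘(ℝ, E)) (extChartAt 𝓘(ℝ, E) x x)).inverse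
      (V ((extChartAt 𝓘(ℝ, E) x).symm (extChartAt 𝓘(ℝ, E) x x))) := rfl
  refine h2.trans (Eq.trans ?_ h)
  exact mfderivWithin_extChartAt_symm_inverse_apply _

/-- In the chain rule the derivative of the inverse chart cancels the inverse derivative in the
pullback of the field. -/
theorem fderiv_fieldInChart {f : N → F} {x : N} {z : E} (hz : z ∈ (extChartAt 𝓘(ℝ, E) x).target)
    (hf : MDifferentiableAt 𝓘(ℝ, E) 𝓘(ℝ, F) f ((extChartAt 𝓘(ℝ, E) x).symm z))
    (V : ∀ y : N, TangentSpace 𝓘(ℝ, E) y) :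
    fderiv ℝ (fun z => f ((extChartAt 𝓘(ℝ, E) x).symm z)) z (fieldInChart x V z) =
      md E F f ((extChartAt 𝓘(ℝ, E) x).symm z) (V ((extChartAt 𝓘(ℝ, E) x).symm z)) := by
  have hs := mdifferentiableWithinAt_extChartAt_symm hz
  have hi := isInvertible_mfderivWithin_extChartAt_symm hz
  have h1 := hi.self_apply_inverse (V ((extChartAt 𝓘(ℝ, E) x).symm z))
  rw [ModelWithCorners.range_eq_univ] at hs
  rw [mdifferentiableWithinAt_univ] at hs
  have h2 : fderiv ℝ (fun z => f ((extChartAt 𝓘(ℝ, E) x).symm z)) z = (md E F f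
      ((extChartAt 𝓘(ℝ, E) x).symm z)).comp (md E E (extChartAt 𝓘(ℝ, E) x).symm z) := by
    rw [← md_eq_fderiv]
    exact md_comp hf hs
  rw [h2]
  refine congrArg (md E F f ((extChartAt 𝓘(ℝ, E) x).symm z)) (Eq.trans ?_ h1)
  unfold fieldInChart md
  rw [← mfderivWithin_univ, ModelWithCorners.range_eq_univ]
  rfl

theorem SmoothFieldOn.differentiableAt_fieldInChart [CompleteSpace E]
    {V : ∀ y : N, TangentSpace 𝓘(ℝ, E) y} {U : Set N} (hV : SmoothFieldOn E V U) {x : N}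
    (hx : U ∈ 𝓝 x) : DifferentiableAt ℝ (fieldInChart x V) (extChartAt 𝓘(ℝ, E) x x) := by
  have h1 : MDifferentiableAt 𝓘(ℝ, E) 𝓘(ℝ, E).tangent
      (fun y => (⟨y, V y⟩ : TangentBundle 𝓘(ℝ, E) N)) x :=
    (hV.contMDiffAt hx).mdifferentiableAt (by simp)
  have h2 := (mdifferentiableWithinAt_univ.2
    h1).differentiableWithinAt_mpullbackWithin_vectorField
  have h3 : range 𝓘(ℝ, E) = univ := ModelWithCorners.range_eq_univ _
  have h4 : DifferentiableWithinAt ℝ (fieldInChart x V)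
      ((extChartAt 𝓘(ℝ, E) x).symm ⁻¹' univ ∩ range 𝓘(ℝ, E)) (extChartAt 𝓘(ℝ, E) x x) := h2
  rwa [preimage_univ, univ_inter, h3, differentiableWithinAt_univ] at h4

theorem contDiffAt_comp_chart_symm {f : N → F} {x : N}
    (hf : ContMDiffAt 𝓘(ℝ, E) 𝓘(ℝ, F) ∞ f x) :
    ContDiffAt ℝ ∞ (fun z => f ((extChartAt 𝓘(ℝ, E) x).symm z)) (extChartAt 𝓘(ℝ, E) x x) := by
  have h1 := contMDiffWithinAt_extChartAt_symm_range (I := 𝓘(ℝ, E)) (n := ∞) x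
    (mem_extChartAt_target x)
  rw [ModelWithCorners.range_eq_univ] at h1
  have h2 : ContMDiffAt 𝓘(ℝ, E) 𝓘(ℝ, E) ∞ (extChartAt 𝓘(ℝ, E) x).symm
    (extChartAt 𝓘(ℝ, E) x x) := h1
  refine contMDiffAt_iff_contDiffAt.1 (ContMDiffAt.comp _ ?_ h2)
  rwa [extChartAt_to_inv]

theorem mdifferentiableAt_of_comp_chart_symm {f : N → F} {x : N}
    (hf : DifferentiableAt ℝ (fun z => f ((extChartAt 𝓘(ℝ, E) x).symm z))
      (extChartAt 𝓘(ℝ, E) x x)) : MDifferentiableAt 𝓘(ℝ, E) 𝓘(ℝ, F) f x := by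
  have h1 : MDifferentiableAt 𝓘(ℝ, E) 𝓘(ℝ, E) (extChartAt 𝓘(ℝ, E) x) x :=
    mdifferentiableAt_extChartAt (mem_chart_source E x)
  refine (MDifferentiableAt.comp x hf.mdifferentiableAt h1).congr_of_eventuallyEq ?_
  filter_upwards [extChartAt_source_mem_nhds (I := 𝓘(ℝ, E)) x] with y hy
  exact congrArg f ((extChartAt 𝓘(ℝ, E) x).left_inv hy).symm

/-- The derivative of a smooth map along a smooth vector field is differentiable; and the
derivative along a Lie bracket is the commutator of derivatives. -/
theorem mdifferentiableAt_md_field [CompleteSpace E] {f : N → F} {U : Set N} (hU : IsOpen U)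
    (hf : ContMDiffOn 𝓘(ℝ, E) 𝓘(ℝ, F) ∞ f U) {V : ∀ y : N, TangentSpace 𝓘(ℝ, E) y}
    (hV : SmoothFieldOn E V U) {x : N} (hx : x ∈ U) :
    MDifferentiableAt 𝓘(ℝ, E) 𝓘(ℝ, F) (fun y => md E F f y (V y)) x ∧
    (fun z => fderiv ℝ (fun z => f ((extChartAt 𝓘(ℝ, E) x).symm z)) z (fieldInChart x V z))
      =ᶠ[𝓝 (extChartAt 𝓘(ℝ, E) x x)] fun z =>
        md E F f ((extChartAt 𝓘(ℝ, E) x).symm z) (V ((extChartAt 𝓘(ℝ, E) x).symm z)) := by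
  have hf' := contDiffAt_comp_chart_symm (hf.contMDiffAt (hU.mem_nhds hx))
  have hcs : ContinuousAt (extChartAt 𝓘(ℝ, E) x).symm (extChartAt 𝓘(ℝ, E) x x) :=
    continuousAt_extChartAt_symm x
  have h1 : (fun z => fderiv ℝ (fun z => f ((extChartAt 𝓘(ℝ, E) x).symm z)) z
      (fieldInChart x V z)) =ᶠ[𝓝 (extChartAt 𝓘(ℝ, E) x x)] fun z =>
        md E F f ((extChartAt 𝓘(ℝ, E) x).symm z) (V ((extChartAt 𝓘(ℝ, E) x).symm z)) := by
    have hU' : U ∈ 𝓝 ((extChartAt 𝓘(ℝ, E) x).symm (extChartAt 𝓘(ℝ, E) x x)) := by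
      rw [extChartAt_to_inv]
      exact hU.mem_nhds hx
    filter_upwards [extChartAt_target_mem_nhds (I := 𝓘(ℝ, E)) x, hcs hU'] with z hz hzU
    exact fderiv_fieldInChart hz ((hf.contMDiffAt (hU.mem_nhds hzU)).mdifferentiableAt (by simp)) V
  refine ⟨mdifferentiableAt_of_comp_chart_symm ?_, h1⟩
  refine DifferentiableAt.congr_of_eventuallyEq ?_ h1.symm
  exact ((hf'.fderiv_right (m := 1) (by norm_cast)).differentiableAt (by simp)).clm_apply
    (hV.differentiableAt_fieldInChart (hU.mem_nhds hx))

/-- In the chart at `x` this is the symmetry of the second derivative of `f`. Vector values are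
allowed so that a chart can be taken for `f`. -/
theorem md_mlieBracket [CompleteSpace E] {f : N → F} {U : Set N} (hU : IsOpen U)
    (hf : ContMDiffOn 𝓘(ℝ, E) 𝓘(ℝ, F) ∞ f U) {V W : ∀ y : N, TangentSpace 𝓘(ℝ, E) y}
    (hV : SmoothFieldOn E V U) (hW : SmoothFieldOn E W U) {x : N} (hx : x ∈ U) :
    md E F f x (mlieBracket 𝓘(ℝ, E) V W x) =
      md E F (fun y => md E F f y (W y)) x (V x) - md E F (fun y => md E F f y (V y)) x (W x) := by
  obtain ⟨hdV, heV⟩ := mdifferentiableAt_md_field hU hf hV hx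
  obtain ⟨hdW, heW⟩ := mdifferentiableAt_md_field hU hf hW hx
  have hfx := hf.contMDiffAt (hU.mem_nhds hx)
  have h := fderiv_apply_lieBracket (contDiffAt_comp_chart_symm hfx) (by simp; norm_cast)
    (hW.differentiableAt_fieldInChart (hU.mem_nhds hx))
    (hV.differentiableAt_fieldInChart (hU.mem_nhds hx))
  rw [heV.fderiv_eq, heW.fderiv_eq, fieldInChart_self, fieldInChart_self] at h
  rw [md_eq_fderiv_chart hdV, md_eq_fderiv_chart hdW,
    md_eq_fderiv_chart (hfx.mdifferentiableAt (by simp)), ← h]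
  exact congrArg _ (mlieBracket_eq_fieldInChart x V W)

/-- Related vector fields have related Lie brackets. -/
theorem md_mlieBracket_of_related [CompleteSpace E]
    {E' : Type*} [NormedAddCommGroup E'] [NormedSpace ℝ E'] [CompleteSpace E']
    {N' : Type*} [TopologicalSpace N'] [ChartedSpace E' N'] [IsManifold 𝓘(ℝ, E') ∞ N']
    {p : N → N'} (hp : ContMDiff 𝓘(ℝ, E) 𝓘(ℝ, E') ∞ p) {U : Set N} {U' : Set N'} (hU : IsOpen U)
    (hU' : IsOpen U') (hUU' : ∀ x ∈ U, p x ∈ U')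
    {V W : ∀ y : N, TangentSpace 𝓘(ℝ, E) y} {V' W' : ∀ y : N', TangentSpace 𝓘(ℝ, E') y}
    (hV : SmoothFieldOn E V U) (hW : SmoothFieldOn E W U) (hV' : SmoothFieldOn E' V' U')
    (hW' : SmoothFieldOn E' W' U') (hVV' : ∀ x ∈ U, md E E' p x (V x) = V' (p x))
    (hWW' : ∀ x ∈ U, md E E' p x (W x) = W' (p x)) {x : N} (hx : x ∈ U) :
    md E E' p x (mlieBracket 𝓘(ℝ, E) V W x) = mlieBracket 𝓘(ℝ, E') V' W' (p x) := by
  -- The commutator formula is applied to `φ` downstairs and to `φ ∘ p` upstairs. As `φ` has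
  -- identity derivative at `p x`, it loses no information about tangent vectors there.
  set φ := extChartAt 𝓘(ℝ, E') (p x)
  have hφ : ContMDiffOn 𝓘(ℝ, E') 𝓘(ℝ, E') ∞ φ (U' ∩ (chartAt E' (p x)).source) :=
    contMDiffOn_extChartAt.mono inter_subset_right
  have hU1 : IsOpen (U' ∩ (chartAt E' (p x)).source) := hU'.inter (chartAt E' (p x)).open_source
  have hx1 : p x ∈ U' ∩ (chartAt E' (p x)).source := ⟨hUU' x hx, mem_chart_source _ _⟩
  set O := U ∩ p ⁻¹' (U' ∩ (chartAt E' (p x)).source)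
  have hO : IsOpen O := hU.inter (hU1.preimage hp.continuous)
  have hxO : x ∈ O := ⟨hx, hx1⟩
  have hφp : ContMDiffOn 𝓘(ℝ, E) 𝓘(ℝ, E') ∞ (fun y => φ (p y)) O :=
    hφ.comp hp.contMDiffOn fun y hy => hy.2
  have hφd : ∀ y ∈ O, MDifferentiableAt 𝓘(ℝ, E') 𝓘(ℝ, E') φ (p y) := fun y hy =>
    (hφ.contMDiffAt (hU1.mem_nhds hy.2)).mdifferentiableAt (by simp)
  have hpd : ∀ y, MDifferentiableAt 𝓘(ℝ, E) 𝓘(ℝ, E') p y := fun y =>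
    (hp y).mdifferentiableAt (by simp)
  have hid : md E' E' φ (p x) = ContinuousLinearMap.id ℝ E' := mfderiv_extChartAt_self
  -- Relatedness says that the derivative of `φ ∘ p` along `V` is the derivative of `φ` along `V'`,
  -- composed with `p`; this is then differentiated once more.
  have key : ∀ (V : ∀ y : N, TangentSpace 𝓘(ℝ, E) y) (V' : ∀ y : N', TangentSpace 𝓘(ℝ, E') y),
      SmoothFieldOn E' V' U' → (∀ x ∈ U, md E E' p x (V x) = V' (p x)) →
      md E E' (fun y => md E E' (fun y => φ (p y)) y (V y)) x =
        (md E' E' (fun y => md E' E' φ y (V' y)) (p x)).comp (md E E' p x) := by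
    intro V V' hV' hVV'
    rw [← md_comp (mdifferentiableAt_md_field hU1 hφ (hV'.mono inter_subset_left) hx1).1 (hpd x)]
    refine md_congr ?_
    filter_upwards [hO.mem_nhds hxO] with y hy
    rw [md_comp (hφd y hy) (hpd y), ← hVV' y hy.1]
    rfl
  have h1 := md_mlieBracket hO hφp (hV.mono inter_subset_left) (hW.mono inter_subset_left) hxO
  have h2 := md_mlieBracket hU1 hφ (hV'.mono inter_subset_left) (hW'.mono inter_subset_left) hx1
  rw [key V V' hV' hVV', key W W' hW' hWW', md_comp (hφd x hxO) (hpd x), hid] at h1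
  rw [hid] at h2
  have h3 : md E E' p x (V x) = V' (p x) := hVV' x hx
  have h4 : md E E' p x (W x) = W' (p x) := hWW' x hx
  refine Eq.trans (h1.trans ?_) h2.symm
  rw [← h3, ← h4]
  rfl

end Brackets

end FilteredGeometry

namespace FilteredGeometry

/-! ### Tangent spaces of principal bundles -/

section Families

variable {E : Type*} [NormedAddCommGroup E] [NormedSpace ℝ E]
  {N : Type*} [TopologicalSpace N] [ChartedSpace E N]
  {E' : Type*} [NormedAddCommGroup E'] [NormedSpace ℝ E']
  {N' : Type*} [TopologicalSpace N'] [ChartedSpace E' N']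
  {E₁ : Type*} [NormedAddCommGroup E₁] [NormedSpace ℝ E₁]
  {N₁ : Type*} [TopologicalSpace N₁] [ChartedSpace E₁ N₁]
  {E₂ : Type*} [NormedAddCommGroup E₂] [NormedSpace ℝ E₂]
  {N₂ : Type*} [TopologicalSpace N₂] [ChartedSpace E₂ N₂]

/-- The derivatives of a smooth family of maps, applied to a smooth family of tangent vectors,
form a smooth family of tangent vectors. -/
theorem contMDiffAt_md_family [IsManifold 𝓘(ℝ, E) ∞ N] [IsManifold 𝓘(ℝ, E') ∞ N']
    [IsManifold 𝓘(ℝ, E₁) ∞ N₁]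
    {f : N → N₁ → N'} {g : N → N₁}
    {v : ∀ x : N, TangentSpace 𝓘(ℝ, E₁) (g x)} {x₀ : N}
    (hf : ContMDiffAt (𝓘(ℝ, E).prod 𝓘(ℝ, E₁)) 𝓘(ℝ, E') ∞ (Function.uncurry f) (x₀, g x₀))
    (hg : ContMDiffAt 𝓘(ℝ, E) 𝓘(ℝ, E₁) ∞ g x₀)
    (hv : ContMDiffAt 𝓘(ℝ, E) 𝓘(ℝ, E₁).tangent ∞
      (fun x => (⟨g x, v x⟩ : TangentBundle 𝓘(ℝ, E₁) N₁)) x₀) :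
    ContMDiffAt 𝓘(ℝ, E) 𝓘(ℝ, E').tangent ∞
      (fun x => (⟨f x (g x), mfderiv 𝓘(ℝ, E₁) 𝓘(ℝ, E') (f x) (g x) (v x)⟩ :
        TangentBundle 𝓘(ℝ, E') N')) x₀ := by
  have : IsManifold 𝓘(ℝ, E) 1 N := IsManifold.of_le (n := ∞) (by simp)
  have : IsManifold 𝓘(ℝ, E') 1 N' := IsManifold.of_le (n := ∞) (by simp)
  have : IsManifold 𝓘(ℝ, E₁) 1 N₁ := IsManifold.of_le (n := ∞) (by simp)
  have h1 := hf.mfderiv f g hg (m := ∞) (by simp)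
  exact ContMDiffAt.clm_apply_of_inCoordinates h1 hv
    (ContMDiffAt.comp x₀ hf (contMDiffAt_id.prodMk hg))

/-- The derivative of a map of two variables along a pair of maps. -/
theorem md_comp_prodMk {f : N₁ × N₂ → N'} {a : N → N₁} {b : N → N₂} {x : N}
    (hf : MDifferentiableAt (𝓘(ℝ, E₁).prod 𝓘(ℝ, E₂)) 𝓘(ℝ, E') f (a x, b x))
    (ha : MDifferentiableAt 𝓘(ℝ, E) 𝓘(ℝ, E₁) a x) (hb : MDifferentiableAt 𝓘(ℝ, E) 𝓘(ℝ, E₂) b x)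
    (v : E) :
    md E E' (fun y => f (a y, b y)) x v =
      md E₁ E' (fun z => f (z, b x)) (a x) (md E E₁ a x v) +
        md E₂ E' (fun z => f (a x, z)) (b x) (md E E₂ b x v) := by
  have h1 := mfderiv_comp x hf (ha.prodMk hb)
  have h2 := mfderiv_prodMk ha hb
  have h3 := mfderiv_prod_eq_add_apply hf
    (v := mfderiv 𝓘(ℝ, E) (𝓘(ℝ, E₁).prod 𝓘(ℝ, E₂)) (fun y => (a y, b y)) x v)
  refine (congrArg (fun A : E →L[ℝ] E' => A v) h1).trans (h3.trans ?_)
  have h4 : mfderiv 𝓘(ℝ, E) (𝓘(ℝ, E₁).prod 𝓘(ℝ, E₂)) (fun y => (a y, b y)) x v =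
      (md E E₁ a x v, md E E₂ b x v) :=
    congrArg (fun A : E →L[ℝ] E₁ × E₂ => A v) h2
  exact congrArg (fun p : E₁ × E₂ => md E₁ E' (fun z => f (z, b x)) (a x) p.1 +
        md E₂ E' (fun z => f (a x, z)) (b x) p.2) h4

end Families

/-! ### Vertical vectors and flat lifts in a principal bundle. -/

section PrincipalTangent

open MulOpposite Set

variable {E_B E_K E_M : Type*} [NormedAddCommGroup E_B] [NormedSpace ℝ E_B]
  [NormedAddCommGroup E_K] [NormedSpace ℝ E_K] [NormedAddCommGroup E_M] [NormedSpace ℝ E_M]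
  {K : Type*} [Group K] [TopologicalSpace K] [ChartedSpace E_K K]
  {B : Type*} [TopologicalSpace B] [ChartedSpace E_B B] [MulAction Kᵐᵒᵖ B]
  {M : Type*} [TopologicalSpace M] [ChartedSpace E_M M]
  {π : B → M} {U : Set M} {χ : OpenPartialHomeomorph B (M × K)}

theorem IsPrincipalBundle.mdifferentiableAt_proj (hp : IsPrincipalBundle E_B E_K E_M K π) (u : B) :
    MDifferentiableAt 𝓘(ℝ, E_B) 𝓘(ℝ, E_M) π u :=
  (hp.smooth_proj u).mdifferentiableAt (by simp)

theorem IsPrincipalBundle.md_proj_smul (hp : IsPrincipalBundle E_B E_K E_M K π) (g : K) (u : B)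
    (v : E_B) :
    md E_B E_M π (op g • u) (md E_B E_B (fun w : B => op g • w) u v) = md E_B E_M π u v := by
  have h := md_comp (hp.mdifferentiableAt_proj (op g • u))
    ((hp.smooth_smul g u).mdifferentiableAt (by simp))
  simp only [hp.proj_act] at h
  exact (congrArg (fun A : E_B →L[ℝ] E_M => A v) h).symm

theorem IsPrincipalBundle.md_proj_orbit (hp : IsPrincipalBundle E_B E_K E_M K π) (u : B) (v : E_K) :
    md E_B E_M π (op (1 : K) • u) (md E_K E_B (fun g : K => op g • u) 1 v) = 0 := by
  have h := md_comp (f := fun g : K => op g • u) (hp.mdifferentiableAt_proj (op (1 : K) • u))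
    ((hp.smooth_orbit u 1).mdifferentiableAt (by simp))
  simp only [hp.proj_act] at h
  rw [md_const] at h
  exact (congrArg (fun A : E_K →L[ℝ] E_M => A v) h).symm

theorem IsPrincipalBundle.surjective (hp : IsPrincipalBundle E_B E_K E_M K π) :
    Function.Surjective π := by
  intro x
  obtain ⟨U, χ, hx, h⟩ := hp.exists_chart x
  exact ⟨χ.symm (x, 1), h.proj_symm hx 1⟩

namespace IsBundleChart

theorem md_proj_section (h : IsBundleChart E_B E_K E_M π U χ)
    (hp : IsPrincipalBundle E_B E_K E_M K π) {y : M} (hy : y ∈ U) (k : K) (v : E_M) :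
    md E_B E_M π (χ.symm (y, k)) (md E_M E_B (fun y => χ.symm (y, k)) y v) = v := by
  have h1 := md_comp (f := fun y => χ.symm (y, k)) (hp.mdifferentiableAt_proj (χ.symm (y, k)))
    ((h.contMDiffAt_section hy k).mdifferentiableAt (by simp))
  have h2 : md E_M E_M (fun y => π (χ.symm (y, k))) y = ContinuousLinearMap.id ℝ E_M := by
    rw [← md_id y]
    refine md_congr ?_
    filter_upwards [h.isOpen.mem_nhds hy] with z hz using h.proj_symm hz k
  rw [h2] at h1
  exact (congrArg (fun A : E_M →L[ℝ] E_M => A v) h1).symm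

/-- A vertical tangent vector is the value of a fundamental field. -/
theorem exists_fundamental [LieGroup 𝓘(ℝ, E_K) ∞ K] (h : IsBundleChart E_B E_K E_M π U χ)
    (hp : IsPrincipalBundle E_B E_K E_M K π) {u : B} (hu : π u ∈ U) {v : E_B}
    (hv : md E_B E_M π u v = 0) :
    ∃ X : E_K, md E_K E_B (fun g : K => op g • u) 1 X = v := by
  set k := (χ u).2
  have hs : χ.symm (π u, k) = u := h.symm_apply hu
  -- Each `w` over `U` is the point of the section of constant group part `k` over `π w`, moved by
  -- `k⁻¹ * (χ w).2`, which is `1` at `u`. This expression of the identity map is differentiated in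
  -- the direction `v`.
  have h1 : ∀ w, π w ∈ U → op (k⁻¹ * (χ w).2) • χ.symm (π w, k) = w := fun w hw => by
    rw [h.smul_symm hp hw, mul_inv_cancel_left, h.symm_apply hw]
  have hσ : MDifferentiableAt 𝓘(ℝ, E_M) 𝓘(ℝ, E_B) (fun y => χ.symm (y, k)) (π u) :=
    (h.contMDiffAt_section hu k).mdifferentiableAt (by simp)
  have ha : MDifferentiableAt 𝓘(ℝ, E_B) 𝓘(ℝ, E_B) (fun w => χ.symm (π w, k)) u :=
    MDifferentiableAt.comp (g := fun y => χ.symm (y, k)) (f := π) u hσ (hp.mdifferentiableAt_proj u)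
  have hb : MDifferentiableAt 𝓘(ℝ, E_B) 𝓘(ℝ, E_K) (fun w => k⁻¹ * (χ w).2) u :=
    (contMDiffAt_const.mul (h.contMDiffAt_snd hu)).mdifferentiableAt (by simp)
  have h2 := md_comp_prodMk (f := fun q : B × K => op q.2 • q.1)
    ((hp.smooth_act _).mdifferentiableAt (by simp)) ha hb v
  have h3 : md E_B E_B (fun w => op (k⁻¹ * (χ w).2) • χ.symm (π w, k)) u =
      ContinuousLinearMap.id ℝ E_B := by
    rw [← md_id u]
    refine md_congr ?_
    filter_upwards [(h.isOpen.preimage hp.smooth_proj.continuous).mem_nhds hu] with w hw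
    exact h1 w hw
  -- The section factor depends on `w` through `π w` only, so a vertical vector does not move it;
  -- what remains is the derivative of the orbit map.
  have h4 : md E_B E_B (fun w => χ.symm (π w, k)) u v = 0 := by
    rw [md_comp (f := π) hσ (hp.mdifferentiableAt_proj u), ContinuousLinearMap.comp_apply, hv,
      map_zero]
  rw [h3, h4, map_zero, zero_add] at h2
  have h5 : k⁻¹ * (χ u).2 = 1 := inv_mul_cancel k
  simp only [hs, h5] at h2
  exact ⟨_, h2.symm⟩

/-- The horizontal lift, for the flat connection of a local trivialization, of a vector field. -/
noncomputable def lift (π : B → M) (χ : OpenPartialHomeomorph B (M × K))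
    (ξ : ∀ x : M, TangentSpace 𝓘(ℝ, E_M) x) (w : B) : TangentSpace 𝓘(ℝ, E_B) w :=
  md E_M E_B (fun y => χ.symm (y, (χ w).2)) (π w) (ξ (π w))

theorem md_proj_lift (h : IsBundleChart E_B E_K E_M π U χ)
    (hp : IsPrincipalBundle E_B E_K E_M K π) {ξ : ∀ x : M, TangentSpace 𝓘(ℝ, E_M) x} {w : B}
    (hw : π w ∈ U) : md E_B E_M π w (lift (E_B := E_B) π χ ξ w) = ξ (π w) := by
  have h1 := h.md_proj_section hp hw (χ w).2 (ξ (π w))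
  rwa [h.symm_apply hw] at h1

theorem smoothFieldOn_lift [IsManifold 𝓘(ℝ, E_M) ∞ M] [IsManifold 𝓘(ℝ, E_B) ∞ B]
    (h : IsBundleChart E_B E_K E_M π U χ)
    (hp : IsPrincipalBundle E_B E_K E_M K π) {ξ : ∀ x : M, TangentSpace 𝓘(ℝ, E_M) x} {V : Set M}
    (hV : IsOpen V) (hξ : SmoothFieldOn E_M ξ V) :
    SmoothFieldOn E_B (lift (E_B := E_B) π χ ξ) (π ⁻¹' (U ∩ V)) := by
  intro w₀ hw₀
  refine ContMDiffAt.contMDiffWithinAt ?_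
  have hξ' : ContMDiffAt 𝓘(ℝ, E_B) 𝓘(ℝ, E_M).tangent ∞
      (fun w => (⟨π w, ξ (π w)⟩ : TangentBundle 𝓘(ℝ, E_M) M)) w₀ :=
    ContMDiffAt.comp w₀ (hξ.contMDiffAt (hV.mem_nhds hw₀.2)) (hp.smooth_proj w₀)
  have hf : ContMDiffAt (𝓘(ℝ, E_B).prod 𝓘(ℝ, E_M)) 𝓘(ℝ, E_B) ∞
      (Function.uncurry fun (w : B) (y : M) => χ.symm (y, (χ w).2)) (w₀, π w₀) := by
    refine ContMDiffAt.comp (g := χ.symm) (f := fun p : B × M => (p.2, (χ p.1).2)) _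
      (h.contMDiffAt_symm hw₀.1 _) (_root_.contMDiffAt_snd.prodMk ?_)
    exact ContMDiffAt.comp (g := fun w => (χ w).2) (f := Prod.fst) _ (h.contMDiffAt_snd hw₀.1)
      contMDiffAt_fst
  refine (contMDiffAt_md_family hf (hp.smooth_proj w₀) hξ').congr_of_eventuallyEq ?_
  -- The family is based at `χ.symm (π w, (χ w).2)`, which is `w` only over `U`.
  filter_upwards [(h.isOpen.preimage hp.smooth_proj.continuous).mem_nhds hw₀.1] with w hw
  have hs : χ.symm (π w, (χ w).2) = w := h.symm_apply hw
  exact congrArg (fun b : B => (⟨b, md E_M E_B (fun y => χ.symm (y, (χ w).2)) (π w) (ξ (π w))⟩ :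
    TangentBundle 𝓘(ℝ, E_B) B)) hs.symm

end IsBundleChart

theorem IsPrincipalBundle.exists_smul_eq (hp : IsPrincipalBundle E_B E_K E_M K π)
    {u u' : B} (h : π u = π u') : ∃ g : K, op g • u = u' := by
  obtain ⟨U, χ, hx, hχ⟩ := hp.exists_chart (π u)
  refine ⟨(χ u).2⁻¹ * (χ u').2, ?_⟩
  have h1 := hχ.smul_symm hp hx (χ u).2 ((χ u).2⁻¹ * (χ u').2)
  rw [hχ.symm_apply hx, mul_inv_cancel_left, h, hχ.symm_apply (h ▸ hx)] at h1
  exact h1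

end PrincipalTangent

end FilteredGeometry

namespace FilteredGeometry

/-! ### Smoothness of the inverse of a coframe -/

section Parallel

open Set

variable {E : Type*} [NormedAddCommGroup E] [NormedSpace ℝ E]
  {N : Type*} [TopologicalSpace N] [ChartedSpace E N]

theorem contMDiffAt_clm_of_apply {E' F : Type*} [NormedAddCommGroup E'] [NormedSpace ℝ E']
    [FiniteDimensional ℝ E'] [NormedAddCommGroup F] [NormedSpace ℝ F]
    {f : N → E' →L[ℝ] F} {x : N}
    (hf : ∀ v, ContMDiffAt 𝓘(ℝ, E) 𝓘(ℝ, F) ∞ (fun y => f y v) x) :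
    ContMDiffAt 𝓘(ℝ, E) 𝓘(ℝ, E' →L[ℝ] F) ∞ f x := by
  set b := Module.finBasis ℝ E'
  have h : f = fun y => ∑ k, ContinuousLinearMap.smulRightL ℝ E' F
      (LinearMap.toContinuousLinearMap (b.coord k)) (f y (b k)) := by
    funext y
    ext v
    conv_lhs => rw [← b.sum_repr v, map_sum]
    simp
  rw [h]
  exact contMDiffAt_finsetSum fun k _ =>
    ((ContinuousLinearMap.smulRightL ℝ E' F _).contMDiff.contMDiffAt).comp x (hf (b k))

/-- If a coframe takes smooth fields to smooth functions, its dual frame is smooth. -/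
theorem smoothFieldOn_symm [FiniteDimensional ℝ E] [IsManifold 𝓘(ℝ, E) ∞ N] {W : Type*}
    [AddCommGroup W] [Module ℝ W] [FiniteDimensional ℝ W]
    (Θ : ∀ u : N, TangentSpace 𝓘(ℝ, E) u ≃ₗ[ℝ] W)
    (hΘ : ∀ (U : Set N) (ξ : ∀ u : N, TangentSpace 𝓘(ℝ, E) u), IsOpen U →
      SmoothFieldOn E ξ U → SmoothOn E (fun u => Θ u (ξ u)) U) (X : W) :
    SmoothFieldOn E (fun u => (Θ u).symm X) univ := by
  intro u₀ _
  refine ContMDiffAt.contMDiffWithinAt ?_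
  set e := trivializationAt E (TangentSpace 𝓘(ℝ, E) : N → Type _) u₀
  have hu₀ : u₀ ∈ e.baseSet := FiberBundle.mem_baseSet_trivializationAt' u₀
  set L := (Module.finBasis ℝ W).equivFun
  have hfield : ∀ v : E, SmoothFieldOn E (fun u => e.symm u v) e.baseSet := fun v => by
    refine (e.contMDiffOn_section_baseSet_iff).2 ?_
    refine (contMDiffOn_const (c := v)).congr fun u hu => ?_
    rw [e.apply_mk_symm hu]
  have hA : ∀ v : E, ContMDiffAt 𝓘(ℝ, E) 𝓘(ℝ, Fin (Module.finrank ℝ W) → ℝ) ∞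
      (fun u => L (Θ u (e.symm u v))) u₀ := fun v =>
    (SmoothOn.contMDiffOn L.toLinearMap
      (hΘ e.baseSet _ e.open_baseSet (hfield v))).contMDiffAt (e.open_baseSet.mem_nhds hu₀)
  let Ψ : ∀ u ∈ e.baseSet, E ≃ₗ[ℝ] (Fin (Module.finrank ℝ W) → ℝ) := fun u hu =>
    ((e.linearEquivAt ℝ u hu).symm.trans (Θ u)).trans L
  -- The matrix of the coframe in a trivialization of the tangent bundle. Its columns are the values
  -- of `Θ` on smooth local fields, so it is smooth, and inversion of continuous linear maps is
  -- smooth at an isomorphism.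
  let A : N → E →L[ℝ] (Fin (Module.finrank ℝ W) → ℝ) := fun u =>
    LinearMap.toContinuousLinearMap (L.toLinearMap ∘ₗ (Θ u).toLinearMap ∘ₗ e.symmₗ ℝ u)
  have hAv : ∀ u ∈ e.baseSet, ∀ v, A u v = L (Θ u (e.symm u v)) := fun u hu v => by
    refine (congrFun (LinearMap.coe_toContinuousLinearMap' _) v).trans ?_
    exact congrArg (fun w => L (Θ u w)) (e.symmₗ_apply hu v)
  have hAs : ContMDiffAt 𝓘(ℝ, E) 𝓘(ℝ, E →L[ℝ] (Fin (Module.finrank ℝ W) → ℝ)) ∞ A u₀ :=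
    contMDiffAt_clm_of_apply fun v => by
      refine (hA v).congr_of_eventuallyEq ?_
      filter_upwards [e.open_baseSet.mem_nhds hu₀] with u hu using hAv u hu v
  have hAe : ∀ u (hu : u ∈ e.baseSet), A u = (Ψ u hu).toContinuousLinearEquiv := fun u hu => by
    ext1 v
    exact hAv u hu v
  have hinv : ContMDiffAt 𝓘(ℝ, E) 𝓘(ℝ, (Fin (Module.finrank ℝ W) → ℝ) →L[ℝ] E) ∞
      (fun u => (A u).inverse) u₀ := by
    refine ContMDiffAt.comp u₀ (g := ContinuousLinearMap.inverse) ?_ hAs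
    rw [hAe u₀ hu₀]
    exact (contDiffAt_map_inverse (Ψ u₀ hu₀).toContinuousLinearEquiv).contMDiffAt
  refine (e.contMDiffAt_section_iff hu₀).2 ?_
  refine (hinv.clm_apply (contMDiffAt_const (c := L X))).congr_of_eventuallyEq ?_
  filter_upwards [e.open_baseSet.mem_nhds hu₀] with u hu
  rw [hAe u hu, ContinuousLinearMap.inverse_equiv]
  change (e.linearEquivAt ℝ u hu) ((Θ u).symm X) =
    (e.linearEquivAt ℝ u hu) ((Θ u).symm (L.symm (L X)))
  rw [LinearEquiv.symm_apply_apply]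

end Parallel

/-! ### The filtration of the tangent bundle -/

section Anchor

open MulOpposite Set

variable {𝔤 : Type*} [LieRing 𝔤] [LieAlgebra ℝ 𝔤] [FiniteDimensional ℝ 𝔤]
  {E_P : Type*} [NormedAddCommGroup E_P] [NormedSpace ℝ E_P]
  {P : Type*} [Group P] [TopologicalSpace P] [ChartedSpace E_P P] {μ ν : ℕ}
  {A : AdmissiblePair 𝔤 E_P P μ ν}
  {E_M : Type*} [NormedAddCommGroup E_M] [NormedSpace ℝ E_M]
  {M : Type*} [TopologicalSpace M] [ChartedSpace E_M M]
  {E_B : Type*} [NormedAddCommGroup E_B] [NormedSpace ℝ E_B]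
  {B : Type*} [TopologicalSpace B] [ChartedSpace E_B B] [IsManifold 𝓘(ℝ, E_B) ∞ B]
  [MulAction Pᵐᵒᵖ B]
  {π : B → M} {θ : ∀ u : B, TangentSpace 𝓘(ℝ, E_B) u →ₗ[ℝ] 𝔤}

namespace IsCartanGeometry

/-- The linear isomorphism given by the Cartan connection. -/
noncomputable def coframe (hθ : IsCartanGeometry A (E_M := E_M) π θ) (u : B) :
    TangentSpace 𝓘(ℝ, E_B) u ≃ₗ[ℝ] 𝔤 :=
  LinearEquiv.ofBijective (θ u) (hθ.bijective u)

/-- The vector field on which the Cartan connection is constant with value `X`. -/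
noncomputable def parallel (hθ : IsCartanGeometry A (E_M := E_M) π θ) (X : 𝔤) (u : B) :
    TangentSpace 𝓘(ℝ, E_B) u :=
  (hθ.coframe u).symm X

theorem apply_parallel (hθ : IsCartanGeometry A (E_M := E_M) π θ) (X : 𝔤) (u : B) :
    θ u (hθ.parallel X u) = X :=
  (hθ.coframe u).apply_symm_apply X

theorem parallel_apply (hθ : IsCartanGeometry A (E_M := E_M) π θ) (u : B)
    (v : TangentSpace 𝓘(ℝ, E_B) u) : hθ.parallel (θ u v) u = v :=
  (hθ.coframe u).symm_apply_apply v

theorem smoothFieldOn_parallel [FiniteDimensional ℝ E_B]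
    (hθ : IsCartanGeometry A (E_M := E_M) π θ) (X : 𝔤) :
    SmoothFieldOn E_B (hθ.parallel X) univ :=
  smoothFieldOn_symm hθ.coframe hθ.smooth X

/-- The surjection `𝔤 → T_{π u} M` induced by the Cartan connection. -/
noncomputable def anchor (hθ : IsCartanGeometry A (E_M := E_M) π θ) (u : B) : 𝔤 →ₗ[ℝ] E_M :=
  (md E_B E_M π u).toLinearMap ∘ₗ (hθ.coframe u).symm.toLinearMap

theorem anchor_form (hθ : IsCartanGeometry A (E_M := E_M) π θ) (u : B)
    (v : TangentSpace 𝓘(ℝ, E_B) u) : hθ.anchor u (θ u v) = md E_B E_M π u v :=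
  congrArg (md E_B E_M π u) (hθ.parallel_apply u v)

theorem anchor_surjective (hθ : IsCartanGeometry A (E_M := E_M) π θ) (u : B) :
    Function.Surjective (hθ.anchor u) := by
  intro v
  obtain ⟨U, χ, hx, hχ⟩ := hθ.principal.exists_chart (π u)
  have h := hχ.md_proj_section hθ.principal hx (χ u).2 v
  rw [hχ.symm_apply hx] at h
  exact ⟨θ u (md E_M E_B (fun y => χ.symm (y, (χ u).2)) (π u) v), (hθ.anchor_form u _).trans h⟩

/-- The value of the Cartan connection on the lift of a vector field. -/
theorem anchor_form_lift (hθ : IsCartanGeometry A (E_M := E_M) π θ)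
    {U : Set M} {χ : OpenPartialHomeomorph B (M × P)} (h : IsBundleChart E_B E_P E_M π U χ)
    (ξ : ∀ x : M, TangentSpace 𝓘(ℝ, E_M) x) {w : B}
    (hw : π w ∈ U) : hθ.anchor w (θ w (IsBundleChart.lift π χ ξ w)) = ξ (π w) :=
  (hθ.anchor_form w _).trans (h.md_proj_lift hθ.principal hw)

/-- Right translation by `g` does not change the projection, and by equivariance it turns the value
`Ad g X` of `θ` at `u` into `X` at `u · g`. -/
theorem anchor_smul (hθ : IsCartanGeometry A (E_M := E_M) π θ) (g : P) (u : B) (X : 𝔤) :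
    hθ.anchor (op g • u) X = hθ.anchor u (A.Ad g X) := by
  have h := hθ.equivariant g u (hθ.parallel (A.Ad g X) u)
  rw [hθ.apply_parallel] at h
  have h1 : A.Ad g⁻¹ (A.Ad g X) = X := by
    rw [← LinearEquiv.mul_apply, ← map_mul, inv_mul_cancel, map_one, LinearEquiv.coe_one, id]
  rw [h1] at h
  refine (congrArg (hθ.anchor (op g • u)) h.symm).trans ?_
  exact (hθ.anchor_form _ _).trans (hθ.principal.md_proj_smul g u _)

/-- The kernel of the derivative of `π` consists of the values of fundamental fields, on which `θ`
takes exactly the values in the range of `ι`, that is `𝔤^0`. -/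
theorem anchor_eq_zero_iff [LieGroup 𝓘(ℝ, E_P) ∞ P] (hθ : IsCartanGeometry A (E_M := E_M) π θ)
    (u : B) (X : 𝔤) : hθ.anchor u X = 0 ↔ X ∈ A.S.F 0 := by
  constructor
  · intro h
    obtain ⟨U, χ, hx, hχ⟩ := hθ.principal.exists_chart (π u)
    obtain ⟨Y, hY⟩ := hχ.exists_fundamental hθ.principal hx h
    have h1 := hθ.fundamental Y u
    -- The points `op 1 • u` and `u` are equal but their tangent spaces differ as types; the
    -- statement is generalized to a variable point so that the equality can be substituted.
    have h2 : ∀ u' : B, u' = u → θ u' (hθ.parallel X u : E_B) = X := by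
      rintro _ rfl
      exact hθ.apply_parallel X _
    have h3 : A.ι Y = X := by
      rw [← h1]
      refine Eq.trans ?_ (h2 _ (one_smul Pᵐᵒᵖ u))
      exact congrArg (fun v : E_B => θ (op (1 : P) • u) v) hY
    rw [← h3, ← A.ι_range]
    exact ⟨Y, rfl⟩
  · intro h
    rw [← A.ι_range] at h
    obtain ⟨Y, rfl⟩ := h
    have h2 : ∀ u' : B, u' = u → hθ.anchor u (A.ι Y) = hθ.anchor u' (A.ι Y) := by
      rintro _ rfl
      rfl
    rw [h2 _ (one_smul Pᵐᵒᵖ u), ← hθ.fundamental Y u]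
    exact (hθ.anchor_form (op (1 : P) • u) _).trans (hθ.principal.md_proj_orbit u Y)

/-- `Ad g` preserves each `𝔤^i`, which gives one inclusion; the other is the same inclusion for
`g⁻¹`. As `P` is transitive on fibres, the image depends only on the base point. -/
theorem map_anchor_smul (hθ : IsCartanGeometry A (E_M := E_M) π θ) (i : ℤ) (g : P) (u : B) :
    (A.S.F i).map (hθ.anchor (op g • u)) = (A.S.F i).map (hθ.anchor u) := by
  have key : ∀ (g : P) (u : B),
      (A.S.F i).map (hθ.anchor (op g • u)) ≤ (A.S.F i).map (hθ.anchor u) := by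
    rintro g u _ ⟨X, hX, rfl⟩
    exact ⟨A.Ad g X, A.Ad_mem g i X hX, (hθ.anchor_smul g u X).symm⟩
  refine le_antisymm (key g u) ?_
  have h := key g⁻¹ (op g • u)
  rwa [smul_smul, ← op_mul, mul_inv_cancel, op_one, one_smul] at h

theorem map_anchor_eq (hθ : IsCartanGeometry A (E_M := E_M) π θ) (i : ℤ) {u u' : B}
    (h : π u = π u') : (A.S.F i).map (hθ.anchor u) = (A.S.F i).map (hθ.anchor u') := by
  obtain ⟨g, rfl⟩ := hθ.principal.exists_smul_eq h
  exact (hθ.map_anchor_smul i g u).symm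

theorem map_anchor (hθ : IsCartanGeometry A (E_M := E_M) π θ) (i : ℤ) (u : B) :
    (A.S.F i).map (hθ.anchor u) = ((A.S.F i).comap (θ u)).map (md E_B E_M π u).toLinearMap := by
  ext z
  constructor
  · rintro ⟨X, hX, rfl⟩
    refine ⟨hθ.parallel X u, ?_, rfl⟩
    change θ u (hθ.parallel X u) ∈ A.S.F i
    rwa [hθ.apply_parallel]
  · rintro ⟨v, hv, rfl⟩
    exact ⟨θ u v, hv, hθ.anchor_form u v⟩

/-- The filtration of the tangent bundle of the base of a Cartan geometry. -/
noncomputable def filtration (hθ : IsCartanGeometry A (E_M := E_M) π θ) (i : ℤ) (x : M) :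
    Submodule ℝ E_M :=
  (A.S.F i).map (hθ.anchor (Function.surjInv hθ.principal.surjective x))

theorem filtration_proj (hθ : IsCartanGeometry A (E_M := E_M) π θ) (i : ℤ) (u : B) :
    hθ.filtration i (π u) = (A.S.F i).map (hθ.anchor u) :=
  hθ.map_anchor_eq i (Function.surjInv_eq hθ.principal.surjective (π u))

theorem anchor_mem (hθ : IsCartanGeometry A (E_M := E_M) π θ) {i : ℤ} (u : B) {X : 𝔤}
    (hX : X ∈ A.S.F i) : hθ.anchor u X ∈ hθ.filtration i (π u) :=
  hθ.filtration_proj i u ▸ ⟨X, hX, rfl⟩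

theorem anchor_mem_of_proj (hθ : IsCartanGeometry A (E_M := E_M) π θ) {u : B} {x : M}
    (h : π u = x) (k : ℤ) (X : 𝔤) (hX : X ∈ A.S.F k) : hθ.anchor u X ∈ hθ.filtration k x :=
  h ▸ hθ.anchor_mem u hX

/-- For `i ≤ 0` the step `𝔤^i` contains the kernel `𝔤^0` of the anchor, so it is recovered from its
image. For `i > 0` membership of the image would only give `X ∈ 𝔤^0`. -/
theorem anchor_mem_iff [LieGroup 𝓘(ℝ, E_P) ∞ P] (hθ : IsCartanGeometry A (E_M := E_M) π θ) {i : ℤ}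
    (hi : i ≤ 0) (u : B) (X : 𝔤) : hθ.anchor u X ∈ hθ.filtration i (π u) ↔ X ∈ A.S.F i := by
  refine ⟨fun h => ?_, hθ.anchor_mem u⟩
  rw [hθ.filtration_proj] at h
  obtain ⟨Y, hY, h⟩ := h
  have h1 : hθ.anchor u (X - Y) = 0 := by
    rw [map_sub]
    exact sub_eq_zero.2 h.symm
  have h2 := A.S.antitone hi ((hθ.anchor_eq_zero_iff u _).1 h1)
  simpa using (A.S.F i).add_mem h2 hY

theorem filtration_antitone (hθ : IsCartanGeometry A (E_M := E_M) π θ) (x : M) :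
    Antitone fun i => hθ.filtration i x := fun _ _ h =>
  Submodule.map_mono (A.S.antitone h)

theorem filtration_top (hθ : IsCartanGeometry A (E_M := E_M) π θ) {i : ℤ} (hi : i ≤ -(μ : ℤ))
    (x : M) : hθ.filtration i x = ⊤ := by
  unfold filtration
  rw [A.S.top i hi, Submodule.map_top]
  exact LinearMap.range_eq_top.2 (hθ.anchor_surjective _)

theorem filtration_bot [LieGroup 𝓘(ℝ, E_P) ∞ P] (hθ : IsCartanGeometry A (E_M := E_M) π θ) {i : ℤ}
    (hi : 0 ≤ i) (x : M) : hθ.filtration i x = ⊥ := by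
  refine (Submodule.eq_bot_iff _).2 ?_
  rintro _ ⟨X, hX, rfl⟩
  exact (hθ.anchor_eq_zero_iff _ _).2 (A.S.antitone hi hX)

end IsCartanGeometry

end Anchor

end FilteredGeometry

namespace FilteredGeometry

/-! ### Regularity and brackets of sections of the filtration. -/

section CartanFiltration

open MulOpposite Set VectorField

variable {𝔤 : Type*} [LieRing 𝔤] [LieAlgebra ℝ 𝔤] [FiniteDimensional ℝ 𝔤]
  {E_P : Type*} [NormedAddCommGroup E_P] [NormedSpace ℝ E_P]
  {P : Type*} [Group P] [TopologicalSpace P] [ChartedSpace E_P P] {μ ν : ℕ}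
  {A : AdmissiblePair 𝔤 E_P P μ ν}
  {E_M : Type*} [NormedAddCommGroup E_M] [NormedSpace ℝ E_M]
  {M : Type*} [TopologicalSpace M] [ChartedSpace E_M M] [IsManifold 𝓘(ℝ, E_M) ∞ M]
  {E_B : Type*} [NormedAddCommGroup E_B] [NormedSpace ℝ E_B]
  {B : Type*} [TopologicalSpace B] [ChartedSpace E_B B] [IsManifold 𝓘(ℝ, E_B) ∞ B]
  [MulAction Pᵐᵒᵖ B]
  {π : B → M} {θ : ∀ u : B, TangentSpace 𝓘(ℝ, E_B) u →ₗ[ℝ] 𝔤}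
  {U : Set M} {χ : OpenPartialHomeomorph B (M × P)}

namespace IsCartanGeometry

/-- The projection to the base, along a local section, of a parallel field is smooth. -/
theorem smoothFieldOn_anchor [FiniteDimensional ℝ E_B]
    (hθ : IsCartanGeometry A (E_M := E_M) π θ) (h : IsBundleChart E_B E_P E_M π U χ) (k : P)
    (X : 𝔤) : SmoothFieldOn E_M (fun y => hθ.anchor (χ.symm (y, k)) X) U := by
  intro y₀ hy₀
  refine ContMDiffAt.contMDiffWithinAt ?_
  have hσ := h.contMDiffAt_section hy₀ k
  have hX : ContMDiffAt 𝓘(ℝ, E_M) 𝓘(ℝ, E_B).tangent ∞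
      (fun y => (⟨χ.symm (y, k), hθ.parallel X (χ.symm (y, k))⟩ : TangentBundle 𝓘(ℝ, E_B) B)) y₀ :=
    ContMDiffAt.comp y₀ ((hθ.smoothFieldOn_parallel X).contMDiffAt Filter.univ_mem) hσ
  have hf : ContMDiffAt (𝓘(ℝ, E_M).prod 𝓘(ℝ, E_B)) 𝓘(ℝ, E_M) ∞
      (Function.uncurry fun (_ : M) (w : B) => π w) (y₀, χ.symm (y₀, k)) :=
    ContMDiffAt.comp (g := π) (f := Prod.snd) _ (hθ.principal.smooth_proj _) contMDiffAt_snd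
  refine (contMDiffAt_md_family hf hσ hX).congr_of_eventuallyEq ?_
  filter_upwards [h.isOpen.mem_nhds hy₀] with y hy
  exact congrArg (fun b : M => (⟨b, hθ.anchor (χ.symm (y, k)) X⟩ : TangentBundle 𝓘(ℝ, E_M) M))
    (h.proj_symm hy k).symm

theorem isLocalSection_anchor [FiniteDimensional ℝ E_B]
    (hθ : IsCartanGeometry A (E_M := E_M) π θ) (h : IsBundleChart E_B E_P E_M π U χ) (k : P)
    {i : ℤ} {X : 𝔤} (hX : X ∈ A.S.F i) :
    IsLocalSection E_M (hθ.filtration i) (fun y => hθ.anchor (χ.symm (y, k)) X) U where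
  isOpen := h.isOpen
  smooth := hθ.smoothFieldOn_anchor h k X
  mem y hy := by
    have h1 := hθ.anchor_mem (χ.symm (y, k)) hX
    rwa [h.proj_symm hy] at h1

/-- At every point the anchor induces an injection of `𝔤 / 𝔤^0`. Representatives in `𝔤^i` of a fixed
basis of the image of `𝔤^i` there, projected along a local section of the bundle, therefore form a
frame. -/
theorem isSmoothSubbundle_filtration [LieGroup 𝓘(ℝ, E_P) ∞ P] [FiniteDimensional ℝ E_B]
    (hθ : IsCartanGeometry A (E_M := E_M) π θ) (i : ℤ) :
    IsSmoothSubbundle E_M (hθ.filtration i) := by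
  intro x
  rcases le_or_gt 0 i with hi | hi
  · refine ⟨univ, 0, fun a => a.elim0, mem_univ x, fun a => a.elim0, fun y _ =>
      ⟨linearIndependent_empty_type, ?_⟩⟩
    refine Eq.trans ?_ (hθ.filtration_bot hi y).symm
    rw [range_eq_empty]
    exact Submodule.span_empty
  obtain ⟨U, χ, hx, h⟩ := hθ.principal.exists_chart x
  set W := (A.S.F i).map (A.S.F 0).mkQ
  set b := Module.finBasis ℝ W
  have hb : ∀ a, ∃ X ∈ A.S.F i, (A.S.F 0).mkQ X = b a := fun a => (b a).2
  choose X hX hXb using hb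
  refine ⟨U, _, fun a y => hθ.anchor (χ.symm (y, 1)) (X a), hx, fun a =>
    hθ.isLocalSection_anchor h 1 (hX a), fun y hy => ⟨?_, ?_⟩⟩
  · refine Fintype.linearIndependent_iff.2 fun c hc => ?_
    have h1 : hθ.anchor (χ.symm (y, 1)) (∑ a, c a • X a) = 0 := by
      rw [map_sum]
      simp only [map_smul]
      exact hc
    have h2 := (Submodule.Quotient.mk_eq_zero _).2 ((hθ.anchor_eq_zero_iff _ _).1 h1)
    have h3 : (A.S.F 0).mkQ (∑ a, c a • X a) = 0 := h2
    simp only [map_sum, map_smul, hXb] at h3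
    have h4 : ∑ a, c a • b a = 0 := by
      apply Subtype.ext
      simpa using h3
    exact Fintype.linearIndependent_iff.1 b.linearIndependent c h4
  · have h0 : hθ.filtration i y = (A.S.F i).map (hθ.anchor (χ.symm (y, 1))) := by
      rw [← hθ.filtration_proj, h.proj_symm hy]
    have h1 : Submodule.span ℝ (range fun a => hθ.anchor (χ.symm (y, 1)) (X a)) =
        hθ.filtration i y := by
      rw [h0]
      refine le_antisymm (Submodule.span_le.2 ?_) ?_
      · rintro _ ⟨a, rfl⟩
        exact ⟨X a, hX a, rfl⟩
      · rintro _ ⟨Y, hY, rfl⟩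
        set c := b.repr ⟨(A.S.F 0).mkQ Y, Y, hY, rfl⟩
        have h2 : (A.S.F 0).mkQ (Y - ∑ a, c a • X a) = 0 := by
          rw [map_sub, sub_eq_zero]
          simp only [map_sum, map_smul, hXb]
          have h3 := congrArg Subtype.val (b.sum_repr ⟨(A.S.F 0).mkQ Y, Y, hY, rfl⟩)
          refine h3.symm.trans ?_
          simp only [Submodule.coe_sum, Submodule.coe_smul, c]
        have h4 := (hθ.anchor_eq_zero_iff (χ.symm (y, 1)) _).2
          ((Submodule.Quotient.mk_eq_zero _).1 h2)
        rw [map_sub, sub_eq_zero] at h4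
        rw [h4, map_sum]
        refine Submodule.sum_mem _ fun a _ => ?_
        rw [map_smul]
        exact Submodule.smul_mem _ _ (Submodule.subset_span ⟨a, rfl⟩)
    exact h1

theorem form_lift_mem [LieGroup 𝓘(ℝ, E_P) ∞ P] (hθ : IsCartanGeometry A (E_M := E_M) π θ)
    (h : IsBundleChart E_B E_P E_M π U χ) {i : ℤ} (hi : i ≤ 0) {V : Set M}
    {ξ : ∀ x : M, TangentSpace 𝓘(ℝ, E_M) x} (hξ : IsLocalSection E_M (hθ.filtration i) ξ V) {w : B}
    (hw : π w ∈ U ∩ V) : θ w (IsBundleChart.lift π χ ξ w) ∈ A.S.F i := by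
  rw [← hθ.anchor_mem_iff hi w, hθ.anchor_form_lift h ξ hw.1]
  exact hξ.mem _ hw.2

theorem smoothOn_form_lift (hθ : IsCartanGeometry A (E_M := E_M) π θ)
    (h : IsBundleChart E_B E_P E_M π U χ) {V : Set M} (hV : IsOpen V)
    {ξ : ∀ x : M, TangentSpace 𝓘(ℝ, E_M) x} (hξ : SmoothFieldOn E_M ξ V) :
    SmoothOn E_B (fun w => θ w (IsBundleChart.lift π χ ξ w)) (π ⁻¹' (U ∩ V)) :=
  hθ.smooth _ _ ((h.isOpen.inter hV).preimage hθ.principal.smooth_proj.continuous)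
    (h.smoothFieldOn_lift hθ.principal hV hξ)

/-- Regularity: the Lie bracket of sections of the filtration corresponds, up to terms of higher
degree, to the bracket of `𝔤`. -/
theorem exists_bracket_form [LieGroup 𝓘(ℝ, E_P) ∞ P] [FiniteDimensional ℝ E_B]
    [FiniteDimensional ℝ E_M] (hθ : IsCartanGeometry A (E_M := E_M) π θ) (hreg : IsRegular A.S θ)
    {i j : ℤ} (hi : i < 0) (hj : j < 0) {V : Set M} {ξ η : ∀ x : M, TangentSpace 𝓘(ℝ, E_M) x}
    (hξ : IsLocalSection E_M (hθ.filtration i) ξ V) (hη : IsLocalSection E_M (hθ.filtration j) η V)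
    {u : B} (hu : π u ∈ V) :
    ∃ X ∈ A.S.F i, ∃ Y ∈ A.S.F j, ∃ Z, hθ.anchor u X = ξ (π u) ∧ hθ.anchor u Y = η (π u) ∧
      hθ.anchor u Z = mlieBracket 𝓘(ℝ, E_M) ξ η (π u) ∧ Z - ⁅X, Y⁆ ∈ A.S.F (i + j + 1) := by
  have : CompleteSpace E_B := FiniteDimensional.complete ℝ E_B
  have : CompleteSpace E_M := FiniteDimensional.complete ℝ E_M
  obtain ⟨U, χ, hx, h⟩ := hθ.principal.exists_chart (π u)
  -- The lifts are `π`-related to `ξ` and `η`, so their bracket projects to the bracket of `ξ` and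
  -- `η`. The witnesses `X`, `Y`, `Z` are the values of `θ` at `u` on the lifts and on their
  -- bracket.
  set ξ' := IsBundleChart.lift (E_B := E_B) π χ ξ with hξ'
  set η' := IsBundleChart.lift (E_B := E_B) π χ η with hη'
  have hO : IsOpen (π ⁻¹' (U ∩ V)) :=
    (h.isOpen.inter hξ.isOpen).preimage hθ.principal.smooth_proj.continuous
  have huO : u ∈ π ⁻¹' (U ∩ V) := ⟨hx, hu⟩
  have hsξ := h.smoothFieldOn_lift hθ.principal hξ.isOpen hξ.smooth
  have hsη := h.smoothFieldOn_lift hθ.principal hη.isOpen hη.smooth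
  have hmξ : ∀ w ∈ π ⁻¹' (U ∩ V), θ w (ξ' w) ∈ A.S.F i := fun w hw =>
    hθ.form_lift_mem h hi.le hξ hw
  have hmη : ∀ w ∈ π ⁻¹' (U ∩ V), θ w (η' w) ∈ A.S.F j := fun w hw =>
    hθ.form_lift_mem h hj.le hη hw
  refine ⟨θ u (ξ' u), hmξ u huO, θ u (η' u), hmη u huO, θ u (mlieBracket 𝓘(ℝ, E_B) ξ' η' u),
    hθ.anchor_form_lift h ξ hx, hθ.anchor_form_lift h η hx, ?_, ?_⟩
  · refine (hθ.anchor_form u _).trans ?_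
    exact md_mlieBracket_of_related hθ.principal.smooth_proj hO hξ.isOpen (fun w hw => hw.2)
      hsξ hsη hξ.smooth hη.smooth (fun w hw => h.md_proj_lift hθ.principal hw.1)
      (fun w hw => h.md_proj_lift hθ.principal hw.1) huO
  · have hK := hreg i j _ ξ' η' hO hsξ hsη u huO (hmξ u huO) (hmη u huO)
    -- The functions `θ(η')` and `θ(ξ')` take values in `𝔤^j` and `𝔤^i`, and so do their
    -- derivatives. Since `i, j ≤ -1`, both steps lie in `𝔤^{i+j+1}`; the formula for the curvature
    -- then leaves `θ([ξ', η']) - [X, Y]` in that step.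
    have h1 : derivAlong E_B (fun w => θ w (η' w)) u (ξ' u) ∈ A.S.F (i + j + 1) :=
      A.S.antitone (by omega) (derivAlong_mem (A.S.F j)
        ((hθ.smoothOn_form_lift h hη.isOpen hη.smooth).weakDiffAt (hO.mem_nhds huO))
        (Filter.mem_of_superset (hO.mem_nhds huO) hmη) (ξ' u))
    have h2 : derivAlong E_B (fun w => θ w (ξ' w)) u (η' u) ∈ A.S.F (i + j + 1) :=
      A.S.antitone (by omega) (derivAlong_mem (A.S.F i)
        ((hθ.smoothOn_form_lift h hξ.isOpen hξ.smooth).weakDiffAt (hO.mem_nhds huO))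
        (Filter.mem_of_superset (hO.mem_nhds huO) hmξ) (η' u))
    have h3 := (A.S.F (i + j + 1)).sub_mem ((A.S.F (i + j + 1)).sub_mem h1 h2) hK
    unfold curvature at h3
    convert h3 using 1
    abel

theorem mlieBracket_mem_filtration [LieGroup 𝓘(ℝ, E_P) ∞ P] [FiniteDimensional ℝ E_B]
    [FiniteDimensional ℝ E_M] (hθ : IsCartanGeometry A (E_M := E_M) π θ) (hreg : IsRegular A.S θ)
    (i j : ℤ) (V : Set M) (ξ η : ∀ x : M, TangentSpace 𝓘(ℝ, E_M) x)
    (hξ : IsLocalSection E_M (hθ.filtration i) ξ V) (hη : IsLocalSection E_M (hθ.filtration j) η V)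
    (x : M) (hx : x ∈ V) : mlieBracket 𝓘(ℝ, E_M) ξ η x ∈ hθ.filtration (i + j) x := by
  -- In degree `k ≥ 0` a section vanishes on an open set, so its brackets vanish there too; only
  -- negative degrees need regularity.
  have hzero : ∀ {k : ℤ} {ζ : ∀ x : M, TangentSpace 𝓘(ℝ, E_M) x}, 0 ≤ k →
      IsLocalSection E_M (hθ.filtration k) ζ V →
      ζ =ᶠ[𝓝 x] (0 : ∀ x : M, TangentSpace 𝓘(ℝ, E_M) x) := fun hk hζ => by
    filter_upwards [hζ.isOpen.mem_nhds hx] with y hy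
    have h1 := hζ.mem y hy
    rw [hθ.filtration_bot hk] at h1
    exact (Submodule.mem_bot ℝ).1 h1
  have hmem : ∀ z : E_M, z = 0 → z ∈ hθ.filtration (i + j) x := by
    rintro _ rfl
    exact Submodule.zero_mem _
  rcases le_or_gt 0 i with hi | hi
  · refine hmem _ (((hzero hi hξ).mlieBracket_vectorField_eq Filter.EventuallyEq.rfl).trans ?_)
    rw [mlieBracket_zero_left]
    rfl
  rcases le_or_gt 0 j with hj | hj
  · refine hmem _ ((Filter.EventuallyEq.rfl.mlieBracket_vectorField_eq (hzero hj hη)).trans ?_)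
    rw [mlieBracket_zero_right]
    rfl
  obtain ⟨u, rfl⟩ := hθ.principal.surjective x
  obtain ⟨X, hX, Y, hY, Z, -, -, hZ, hXYZ⟩ := hθ.exists_bracket_form hreg hi hj hξ hη hx
  rw [← hZ]
  refine hθ.anchor_mem u ?_
  simpa using (A.S.F (i + j)).add_mem (A.S.antitone (by omega) hXYZ) (A.S.lie_mem i j X Y hX hY)

theorem isFilteredManifold [LieGroup 𝓘(ℝ, E_P) ∞ P] [FiniteDimensional ℝ E_B]
    [FiniteDimensional ℝ E_M] (hθ : IsCartanGeometry A (E_M := E_M) π θ) (hreg : IsRegular A.S θ) :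
    IsFilteredManifold E_M μ hθ.filtration where
  antitone := hθ.filtration_antitone
  top _ hi x := hθ.filtration_top hi x
  bot _ hi x := hθ.filtration_bot hi x
  smooth := hθ.isSmoothSubbundle_filtration
  bracket := hθ.mlieBracket_mem_filtration hreg

end IsCartanGeometry

end CartanFiltration

end FilteredGeometry

namespace FilteredGeometry

/-! ### The graded frames defined by a Cartan geometry -/

section GrMap

variable {V : Type*} [AddCommGroup V] [Module ℝ V] {V' : Type*} [AddCommGroup V'] [Module ℝ V']
  {F : ℤ → Submodule ℝ V} {F' : ℤ → Submodule ℝ V'}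

/-- The map of associated graded spaces induced by a filtered map. -/
def Gr.map (ρ : V →ₗ[ℝ] V') (h : ∀ k, ∀ X ∈ F k, ρ X ∈ F' k) (i : ℤ) : Gr F i →ₗ[ℝ] Gr F' i :=
  Submodule.mapQ _ _ (ρ.restrict (h i)) fun X hX => h (i + 1) X hX

theorem Gr.map_mk (ρ : V →ₗ[ℝ] V') (h : ∀ k, ∀ X ∈ F k, ρ X ∈ F' k) {i : ℤ} {X : V}
    (hX : X ∈ F i) : Gr.map ρ h i (Gr.mk hX) = Gr.mk (h i X hX) := rfl

theorem Gr.map_bijective (ρ : V →ₗ[ℝ] V') (h : ∀ k, ∀ X ∈ F k, ρ X ∈ F' k) {i : ℤ}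
    (hs : ∀ v ∈ F' i, ∃ X ∈ F i, ρ X = v) (hi : ∀ X, ρ X ∈ F' (i + 1) → X ∈ F (i + 1)) :
    Function.Bijective (Gr.map ρ h i) := by
  constructor
  · refine (injective_iff_map_eq_zero _).2 fun z hz => ?_
    obtain ⟨X, hX, rfl⟩ := Gr.mk_surjective z
    rw [Gr.map_mk, Gr.mk_eq_zero_iff] at hz
    exact (Gr.mk_eq_zero_iff _).2 (hi X hz)
  · intro z
    obtain ⟨v, hv, rfl⟩ := Gr.mk_surjective z
    obtain ⟨X, hX, rfl⟩ := hs v hv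
    exact ⟨Gr.mk hX, rfl⟩

end GrMap

theorem GradedFrame.ext_toEquiv {𝔤 : Type*} [LieRing 𝔤] [LieAlgebra ℝ 𝔤] {μ ν : ℕ}
    {E_M : Type*} [NormedAddCommGroup E_M] [NormedSpace ℝ E_M]
    {M : Type*} [TopologicalSpace M] [ChartedSpace E_M M] [IsManifold 𝓘(ℝ, E_M) ∞ M]
    {S : LieFiltration 𝔤 μ ν}
    {T : ℤ → ∀ x : M, Submodule ℝ (TangentSpace 𝓘(ℝ, E_M) x)} {x : M} {f f' : GradedFrame E_M S T x}
    (h : ∀ i z, f.toEquiv i z = f'.toEquiv i z) : f = f' := by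
  obtain ⟨e, he⟩ := f
  obtain ⟨e', he'⟩ := f'
  have : e = e' := funext fun i => LinearEquiv.ext (h i)
  subst this
  rfl

section CartanFrames

open MulOpposite Set VectorField

variable {𝔤 : Type*} [LieRing 𝔤] [LieAlgebra ℝ 𝔤] [FiniteDimensional ℝ 𝔤]
  {E_P : Type*} [NormedAddCommGroup E_P] [NormedSpace ℝ E_P]
  {P : Type*} [Group P] [TopologicalSpace P] [ChartedSpace E_P P] [LieGroup 𝓘(ℝ, E_P) ∞ P] {μ ν : ℕ}
  {A : AdmissiblePair 𝔤 E_P P μ ν}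
  {E_M : Type*} [NormedAddCommGroup E_M] [NormedSpace ℝ E_M]
  {M : Type*} [TopologicalSpace M] [ChartedSpace E_M M]
  {E_B : Type*} [NormedAddCommGroup E_B] [NormedSpace ℝ E_B]
  {B : Type*} [TopologicalSpace B] [ChartedSpace E_B B] [IsManifold 𝓘(ℝ, E_B) ∞ B]
  [MulAction Pᵐᵒᵖ B]
  {π : B → M} {θ : ∀ u : B, TangentSpace 𝓘(ℝ, E_B) u →ₗ[ℝ] 𝔤}

namespace IsCartanGeometry

/-- The isomorphisms `gr_i(𝔤) → gr_i(T_x M)`, `i < 0`, defined by a point `u` over `x`. -/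
noncomputable def grEquiv (hθ : IsCartanGeometry A (E_M := E_M) π θ) {u : B} {x : M}
    (h : π u = x) (i : NegInt) : Gr A.S.F i ≃ₗ[ℝ] GrT E_M hθ.filtration x i :=
  LinearEquiv.ofBijective
    (Gr.map (F' := fun k => hθ.filtration k x) (hθ.anchor u) (hθ.anchor_mem_of_proj h) i)
    (by
      subst h
      refine Gr.map_bijective _ _ (fun v hv => ?_) fun X hX => ?_
      · rw [hθ.filtration_proj] at hv
        exact hv
      -- Injectivity on `gr_i` needs the anchor to detect `𝔤^{i+1}`, which holds because `i < 0`
      -- gives `i + 1 ≤ 0`.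
      · exact (hθ.anchor_mem_iff (by have := i.2; omega) u X).1 hX)

theorem grEquiv_mk (hθ : IsCartanGeometry A (E_M := E_M) π θ) {u : B} {x : M}
    (h : π u = x) (i : NegInt) {X : 𝔤} (hX : X ∈ A.S.F i) {v : TangentSpace 𝓘(ℝ, E_M) x}
    (hv : v ∈ hθ.filtration i x) (hXv : hθ.anchor u X = v) :
    hθ.grEquiv h i (Gr.mk hX) = Gr.mk (F := fun k => hθ.filtration k x) hv := by
  subst hXv
  rfl

theorem grEquiv_symm_mk (hθ : IsCartanGeometry A (E_M := E_M) π θ) {u : B} {x : M}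
    (h : π u = x) (i : NegInt) {X : 𝔤} (hX : X ∈ A.S.F i) {v : TangentSpace 𝓘(ℝ, E_M) x}
    (hv : v ∈ hθ.filtration i x) (hXv : hθ.anchor u X = v) :
    (hθ.grEquiv h i).symm (Gr.mk (F := fun k => hθ.filtration k x) hv) = Gr.mk hX := by
  exact (LinearEquiv.symm_apply_eq _).2 (hθ.grEquiv_mk h i hX hv hXv).symm

theorem grEquiv_smul (hθ : IsCartanGeometry A (E_M := E_M) π θ) {u : B} {x : M}
    (h : π u = x) (g : P) (hg : π (op g • u) = x) (i : NegInt) (z : Gr A.S.F i) :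
    hθ.grEquiv hg i z = hθ.grEquiv h i (A.adGr i g z) := by
  obtain ⟨X, hX, rfl⟩ := Gr.mk_surjective z
  rw [A.adGr_mk]
  have h1 := hθ.anchor_mem_of_proj h i _ (A.Ad_mem g i X hX)
  rw [hθ.grEquiv_mk h i _ h1 rfl, hθ.grEquiv_mk hg i hX h1 (hθ.anchor_smul g u X)]

variable [IsManifold 𝓘(ℝ, E_M) ∞ M] [FiniteDimensional ℝ E_B]

-- Smoothness of `φ` is known only on smooth local sections, so the frame must be expanded in such
-- sections. Writing `u` as `χ.symm (π u, 1)` moved by `(χ u).2` turns the frame at `u` on the class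
-- of `Z` into the frame at `χ.symm (π u, 1)` on the class of `Ad (χ u).2 Z`. In a basis of `𝔤^i`
-- the coefficients of the latter are smooth in `u`, and the basis vectors give smooth sections over
-- `M`.
open Classical in
theorem smoothOn_triv_grEquiv (hθ : IsCartanGeometry A (E_M := E_M) π θ) {V : Set M}
    {φ : ∀ (y : M) (i : NegInt), GrT E_M hθ.filtration y i →ₗ[ℝ] Gr A.S.F i}
    (hφ : IsLocalTriv E_M A.S hθ.filtration V φ) (i : NegInt) (X : Gr A.S.F i) :
    SmoothOn E_B (fun u => φ (π u) i (hθ.grEquiv rfl i X)) (π ⁻¹' V) := by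
  refine smoothOn_of_locally fun u₀ hu₀ => ?_
  obtain ⟨U, χ, hx, h⟩ := hθ.principal.exists_chart (π u₀)
  refine ⟨π ⁻¹' U, h.isOpen.preimage hθ.principal.smooth_proj.continuous, hx, ?_⟩
  obtain ⟨Z, hZ, rfl⟩ := Gr.mk_surjective X
  set b := Module.finBasis ℝ (A.S.F i)
  -- The coordinates of `𝔤^i` are extended to `𝔤`, because `Ad g Z` is known to be smooth as a
  -- `𝔤`-valued map.
  have hc : ∀ a, ∃ l : Module.Dual ℝ 𝔤, l ∘ₗ (A.S.F i).subtype = b.coord a := fun a =>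
    LinearMap.exists_extend _
  choose l hl using hc
  have hsec : ∀ a, IsLocalSection E_M (hθ.filtration i)
      (fun y => hθ.anchor (χ.symm (y, 1)) (b a : 𝔤)) U := fun a =>
    hθ.isLocalSection_anchor h 1 (b a).2
  set f : ∀ a, M → Gr A.S.F i := fun a y => if hy : y ∈ U then
    φ y i (Gr.mk (F := fun k => hθ.filtration k y) ((hsec a).mem y hy)) else 0
  have hf' : ∀ a y (hy : y ∈ U),
      f a y = φ y i (Gr.mk (F := fun k => hθ.filtration k y) ((hsec a).mem y hy)) :=
    fun a y hy => dif_pos hy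
  have hf : ∀ a, SmoothOn E_M (f a) (V ∩ U) := fun a =>
    hφ.smooth i U _ (hsec a) (f a) (hf' a)
  have hsum : ∀ u, π u ∈ U → φ (π u) i (hθ.grEquiv rfl i (Gr.mk hZ)) =
      ∑ a, l a (A.Ad (χ u).2 Z) • f a (π u) := fun u hu => by
    have hZ' := A.Ad_mem (χ u).2 i Z hZ
    have hσ := h.proj_symm hu (1 : P)
    have hu1 : op (χ u).2 • χ.symm (π u, 1) = u := by
      rw [h.smul_symm hθ.principal hu, one_mul, h.symm_apply hu]
    have h1 : hθ.grEquiv (rfl : π u = π u) i (Gr.mk hZ) =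
        hθ.grEquiv hσ i (Gr.mk hZ') := by
      have h2 := hθ.anchor_mem_of_proj hσ i _ hZ'
      rw [hθ.grEquiv_mk hσ i hZ' h2 rfl]
      refine hθ.grEquiv_mk rfl i hZ h2 ?_
      rw [← hθ.anchor_smul, hu1]
    have h3 : Gr.mk hZ' = ∑ a, l a (A.Ad (χ u).2 Z) • (Gr.mk (b a).2 : Gr A.S.F i) := by
      have h4 := b.sum_repr ⟨_, hZ'⟩
      have h5 : ∀ a, b.repr ⟨_, hZ'⟩ a = l a (A.Ad (χ u).2 Z) := fun a =>
        (LinearMap.congr_fun (hl a) ⟨_, hZ'⟩).symm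
      simp only [h5] at h4
      have h6 := congrArg (Submodule.mkQ ((A.S.F (i + 1)).submoduleOf (A.S.F i))) h4
      rw [map_sum] at h6
      simp only [map_smul] at h6
      exact h6.symm
    rw [h1, h3, map_sum, map_sum]
    refine Finset.sum_congr rfl fun a _ => ?_
    rw [map_smul, map_smul]
    refine congrArg (l a (A.Ad (χ u).2 Z) • ·) ?_
    rw [hθ.grEquiv_mk hσ i (b a).2 ((hsec a).mem _ hu) rfl]
    exact (hf' a _ hu).symm
  refine (SmoothOn.sum (t := Finset.univ) fun a _ => SmoothOn.smul ?_ ((hf a).comp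
    hθ.principal.smooth_proj.contMDiffOn fun u hu => hu)).congr fun u hu => hsum u hu.2
  exact ((A.Ad_smooth Z).comp (s := π ⁻¹' V ∩ π ⁻¹' U) (g := fun u => (χ u).2)
    (fun u hu => (h.contMDiffAt_snd hu.2).contMDiffWithinAt) fun u _ => mem_univ _) (l a)

variable [FiniteDimensional ℝ E_M]

/-- The congruence modulo `𝔤^{i+j+1}` in `exists_bracket_form` is precisely an equality of classes
in `gr_{i+j}(𝔤)`. -/
theorem intertwinesLevi_grEquiv (hθ : IsCartanGeometry A (E_M := E_M) π θ) (hreg : IsRegular A.S θ)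
    {u : B} {x : M} (h : π u = x) :
    IntertwinesLevi E_M A.S hθ.filtration x fun i => (hθ.grEquiv h i).symm.toLinearMap := by
  subst h
  intro i j V ξ η hx hξ hη
  obtain ⟨X, hX, Y, hY, Z, hXξ, hYη, hZ, hXYZ⟩ := hθ.exists_bracket_form hreg i.2 j.2 hξ hη hx
  have hZm : Z ∈ A.S.F (i.1 + j.1) := by
    simpa using (A.S.F (i.1 + j.1)).add_mem (A.S.antitone (by omega) hXYZ)
      (A.S.lie_mem i j X Y hX hY)
  refine ⟨hθ.mlieBracket_mem_filtration hreg i j V ξ η hξ hη _ hx, ?_⟩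
  refine (hθ.grEquiv_symm_mk rfl (i + j) hZm _ hZ).trans ?_
  have h1 := hθ.grEquiv_symm_mk rfl i hX (hξ.mem _ hx) hXξ
  have h2 := hθ.grEquiv_symm_mk rfl j hY (hη.mem _ hx) hYη
  refine Eq.trans ?_ (congrArg₂ (fun a b => A.S.grBracket i j a b) h1 h2).symm
  exact (Gr.mk_eq_mk_iff _ _).2 hXYZ

/-- The graded frame of `gr(T_x M)` defined by a point over `x`. -/
noncomputable def gradedFrame (hθ : IsCartanGeometry A (E_M := E_M) π θ) (hreg : IsRegular A.S θ)
    {u : B} {x : M} (h : π u = x) : GradedFrame E_M A.S hθ.filtration x where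
  toEquiv := hθ.grEquiv h
  levi := hθ.intertwinesLevi_grEquiv hreg h

-- The trivialization is the inverse of the frame along the local section with group part `1`. On a
-- section `ξ` of `T^i M` it is the class of `θ` on the lift of `ξ`, which is smooth.
open Classical in
theorem isRegularOfType (hθ : IsCartanGeometry A (E_M := E_M) π θ) (hreg : IsRegular A.S θ) :
    IsRegularOfType E_M A.S hθ.filtration := by
  intro x
  obtain ⟨U, χ, hx, h⟩ := hθ.principal.exists_chart x
  have hφ : ∀ y (hy : y ∈ U) (i : NegInt), (if hy : π (χ.symm (y, 1)) = y then
      (hθ.grEquiv hy i).symm.toLinearMap else 0) =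
        (hθ.grEquiv (h.proj_symm hy 1) i).symm.toLinearMap := fun y hy i =>
    dif_pos (h.proj_symm hy 1)
  -- The frame needs a proof that the point lies over `y`, which is available on `U`; where it fails
  -- the value `0` plays no role.
  refine ⟨U, fun y i => if hy : π (χ.symm (y, 1)) = y then
    (hθ.grEquiv hy i).symm.toLinearMap else 0, hx, h.isOpen, fun y hy i => ?_, ?_, fun y hy => ?_⟩
  · rw [hφ y hy]
    exact (hθ.grEquiv (h.proj_symm hy 1) i).symm.bijective
  · intro i V ξ hξ f hf
    have h1 := (hθ.smoothOn_form_lift h hξ.isOpen hξ.smooth).comp (s := U ∩ V)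
      (g := fun y => χ.symm (y, 1))
      (fun y hy => (h.contMDiffAt_section hy.1 1).contMDiffWithinAt) fun y hy => by
        change π (χ.symm (y, 1)) ∈ U ∩ V
        rwa [h.proj_symm hy.1]
    refine (h1.map (Gr.proj A.S.F i)).congr fun y hy => ?_
    have hy' := h.proj_symm hy.1 (1 : P)
    have hym : π (χ.symm (y, 1)) ∈ U ∩ V := by rwa [hy']
    have h2 := hθ.form_lift_mem h i.2.le hξ hym
    rw [hf y hy.2, hφ y hy.1 i, Gr.proj_apply h2]
    refine hθ.grEquiv_symm_mk hy' i h2 _ ?_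
    rw [hθ.anchor_form_lift h ξ hym.1, hy']
  · rw [funext (hφ y hy)]
    exact hθ.intertwinesLevi_grEquiv hreg (h.proj_symm hy 1)

/-- The map from the total space of a Cartan geometry to the natural frame bundle of the base. -/
noncomputable def toFrameBundle (hθ : IsCartanGeometry A (E_M := E_M) π θ)
    (hreg : IsRegular A.S θ) (u : B) : FrameBundle E_M A.S hθ.filtration :=
  ⟨π u, hθ.gradedFrame hreg rfl⟩

/-- Lets frames given by different points of one fibre be compared over a common base point `x`. -/
theorem toFrameBundle_eq (hθ : IsCartanGeometry A (E_M := E_M) π θ)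
    (hreg : IsRegular A.S θ) {u : B} {x : M} (h : π u = x) :
    hθ.toFrameBundle hreg u = ⟨x, hθ.gradedFrame hreg h⟩ := by
  subst h
  rfl

theorem toFrameBundle_smul (hθ : IsCartanGeometry A (E_M := E_M) π θ)
    (hreg : IsRegular A.S θ) (g : P) (u : B) :
    hθ.toFrameBundle hreg (op g • u) = (hθ.toFrameBundle hreg u).act (A.adNeg g) := by
  rw [hθ.toFrameBundle_eq hreg (hθ.principal.proj_act u g)]
  refine congrArg (Sigma.mk (π u)) (GradedFrame.ext_toEquiv fun i z => ?_)
  exact hθ.grEquiv_smul rfl g (hθ.principal.proj_act u g) i z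

theorem toFrameBundle_smul_of_mem (hθ : IsCartanGeometry A (E_M := E_M) π θ)
    (hreg : IsRegular A.S θ) {g : P} (hg : g ∈ A.Pplus) (u : B) :
    hθ.toFrameBundle hreg (op g • u) = hθ.toFrameBundle hreg u := by
  rw [hθ.toFrameBundle_eq hreg (hθ.principal.proj_act u g)]
  refine congrArg (Sigma.mk (π u)) (GradedFrame.ext_toEquiv fun i z => ?_)
  refine (hθ.grEquiv_smul rfl g (hθ.principal.proj_act u g) i z).trans ?_
  have h1 : A.adGr i g = 1 := Subgroup.mem_iInf.1 hg (i : ℤ)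
  rw [h1]
  rfl

/-- The map from the quotient of a Cartan geometry by `P_+` to the natural frame bundle. -/
noncomputable def orbitFrame (hθ : IsCartanGeometry A (E_M := E_M) π θ)
    (hreg : IsRegular A.S θ) (w : OrbitSpace A.Pplus B) : FrameBundle E_M A.S hθ.filtration :=
  Quotient.lift (s := MulAction.orbitRel A.Pplus.op B) (hθ.toFrameBundle hreg) (by
    rintro u u' ⟨⟨n, hn⟩, hu⟩
    have hu' : n • u' = u := hu
    rw [← hu']
    exact hθ.toFrameBundle_smul_of_mem hreg (g := n.unop) hn u') w

theorem orbitFrame_mk (hθ : IsCartanGeometry A (E_M := E_M) π θ)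
    (hreg : IsRegular A.S θ) (u : B) :
    hθ.orbitFrame hreg (OrbitSpace.mk A.Pplus u) = hθ.toFrameBundle hreg u := rfl

theorem orbitFrame_smul (hθ : IsCartanGeometry A (E_M := E_M) π θ)
    (hreg : IsRegular A.S θ) (w : OrbitSpace A.Pplus B) (g : P ⧸ A.Pplus) :
    hθ.orbitFrame hreg (op g • w) = (hθ.orbitFrame hreg w).act (A.beta g) := by
  obtain ⟨u, rfl⟩ := OrbitSpace.mk_surjective w
  obtain ⟨g, rfl⟩ := QuotientGroup.mk_surjective g
  rw [OrbitSpace.op_mk_smul_mk, orbitFrame_mk, orbitFrame_mk]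
  exact hθ.toFrameBundle_smul hreg g u

end IsCartanGeometry

end CartanFrames

end FilteredGeometry

namespace FilteredGeometry

/-! ### The filtered structure underlying a regular Cartan geometry -/

section Underlying

open MulOpposite Set

variable {𝔤 : Type*} [LieRing 𝔤] [LieAlgebra ℝ 𝔤] [FiniteDimensional ℝ 𝔤]
  {E_P : Type*} [NormedAddCommGroup E_P] [NormedSpace ℝ E_P]
  {P : Type*} [Group P] [TopologicalSpace P] [ChartedSpace E_P P] {μ ν : ℕ}

/-- The homomorphism `P / P_+ → Aut_gr(𝔪)` is smooth, and its derivative at the identity is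
injective. -/
theorem AdmissiblePair.isInfInjective_beta (A : AdmissiblePair 𝔤 E_P P μ ν)
    {F : Type*} [NormedAddCommGroup F] [NormedSpace ℝ F] [ChartedSpace F (P ⧸ A.Pplus)]
    (hP : HasSmoothSections E_P F (QuotientGroup.mk : P → P ⧸ A.Pplus))
    {F' : Type*} [NormedAddCommGroup F'] [NormedSpace ℝ F']
    (D : SliceAt E_P F' (QuotientGroup.mk : P → P ⧸ A.Pplus) 1)
    (hD : ∀ v : GroupLieAlgebra 𝓘(ℝ, E_P) P, A.ι v ∈ A.S.F 1 → md E_P F' D.f 1 v = 0) :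
    IsInfInjective F A.S A.beta := by
  have hsm : ∀ (i : NegInt) (X : Gr A.S.F i), SmoothOn F (fun g => (A.beta g).1 i X) univ :=
    fun i X => hP.smoothOn_of_comp QuotientGroup.mk_surjective isOpen_univ (A.adGr_smooth i X)
  refine ⟨hsm, fun v hv => ?_⟩
  -- The tangent vector `v` is lifted to the Lie algebra of `P`, where the derivative of `Ad_gr` is
  -- the bracket.
  obtain ⟨a, ha⟩ := hP.mfderiv_surjective 1 v
  have hlie : ∀ i : ℤ, i < 0 → ∀ Z ∈ A.S.F i, ⁅A.ι a, Z⁆ ∈ A.S.F (i + 1) := fun i hi Z hZ => by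
    have h1 := derivAlong_comp (f := fun g => (A.beta g).1 ⟨i, hi⟩ (Gr.mk hZ))
      (g := (QuotientGroup.mk : P → P ⧸ A.Pplus)) (x := 1)
      ((hsm ⟨i, hi⟩ (Gr.mk hZ)).weakDiffAt Filter.univ_mem)
      ((hP.smooth 1).mdifferentiableAt (by simp)) a
    have h2 : derivAlong E_P (fun g => A.adGr i g (Gr.mk hZ)) 1 a = 0 := by
      refine (h1.trans ?_).trans (hv ⟨i, hi⟩ (Gr.mk hZ))
      exact congrArg (derivAlong F (fun g => (A.beta g).1 ⟨i, hi⟩ (Gr.mk hZ)) 1) ha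
    rw [A.derivAlong_adGr i a hZ, Gr.proj_apply (A.lie_ι_mem a hZ), Gr.mk_eq_zero_iff] at h2
    exact h2
  -- Condition (B). The slice map then kills `a`, hence so does the quotient map, and the image `v`
  -- of `a` is zero.
  have hone : A.ι a ∈ A.S.F 1 := A.mem_one _ (A.ι_mem a) fun i _ hi Z hZ =>
    hlie i (by omega) Z hZ
  exact ha.symm.trans (D.md_eq_zero hP.smooth (hD a hone))

/-- The quotient of a regular Cartan geometry by `P_+` is a filtered structure. -/
theorem IsCartanGeometry.isFilteredStructure [LieGroup 𝓘(ℝ, E_P) ∞ P]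
    {A : AdmissiblePair 𝔤 E_P P μ ν}
    {E_M : Type*} [NormedAddCommGroup E_M] [NormedSpace ℝ E_M] [FiniteDimensional ℝ E_M]
    {M : Type*} [TopologicalSpace M] [ChartedSpace E_M M] [IsManifold 𝓘(ℝ, E_M) ∞ M]
    {E_B : Type*} [NormedAddCommGroup E_B] [NormedSpace ℝ E_B] [FiniteDimensional ℝ E_B]
    {B : Type*} [TopologicalSpace B] [ChartedSpace E_B B] [IsManifold 𝓘(ℝ, E_B) ∞ B]
    [MulAction Pᵐᵒᵖ B] {π : B → M} {θ : ∀ u : B, TangentSpace 𝓘(ℝ, E_B) u →ₗ[ℝ] 𝔤}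
    (hθ : IsCartanGeometry A (E_M := E_M) π θ) (hreg : IsRegular A.S θ)
    {F : Type*} [NormedAddCommGroup F] [NormedSpace ℝ F] [ChartedSpace F (P ⧸ A.Pplus)]
    {F' : Type*} [NormedAddCommGroup F'] [NormedSpace ℝ F']
    [ChartedSpace F' (OrbitSpace A.Pplus B)]
    (hP : HasSmoothSections E_P F (QuotientGroup.mk : P → P ⧸ A.Pplus))
    (hB : HasSmoothSections E_B F' (OrbitSpace.mk A.Pplus : B → OrbitSpace A.Pplus B))
    (hβ : IsInfInjective F A.S A.beta) :
    IsFilteredStructure E_M F' F A.S hθ.filtration A.beta (OrbitSpace.proj hθ.principal)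
      (hθ.orbitFrame hreg) where
  infInjective := hβ
  principal := OrbitSpace.isPrincipalBundle hθ.principal hP hB
  covers w := by
    obtain ⟨u, rfl⟩ := OrbitSpace.mk_surjective w
    rfl
  equivariant := hθ.orbitFrame_smul hreg
  smooth V φ hφ i X := hB.smoothOn_of_comp OrbitSpace.mk_surjective
    (hφ.isOpen.preimage (OrbitSpace.contMDiff_proj hθ.principal hB).continuous)
    (hθ.smoothOn_triv_grEquiv hφ i X)

end Underlying

end FilteredGeometry

theorem theorem2p4
    {𝔤 : Type*} [LieRing 𝔤] [LieAlgebra ℝ 𝔤] [FiniteDimensional ℝ 𝔤]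
    {E_P : Type*} [NormedAddCommGroup E_P] [NormedSpace ℝ E_P] [FiniteDimensional ℝ E_P]
    {P : Type*} [Group P] [TopologicalSpace P] [ChartedSpace E_P P] [LieGroup 𝓘(ℝ, E_P) ∞ P]
    [T2Space P] [SecondCountableTopology P]
    {μ ν : ℕ} (A : AdmissiblePair 𝔤 E_P P μ ν)
    {E_M : Type*} [NormedAddCommGroup E_M] [NormedSpace ℝ E_M] [FiniteDimensional ℝ E_M]
    {M : Type*} [TopologicalSpace M] [ChartedSpace E_M M] [IsManifold 𝓘(ℝ, E_M) ∞ M]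
    [T2Space M] [SecondCountableTopology M]
    {E_B : Type*} [NormedAddCommGroup E_B] [NormedSpace ℝ E_B] [FiniteDimensional ℝ E_B]
    {B : Type*} [TopologicalSpace B] [ChartedSpace E_B B] [IsManifold 𝓘(ℝ, E_B) ∞ B]
    [T2Space B] [SecondCountableTopology B] [MulAction Pᵐᵒᵖ B]
    (π : B → M) (θ : ∀ u : B, TangentSpace 𝓘(ℝ, E_B) u →ₗ[ℝ] 𝔤)
    (hθ : IsCartanGeometry A (E_M := E_M) π θ) (hreg : IsRegular A.S θ) :
    ∃ T : ℤ → ∀ x : M, Submodule ℝ (TangentSpace 𝓘(ℝ, E_M) x),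
      (∀ (i : ℤ) (u : B), T i (π u) =
        ((A.S.F i).comap (θ u)).map (mfderiv 𝓘(ℝ, E_B) 𝓘(ℝ, E_M) π u).toLinearMap) ∧
      IsFilteredManifold E_M μ T ∧
      IsRegularOfType E_M A.S T ∧
      ∃ (a b : ℕ) (_ : ChartedSpace (EuclideanSpace ℝ (Fin a)) (P ⧸ A.Pplus))
        (_ : ChartedSpace (EuclideanSpace ℝ (Fin b)) (OrbitSpace A.Pplus B))
        (π₀ : OrbitSpace A.Pplus B → M) (Φ : OrbitSpace A.Pplus B → FrameBundle E_M A.S T),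
        LieGroup 𝓘(ℝ, EuclideanSpace ℝ (Fin a)) ∞ (P ⧸ A.Pplus) ∧
        T2Space (P ⧸ A.Pplus) ∧ SecondCountableTopology (P ⧸ A.Pplus) ∧
        SmoothSubmersion E_P (EuclideanSpace ℝ (Fin a)) (QuotientGroup.mk : P → P ⧸ A.Pplus) ∧
        IsManifold 𝓘(ℝ, EuclideanSpace ℝ (Fin b)) ∞ (OrbitSpace A.Pplus B) ∧
        T2Space (OrbitSpace A.Pplus B) ∧ SecondCountableTopology (OrbitSpace A.Pplus B) ∧
        SmoothSubmersion E_B (EuclideanSpace ℝ (Fin b)) (OrbitSpace.mk A.Pplus : B → _) ∧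
        (∀ u : B, π₀ (OrbitSpace.mk A.Pplus u) = π u) ∧
        IsFilteredStructure E_M (EuclideanSpace ℝ (Fin b)) (EuclideanSpace ℝ (Fin a))
          A.S T A.beta π₀ Φ ∧
        ∀ u : B, ∃ f : GradedFrame E_M A.S T (π u),
          Φ (OrbitSpace.mk A.Pplus u) = ⟨π u, f⟩ ∧
          ∀ (i : NegInt) (ξ : TangentSpace 𝓘(ℝ, E_B) u) (hξ : θ u ξ ∈ A.S.F i),
            ∃ h : mfderiv 𝓘(ℝ, E_B) 𝓘(ℝ, E_M) π u ξ ∈ T i (π u),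
              f.toEquiv i (Gr.mk hξ) = Gr.mk (F := fun k => T k (π u)) h := by
  -- One slice at the identity of `P` serves three times: its translates give the manifold
  -- structures on `P / P_+` and on `B / P_+`, and its derivative at `1` gives the injectivity of
  -- the derivative of `β`.
  obtain ⟨a, D, hD⟩ := A.exists_slice
  obtain ⟨csP, hmP, hP⟩ := exists_manifold_quotientGroup (E_P := E_P) fun g => D.translate g
  obtain ⟨b, csB, hmB, hB⟩ := OrbitSpace.exists_manifold hθ.principal fun g => D.translate g
  have : IsTopologicalGroup P := topologicalGroup_of_lieGroup 𝓘(ℝ, E_P) ∞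
  have hN : IsClosed (A.Pplus : Set P) := A.isClosed_Pplus
  refine ⟨hθ.filtration, fun i u => (hθ.filtration_proj i u).trans (hθ.map_anchor i u),
    hθ.isFilteredManifold hreg, hθ.isRegularOfType hreg, a, b, csP, csB,
    OrbitSpace.proj hθ.principal, hθ.orbitFrame hreg, hP.lieGroup, inferInstance, inferInstance,
    ⟨hP.smooth, hP.mfderiv_surjective⟩, hmB, OrbitSpace.t2Space hN hθ.principal,
    OrbitSpace.secondCountableTopology hθ.principal, ⟨hB.smooth, hB.mfderiv_surjective⟩,
    fun u => rfl, hθ.isFilteredStructure hreg hP hB (A.isInfInjective_beta hP D hD),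
    fun u => ⟨hθ.gradedFrame hreg rfl, rfl, fun i ξ hξ => ?_⟩⟩
  have h := hθ.anchor_mem u hξ
  rw [hθ.anchor_form u ξ] at h
  exact ⟨h, hθ.grEquiv_mk rfl i hξ h (hθ.anchor_form u ξ)⟩
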